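/- **Setting.** A network is fed by points $N=\{T_n\}_{n\in\mathbb Z}$, $T_n\le T_{n+1}$, carrying marks $\{\zeta_n\}_{n\in\mathbb Z}$ in a measurable space $\mathbb K$. For $m\le n$, $X_{[m,n]}(N)=f_{n-m+1}(T_m,\dots,T_n;\zeta_m,\dots,\zeta_n)$, with measurable $f_l:\mathbb R^l\times\mathbb K^l\to\mathbb R$, is the time of last activity when the network starts empty and is fed by the points $T_m,\dots,T_n$ only. The network is *monotone separable* if for all nondecreasing sequences of points and all marks: $X_{[m,n]}(N)\ge T_n$; $X_{[m,n]}(N')\ge X_{[m,n]}(N)$ if $T'_i\ge T_i$ for all $i$; $X_{[m,n]}(c+N)=X_{[m,n]}(N)+c$ for $c\in\mathbb R$; and $X_{[m,n]}(N)=X_{[l+1,n]}(N)$ whenever $m\le l<n$ and $X_{[m,l]}(N)\le T_{l+1}$. Put $Z_{[m,n]}(N)=X_{[m,n]}(N)-T_n$, $\tau_n=T_{n+1}-T_n$, and let $Z=\lim_{n\to\infty}Z_{[-n,0]}(N)\in[0,\infty]$ be the stationary maximal dater. Let $Q$ be the input with all points equal to $0$. Assume that $a=\mathbf E\tau_n$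 and $\mathbf E Z_{[n,n]}$ are finite, put $b=\gamma(0)=\lim_{n\to\infty}\mathbf E Z_{[-n,-1]}(Q)/n$, and assume stability: $b<a$. Assume moreover: * (IA) the sequences $\{\tau_n\}$ and $\{\zeta_n\}$ are independent of each other and each is i.i.d. * (AA) $Z_{[i,i]}=Y_i^{(1)}+\dots+Y_i^{(r)}$ a.s. for all $i$, where the $Y_i^{(j)}$ are a.s. nonnegative random variables, the sequence of vectors $(Y_i^{(1)},\dots,Y_i^{(r)})$, $i\in\mathbb Z$, is i.i.d., independent of $\{\tau_n\}$ and jointly stationary with $\{\zeta_i\}$ (arbitrary dependence between the components of a vector is allowed), and $Z_{[n,0]}(Q)\ge\max_{1\le j\le r}\sum_{i=n}^0Y_i^{(j)}$ a.s. for all $n\le 0$. * (SE) $F$ is a subexponential distribution on $[0,\infty)$ with finite mean and tail $\overline F$; the integrated tail distribution $F^s$ on $[0,\infty)$, with tail $\overline F^s(x)=\min\{1,\int_x^\infty\overline F(u)\,du\}$, is subexponential; and $\mathbf P(Y_1^{(j)}>x)/\overline F(x)\to d^{(j)}$ as $x\to\infty$ for $j=1,\dots,r$, with $\sum_jd^{(j)}>0$.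 * (H) $\mathbf P(\sum_jY_1^{(j)}>x)\sim\mathbf P(\max_jY_1^{(j)}>x)\sim\sum_j\mathbf P(Y_1^{(j)}>x)$ as $x\to\infty$. Let $x\mapsto N_x$ be a nondecreasing function with values in the nonnegative integers such that $N_x\to\infty$ and $\sum_{n=0}^{N_x}\overline F(x+nc)=o(\overline F^s(x))$ as $x\to\infty$ for every $c\in\mathbb R$. **Theorem 8.** For $x\in\mathbb R$, $n\ge0$ and $j=1,\dots,r$, let $K_{n,x}^{(j)}$ be events such that (i) $K_{n,x}^{(j)}$ and $Y_{-n}^{(j)}$ are independent for all $n$, $x$ and $j$; (ii) for each $j$, $\mathbf P(K_{n,x}^{(j)})\to1$ uniformly in $n\ge N_x$ as $x\to\infty$. For $j=1,\dots,r$ let $(\eta_n^{(j)})_{n\ge0}$ be a real sequence tending to $0$. Put $$A_{n,x}^{(j)}=K_{n,x}^{(j)}\cap\{Y_{-n}^{(j)}>x+n(a-b+\eta_n^{(j)})\},\qquad A_x^{(j)}=\bigcup_{n\ge N_x}A_{n,x}^{(j)},\qquad A_x=\bigcup_{j=1}^rA_x^{(j)}.$$ Then the series $\sum_{n\ge N_x}\mathbf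 P(A_{n,x}^{(j)})$ converge and, as $x\to\infty$, $$\mathbf P(Z>x)\sim\mathbf P(Z>x,A_x)\sim\sum_{j=1}^r\mathbf P(Z>x,A_x^{(j)})\sim\sum_{j=1}^r\sum_{n\ge N_x}\mathbf P(Z>x,A_{n,x}^{(j)}).$$ Moreover, for any random variable $\tilde Z$ (extended real values allowed) with $\tilde Z\le Z$ a.s., $$\mathbf P(\tilde Z>x)=\mathbf P(\tilde Z>x,A_x)+o(\overline F^s(x))=\sum_{j=1}^r\mathbf P(\tilde Z>x,A_x^{(j)})+o(\overline F^s(x))=\sum_{j=1}^r\sum_{n\ge N_x}\mathbf P(\tilde Z>x,A_{n,x}^{(j)})+o(\overline F^s(x)),$$ and if $\mathbf P(\tilde Z>x)=\Theta(\overline F^s(x))$, then $$\mathbf P(\tilde Z>x)\sim\mathbf P(\tilde Z>x,A_x)\sim\sum_{j=1}^r\mathbf P(\tilde Z>x,A_x^{(j)})\sim\sum_{j=1}^r\sum_{n\ge N_x}\mathbf P(\tilde Z>x,A_{n,x}^{(j)}).$$ -/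

import Mathlib

open MeasureTheory ProbabilityTheory Filter Topology Asymptotics

namespace MonSep

noncomputable section

/-! ### Monotone-separable networks -/

/-- `X_{[m,n]}`: time of last activity of the network fed by the points `t m, …, t n` carrying the
marks `z m, …, z n`, obtained from the function `f_l` with `l = n - m + 1`. Used for `m ≤ n`. -/
def lastActivity {K : Type*} (f : (l : ℕ) → (Fin l → ℝ) → (Fin l → K) → ℝ)
    (m n : ℤ) (t : ℤ → ℝ) (z : ℤ → K) : ℝ :=
  f (n - m + 1).toNat (fun i => t (m + (i : ℕ))) (fun i => z (m + (i : ℕ)))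

/-- `Z_{[m,n]} = X_{[m,n]} - T_n`. -/
def dater {K : Type*} (f : (l : ℕ) → (Fin l → ℝ) → (Fin l → K) → ℝ)
    (m n : ℤ) (t : ℤ → ℝ) (z : ℤ → K) : ℝ :=
  lastActivity f m n t z - t n

/-- The four axioms of a monotone-separable network, required for every nondecreasing sequence of
points (simultaneous arrivals are allowed) and all marks, and measurability of the `f_l`. -/
structure MonotoneSeparable {K : Type*} [MeasurableSpace K]
    (f : (l : ℕ) → (Fin l → ℝ) → (Fin l → K) → ℝ) : Prop where
  measurable : ∀ l, Measurable fun p : (Fin l → ℝ) × (Fin l → K) => f l p.1 p.2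
  causality : ∀ (t : ℤ → ℝ) (z : ℤ → K) (m n : ℤ), Monotone t → m ≤ n →
    t n ≤ lastActivity f m n t z
  external_monotonicity : ∀ (t t' : ℤ → ℝ) (z : ℤ → K) (m n : ℤ), Monotone t → Monotone t' →
    (∀ i, t i ≤ t' i) → m ≤ n → lastActivity f m n t z ≤ lastActivity f m n t' z
  homogeneity : ∀ (t : ℤ → ℝ) (z : ℤ → K) (c : ℝ) (m n : ℤ), Monotone t → m ≤ n →
    lastActivity f m n (fun i => c + t i) z = lastActivity f m n t z + c
  separability : ∀ (t : ℤ → ℝ) (z : ℤ → K) (m l n : ℤ), Monotone t → m ≤ l → l < n →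
    lastActivity f m l t z ≤ t (l + 1) → lastActivity f m n t z = lastActivity f (l + 1) n t z

/-! ### Stochastic setting -/

/-- `τ_n = T_{n+1} - T_n`. -/
def interarrival {Ω : Type*} (T : ℤ → Ω → ℝ) (n : ℤ) (ω : Ω) : ℝ := T (n + 1) ω - T n ω

/-- The stationary maximal dater `Z = lim_{n → ∞} Z_{[-n,0]}`, with values in the extended reals
(the sequence is nondecreasing in a monotone-separable network, so that the limit exists). -/
def maximalDater {Ω K : Type*} (f : (l : ℕ) → (Fin l → ℝ) → (Fin l → K) → ℝ)
    (T : ℤ → Ω → ℝ) (ζ : ℤ → Ω → K) (ω : Ω) : EReal :=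
  limUnder atTop fun n : ℕ =>
    ((dater f (-(n : ℤ)) 0 (fun i => T i ω) (fun i => ζ i ω) : ℝ) : EReal)

/-- `γ(0) = lim_{n → ∞} E Z_{[-n,-1]}(Q) / n`, where all the points of `Q` are at `0`
(the expectations are subadditive in `n`, so that the limit exists). -/
def gammaZero {Ω K : Type*} [MeasurableSpace Ω] (P : Measure Ω)
    (f : (l : ℕ) → (Fin l → ℝ) → (Fin l → K) → ℝ) (ζ : ℤ → Ω → K) : ℝ :=
  limUnder atTop fun n : ℕ =>
    (∫ ω, dater f (-(n : ℤ)) (-1) (fun _ => 0) (fun i => ζ i ω) ∂P) / (n : ℝ)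

/-- Random input points and marks of the network, with finite means of `τ_n` and `Z_n`. -/
structure NetworkInput {Ω K : Type*} [MeasurableSpace Ω] [MeasurableSpace K] (P : Measure Ω)
    (f : (l : ℕ) → (Fin l → ℝ) → (Fin l → K) → ℝ)
    (T : ℤ → Ω → ℝ) (ζ : ℤ → Ω → K) : Prop where
  measurable_points : ∀ n, Measurable (T n)
  measurable_marks : ∀ n, Measurable (ζ n)
  monotone_points : ∀ ω, Monotone fun n => T n ω
  integrable_interarrival : ∀ n, Integrable (interarrival T n) P
  integrable_dater : ∀ n, Integrable (fun ω => dater f n n (fun i => T i ω) (fun i => ζ i ω)) P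

/-- (IA): the sequences `ζ` and `τ` are independent of each other, and each is i.i.d. -/
structure IA {Ω K : Type*} [MeasurableSpace Ω] [MeasurableSpace K] (P : Measure Ω)
    (T : ℤ → Ω → ℝ) (ζ : ℤ → Ω → K) : Prop where
  indep_interarrival : iIndepFun (interarrival T) P
  ident_interarrival : ∀ n, IdentDistrib (interarrival T n) (interarrival T 0) P P
  indep_marks : iIndepFun ζ P
  ident_marks : ∀ n, IdentDistrib (ζ n) (ζ 0) P P
  indep : IndepFun (fun ω n => interarrival T n ω) (fun ω n => ζ n ω) P

/-- (AA), where `Y j i` stands for `Y_i^{(j)}`. The vectors `(Y_i^{(1)}, …, Y_i^{(r)})` are i.i.d.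
in `i`, with arbitrary dependence between the components, and jointly stationary with the marks. -/
structure AA {Ω K : Type*} [MeasurableSpace Ω] [MeasurableSpace K] (P : Measure Ω)
    (f : (l : ℕ) → (Fin l → ℝ) → (Fin l → K) → ℝ)
    (T : ℤ → Ω → ℝ) (ζ : ℤ → Ω → K) {r : ℕ} (Y : Fin r → ℤ → Ω → ℝ) : Prop where
  measurable : ∀ j i, Measurable (Y j i)
  nonneg : ∀ j i, ∀ᵐ ω ∂P, 0 ≤ Y j i ω
  indep_interarrival : IndepFun (fun ω n => interarrival T n ω) (fun ω i j => Y j i ω) P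
  indep : iIndepFun (fun (i : ℤ) ω j => Y j i ω) P
  ident : ∀ i, IdentDistrib (fun ω j => Y j i ω) (fun ω j => Y j 0 ω) P P
  stationary : IdentDistrib (fun ω (i : ℤ) => (ζ (i + 1) ω, fun j => Y j (i + 1) ω))
    (fun ω (i : ℤ) => (ζ i ω, fun j => Y j i ω)) P P
  dater_eq_sum : ∀ i, ∀ᵐ ω ∂P,
    dater f i i (fun k => T k ω) (fun k => ζ k ω) = ∑ j, Y j i ω
  sum_le_dater : ∀ n : ℤ, n ≤ 0 → ∀ᵐ ω ∂P, ∀ j,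
    ∑ i ∈ Finset.Icc n 0, Y j i ω ≤ dater f n 0 (fun _ => 0) (fun k => ζ k ω)

/-! ### Tails -/

/-- The tail `x ↦ ν (x, ∞)`. -/
def tail (ν : Measure ℝ) (x : ℝ) : ℝ := ν.real (Set.Ioi x)

/-- Subexponential distribution on `[0, ∞)`. -/
structure Subexponential (ν : Measure ℝ) : Prop where
  prob : IsProbabilityMeasure ν
  nonneg : ν (Set.Iio 0) = 0
  tail_pos : ∀ x, 0 < tail ν x
  tendsto : Tendsto (fun x => tail (Measure.conv ν ν) x / tail ν x) atTop (𝓝 2)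

/-- The tail `min {1, ∫_x^∞ F̄(u) du}` of the integrated tail distribution `F^s` of `F`,
for `x ≥ 0`. -/
def integratedTail (F : Measure ℝ) (x : ℝ) : ℝ := min 1 (∫ u in Set.Ioi x, tail F u)

/-- (SE): `F` and `F^s` are subexponential, `F` has a finite mean, and
`P(Y_1^{(j)} > x) ∼ d^{(j)} F̄(x)` with `∑ d^{(j)} > 0` (where `∼ 0` means `o`). -/
structure SE {Ω : Type*} [MeasurableSpace Ω] (P : Measure Ω) (F : Measure ℝ)
    {r : ℕ} (Y : Fin r → ℤ → Ω → ℝ) (d : Fin r → ℝ) : Prop where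
  subexp : Subexponential F
  finite_mean : Integrable (fun x => x) F
  subexp_integrated : ∃ ν : Measure ℝ, Subexponential ν ∧ ∀ x, 0 ≤ x → tail ν x = integratedTail F x
  tail_equiv : ∀ j, Tendsto (fun x => P.real {ω | x < Y j 1 ω} / tail F x) atTop (𝓝 (d j))
  sum_pos : 0 < ∑ j, d j

/-- (H): `P(∑_j Y_1^{(j)} > x) ∼ P(max_j Y_1^{(j)} > x) ∼ ∑_j P(Y_1^{(j)} > x)`. -/
structure HypH {Ω : Type*} [MeasurableSpace Ω] (P : Measure Ω)
    {r : ℕ} (Y : Fin r → ℤ → Ω → ℝ) : Prop where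
  sum_equiv_max : (fun x : ℝ => P.real {ω | x < ∑ j, Y j 1 ω}) ~[atTop]
    (fun x : ℝ => P.real {ω | ∃ j, x < Y j 1 ω})
  max_equiv_sum : (fun x : ℝ => P.real {ω | ∃ j, x < Y j 1 ω}) ~[atTop]
    (fun x : ℝ => ∑ j, P.real {ω | x < Y j 1 ω})

/-- A nondecreasing integer-valued function `N_x → ∞` such that
`∑_{n=0}^{N_x} F̄(x + n c) = o(F̄^s(x))` for every real `c`. -/
structure TruncationLevel (F : Measure ℝ) (N : ℝ → ℕ) : Prop where
  mono : Monotone N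
  tendsto : Tendsto N atTop atTop
  negligible : ∀ c : ℝ,
    (fun x : ℝ => ∑ n ∈ Finset.range (N x + 1), tail F (x + (n : ℝ) * c)) =o[atTop]
      integratedTail F

/-! ### The typical event -/

/-- `A_{n,x}^{(j)} = K_{n,x}^{(j)} ∩ {Y_{-n}^{(j)} > x + n (a - b + η_n^{(j)})}`. -/
def typicalEvent {Ω : Type*} {r : ℕ} (Y : Fin r → ℤ → Ω → ℝ) (K : Fin r → ℕ → ℝ → Set Ω)
    (η : Fin r → ℕ → ℝ) (a b : ℝ) (j : Fin r) (n : ℕ) (x : ℝ) : Set Ω :=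
  K j n x ∩ {ω | x + (n : ℝ) * (a - b + η j n) < Y j (-(n : ℤ)) ω}

end

end MonSep

open MonSep

open scoped ENNReal

/-! The maximal dater exceeds a high level essentially only because one component of one service
time is huge. The core estimate is that $\{Z>x\}$ without the typical event $A_x$ has probability
$o(\overline F^s(x))$; this is `negligible_exceed_diff_typical`.

Delaying every point to the last point of its batch of $L$ points turns the network into a
single-server queue (`MonotoneSeparable.dater_le_of_batches`), so $Z$ is at most the supremum of a
random walk. Its increments are saturated batch daters minus the times between batches. Since
$\mathbf E Z_{[-L,-1]}(Q)/L\to b$, a suitable $L$ makes the mean increment smaller than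
$-L(a-b-\delta)$. Such a walk exceeds $x$ only through one big increment
(`DescendingWalk.exists_measure_exceed_without_jump_le`). The proof looks at the first passage above
a line $A-nm$: passage is rare for large $A$, the walk restarts independently afterwards, and two
moderate contributions are negligible by subexponentiality.

A big increment forces a big sum of the $Y$ in one batch, hence by subexponentiality and (H) one
component $Y^{(j)}_{-l}>x-\mathrm{const}+l(a-b-\delta)$ (`negligible_block`). Then $A_x$ occurs
unless $l<N_x$, which the truncation condition makes negligible, or $K^{(j)}_{l,x}$ fails, which
independence and uniformity make negligible, or $Y^{(j)}_{-l}$ lies between the lines of slopes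
$a-b\mp\delta$, which costs a fraction of $\overline F^s(x)$ that is small with $\delta$
(`IntegratedPair.exists_tsum_sub_le`).

If $\tilde Z\le Z$, the event $\{\tilde Z>x\}\setminus A_x$ is almost surely contained in
$\{Z>x\}\setminus A_x$, so the same estimate serves $\tilde Z$. Replacing the probability of the
union by sums costs at most the pairs of simultaneous exceedances, which are negligible
(`negligible_pairSum`). Finally $\overline F^s(x)=O(\mathbf P(Z>x))$, because $Z\ge
Y^{(j)}_{-n}-(T_0-T_{-n})$ and the span $T_0-T_{-n}$ is independent of the $Y$
(`exists_le_mul_measure_maximalDater`); this turns the $o(\overline F^s)$ errors into equivalences.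
-/

namespace MonSep

/-! ### Negligibility relative to a tail. -/

/-- `f x` is negligible with respect to the tail `ν (x, ∞)` as `x → ∞`. -/
def Negligible (ν : Measure ℝ) (f : ℝ → ℝ≥0∞) : Prop :=
  ∀ ε : ℝ≥0∞, ε ≠ 0 → ∀ᶠ x in atTop, f x ≤ ε * ν (Set.Ioi x)

namespace Negligible

variable {ν : Measure ℝ} {f g : ℝ → ℝ≥0∞}

theorem mono (hg : Negligible ν g) (h : ∀ᶠ x in atTop, f x ≤ g x) : Negligible ν f :=
  fun ε hε => (h.and (hg ε hε)).mono fun _ hx => hx.1.trans hx.2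

theorem zero : Negligible ν fun _ => 0 := fun _ _ => Eventually.of_forall fun _ => zero_le

theorem add (hf : Negligible ν f) (hg : Negligible ν g) : Negligible ν fun x => f x + g x := by
  intro ε hε
  filter_upwards [hf (ε / 2) (by simpa using hε), hg (ε / 2) (by simpa using hε)] with x h1 h2
  calc f x + g x ≤ ε / 2 * ν (Set.Ioi x) + ε / 2 * ν (Set.Ioi x) := add_le_add h1 h2
    _ = ε * ν (Set.Ioi x) := by rw [← add_mul, ENNReal.add_halves]

theorem const_mul (hf : Negligible ν f) {C : ℝ≥0∞} (hC : C ≠ ∞) :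
    Negligible ν fun x => C * f x := by
  intro ε hε
  rcases eq_or_ne C 0 with rfl | h0
  · simp
  filter_upwards [hf (ε / C) (by simp [hε, hC])] with x hx
  calc C * f x ≤ C * (ε / C * ν (Set.Ioi x)) := by gcongr
    _ = ε * ν (Set.Ioi x) := by rw [← mul_assoc, ENNReal.mul_div_cancel h0 hC]

theorem sum {ι : Type*} {s : Finset ι} {f : ι → ℝ → ℝ≥0∞} (h : ∀ i ∈ s, Negligible ν (f i)) :
    Negligible ν fun x => ∑ i ∈ s, f i x := by
  classical
  induction s using Finset.induction_on with
  | empty => simpa using zero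
  | insert i s hi ih =>
    simp only [Finset.sum_insert hi]
    exact (h i (by simp)).add (ih fun j hj => h j (by simp [hj]))

theorem isLittleO [IsFiniteMeasure ν] (hf : Negligible ν f) :
    (fun x => (f x).toReal) =o[atTop] tail ν := by
  rw [isLittleO_iff]
  intro c hc
  filter_upwards [hf (ENNReal.ofReal c) (by simpa using hc)] with x hx
  have h1 : ENNReal.ofReal c * ν (Set.Ioi x) ≠ ∞ :=
    ENNReal.mul_ne_top ENNReal.ofReal_ne_top (measure_ne_top _ _)
  have h2 := ENNReal.toReal_mono h1 hx
  rw [ENNReal.toReal_mul, ENNReal.toReal_ofReal hc.le] at h2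
  simpa [tail, Measure.real, abs_of_nonneg] using h2

theorem of_tendsto [IsFiniteMeasure ν] (hpos : ∀ x, 0 < tail ν x) {f : ℝ → ℝ≥0∞}
    (hf : ∀ x, f x ≠ ∞)
    (h : Tendsto (fun x => (f x).toReal / tail ν x) atTop (𝓝 0)) : Negligible ν f := by
  intro ε hε
  rcases eq_or_ne ε ∞ with rfl | hε'
  · refine Eventually.of_forall fun x => ?_
    have : ν (Set.Ioi x) ≠ 0 := fun h0 => by simpa [tail, Measure.real, h0] using hpos x
    rw [ENNReal.top_mul this]; exact le_top
  have : 0 < ε.toReal := ENNReal.toReal_pos hε hε'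
  filter_upwards [h.eventually_lt_const this] with x hx
  rw [div_lt_iff₀ (hpos x)] at hx
  rw [← ENNReal.toReal_le_toReal (hf x) (ENNReal.mul_ne_top hε' (measure_ne_top _ _)),
    ENNReal.toReal_mul]
  exact hx.le

end Negligible

theorem tail_antitone (ν : Measure ℝ) [IsFiniteMeasure ν] : Antitone (tail ν) := fun _ _ h =>
  measureReal_mono (Set.Ioi_subset_Ioi h)

theorem tail_nonneg (ν : Measure ℝ) (x : ℝ) : 0 ≤ tail ν x := measureReal_nonneg

theorem ofReal_tail (ν : Measure ℝ) [IsFiniteMeasure ν] (x : ℝ) :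
    ENNReal.ofReal (tail ν x) = ν (Set.Ioi x) := ofReal_measureReal

theorem tendsto_measure_Ioi_atTop (ν : Measure ℝ) [IsFiniteMeasure ν] :
    Tendsto (fun x => ν (Set.Ioi x)) atTop (𝓝 0) := by
  have h := tendsto_measure_iInter_atTop (μ := ν) (s := fun x : ℝ => Set.Ioi x)
    (fun x => measurableSet_Ioi.nullMeasurableSet) (fun x y h => Set.Ioi_subset_Ioi h)
    ⟨0, measure_ne_top _ _⟩
  have : (⋂ x : ℝ, Set.Ioi x) = ∅ := by
    ext y; simp only [Set.mem_iInter, Set.mem_Ioi, Set.mem_empty_iff_false, iff_false, not_forall,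
      not_lt]; exact ⟨y, le_rfl⟩
  rw [this, measure_empty] at h
  exact h

theorem tendsto_tail_atTop (ν : Measure ℝ) [IsFiniteMeasure ν] :
    Tendsto (tail ν) atTop (𝓝 0) := by
  have := (ENNReal.tendsto_toReal ENNReal.zero_ne_top).comp (tendsto_measure_Ioi_atTop ν)
  rw [ENNReal.toReal_zero] at this
  exact this

/-! ### Subexponential laws: long tails and moderate summands. -/

namespace Subexponential

variable {ν : Measure ℝ}

theorem measure_Ioi_ne_zero (h : Subexponential ν) (x : ℝ) : ν (Set.Ioi x) ≠ 0 := fun h0 => by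
  simpa [tail, Measure.real, h0] using h.tail_pos x

theorem eventually_prod_le (h : Subexponential ν) {ε : ℝ} (hε : 0 < ε) :
    ∀ᶠ x in atTop, (ν.prod ν).real {p | x < p.1 + p.2} ≤ (2 + ε) * tail ν x := by
  have := h.prob
  filter_upwards [h.tendsto.eventually_lt_const (show (2 : ℝ) < 2 + ε by linarith)] with x hx
  rw [div_lt_iff₀ (h.tail_pos x)] at hx
  have h1 : tail (Measure.conv ν ν) x = (ν.prod ν).real {p | x < p.1 + p.2} := by
    rw [tail, Measure.real, Measure.real, Measure.conv,
      Measure.map_apply (by fun_prop) measurableSet_Ioi]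
    rfl
  linarith

theorem real_Icc_add (h : Subexponential ν) {B : ℝ} (hB : 0 ≤ B) :
    ν.real (Set.Icc 0 B) + tail ν B = 1 := by
  have := h.prob
  have h1 : ν.real (Set.Ici 0) = 1 := by
    have : ν (Set.Ici (0 : ℝ))ᶜ = 0 := by rw [Set.compl_Ici]; exact h.nonneg
    rw [Measure.real, (prob_compl_eq_zero_iff measurableSet_Ici).1 this, ENNReal.toReal_one]
  rw [tail, ← measureReal_union (Set.disjoint_left.2 fun z (hz : z ∈ Set.Icc _ _) (hz' : z ∈ Set.Ioi _) => not_lt.2 hz.2 hz')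
    measurableSet_Ioi, Set.Icc_union_Ioi_eq_Ici hB, h1]

/-- A subexponential law is long-tailed. -/
theorem eventually_tail_sub_le (h : Subexponential ν) (B : ℝ) {ε : ℝ} (hε : 0 < ε) :
    ∀ᶠ x in atTop, tail ν (x - B) ≤ (1 + ε) * tail ν x := by
  have := h.prob
  wlog hB : 0 ≤ B generalizing B
  · refine Eventually.of_forall fun x => ?_
    have h1 := tail_antitone ν (show x ≤ x - B by linarith)
    nlinarith [tail_nonneg ν x]
  set t := tail ν B with ht
  have htpos : 0 < t := h.tail_pos B
  have hT := (tendsto_tail_atTop ν).eventually_lt_const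
    (show 0 < t * ε / 2 / (1 + ε) by positivity)
  filter_upwards [h.eventually_prod_le (show 0 < t * ε / 2 by positivity), hT,
    eventually_ge_atTop B] with x hx hT hxB
  -- Three disjoint pieces of $\{u+v>x\}$. With $p=\overline\nu(x)$ and $q=\overline\nu(x-B)$ their
  -- masses add up to $(1-t)p+p+(t-p)q\le(2+t\varepsilon/2)p$. Hence $(t-p)q\le
  -- t(1+\varepsilon/2)p$, and `hT` makes $p$ small enough against $t$ to conclude.
  set S1 : Set (ℝ × ℝ) := Set.Icc 0 B ×ˢ Set.Ioi x
  set S2 : Set (ℝ × ℝ) := Set.Ioi x ×ˢ Set.Ici 0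
  set S3 : Set (ℝ × ℝ) := Set.Ioc B x ×ˢ Set.Ioi (x - B)
  have hm2 : MeasurableSet S2 := measurableSet_Ioi.prod measurableSet_Ici
  have hm3 : MeasurableSet S3 := measurableSet_Ioc.prod measurableSet_Ioi
  have hd : Disjoint S1 S2 := Set.disjoint_left.2 fun p h1 h2 =>
    absurd h1.1.2 (not_le.2 (lt_of_le_of_lt hxB h2.1))
  have hd' : Disjoint (S1 ∪ S2) S3 := by
    refine Set.disjoint_left.2 ?_
    rintro p (h1 | h1) h2
    · exact absurd h1.1.2 (not_le.2 h2.1.1)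
    · exact absurd h2.1.2 (not_le.2 h1.1)
  have hsub : S1 ∪ S2 ∪ S3 ⊆ {p | x < p.1 + p.2} := by
    rintro ⟨u, v⟩ ((⟨⟨h1, h2⟩, h3⟩ | ⟨h1, h2⟩) | ⟨⟨h1, h2⟩, h3⟩) <;>
      simp only [Set.mem_Ioi, Set.mem_Ici, Set.mem_ofPred_eq] at * <;> linarith
  have h1 := (measureReal_mono hsub (measure_ne_top (ν.prod ν) _)).trans hx
  rw [measureReal_union hd' hm3, measureReal_union hd hm2, measureReal_prod_prod,
    measureReal_prod_prod, measureReal_prod_prod] at h1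
  have h2 : ν.real (Set.Ici 0) = 1 := by
    have : ν (Set.Ici (0 : ℝ))ᶜ = 0 := by rw [Set.compl_Ici]; exact h.nonneg
    rw [Measure.real, (prob_compl_eq_zero_iff measurableSet_Ici).1 this, ENNReal.toReal_one]
  have h3 := h.real_Icc_add hB
  have h4 : ν.real (Set.Ioc B x) + tail ν x = t := by
    rw [ht, tail, tail, ← measureReal_union (Set.disjoint_left.2 fun z (hz : z ∈ Set.Ioc _ _) (hz' : z ∈ Set.Ioi _) => not_lt.2 hz.2 hz')
      measurableSet_Ioi, Set.Ioc_union_Ioi_eq_Ioi hxB]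
  change _ * tail ν x + tail ν x * _ + _ * tail ν (x - B) ≤ _ at h1
  rw [h2, show ν.real (Set.Icc 0 B) = 1 - t by linarith,
    show ν.real (Set.Ioc B x) = t - tail ν x by linarith] at h1
  rw [lt_div_iff₀ (by positivity)] at hT
  by_contra hcon
  push Not at hcon
  have hp := h.tail_pos x
  have h5 : (t - tail ν x) * tail ν (x - B) ≤ (t * ε / 2 + t) * tail ν x := by linarith
  have h6 : 0 < t - tail ν x := by nlinarith
  have h7 : (t - tail ν x) * ((1 + ε) * tail ν x) < (t - tail ν x) * tail ν (x - B) := by gcongr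
  have h8 : (t - tail ν x) * (1 + ε) * tail ν x < (t * ε / 2 + t) * tail ν x := by linarith
  have h9 := lt_of_mul_lt_mul_right h8 hp.le
  nlinarith

theorem _root_.MonSep.measurableSet_middle (B x : ℝ) :
    MeasurableSet {p : ℝ × ℝ | (B < p.1 ∧ p.1 ≤ x - B) ∧ x < p.1 + p.2} := by
  have h1 : MeasurableSet {p : ℝ × ℝ | B < p.1} := measurableSet_lt (by fun_prop) (by fun_prop)
  have h2 : MeasurableSet {p : ℝ × ℝ | p.1 ≤ x - B} :=
    measurableSet_le (by fun_prop) (by fun_prop)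
  have h3 : MeasurableSet {p : ℝ × ℝ | x < p.1 + p.2} :=
    measurableSet_lt (by fun_prop) (by fun_prop)
  exact (h1.inter h2).inter h3

/-- A sum of two independent variables is rarely large because of two moderate summands. -/
theorem eventually_middle_le (h : Subexponential ν) {ε : ℝ} (hε : 0 < ε) :
    ∃ B₀ : ℝ, ∀ B, B₀ ≤ B → ∀ᶠ x in atTop,
      (ν.prod ν).real {p | (B < p.1 ∧ p.1 ≤ x - B) ∧ x < p.1 + p.2} ≤ ε * tail ν x := by
  have := h.prob
  obtain ⟨B₀, hB₀⟩ := eventually_atTop.1 ((tendsto_tail_atTop ν).eventually_lt_const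
    (show (0 : ℝ) < ε / 4 by positivity))
  refine ⟨max B₀ 0, fun B hB => ?_⟩
  have ht := hB₀ B ((le_max_left _ _).trans hB)
  have hB0 : 0 ≤ B := (le_max_right _ _).trans hB
  filter_upwards [h.eventually_prod_le (show 0 < ε / 2 by positivity),
    eventually_gt_atTop (2 * B)] with x hx hxB
  -- `S1` and `S2` already carry $2(1-\overline\nu(B))\overline\nu(x)$ of the at most
  -- $(2+\varepsilon/2)\overline\nu(x)$ available; as $\overline\nu(B)<\varepsilon/4$, at most
  -- $\varepsilon\overline\nu(x)$ remains for `S3`.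
  set S1 : Set (ℝ × ℝ) := Set.Icc 0 B ×ˢ Set.Ioi x
  set S2 : Set (ℝ × ℝ) := Set.Ioi x ×ˢ Set.Icc 0 B
  set S3 : Set (ℝ × ℝ) := {p | (B < p.1 ∧ p.1 ≤ x - B) ∧ x < p.1 + p.2}
  have hm2 : MeasurableSet S2 := measurableSet_Ioi.prod measurableSet_Icc
  have hm3 : MeasurableSet S3 := measurableSet_middle B x
  have hd : Disjoint S1 S2 := Set.disjoint_left.2 fun p h1 h2 => by
    have := h1.1.2; have := h2.1; simp only [Set.mem_Ioi] at this; linarith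
  have hd' : Disjoint (S1 ∪ S2) S3 := by
    refine Set.disjoint_left.2 ?_
    rintro p (h1 | h1) ⟨⟨h2, h3⟩, h4⟩
    · exact absurd h1.1.2 (not_le.2 h2)
    · have := h1.1; simp only [Set.mem_Ioi] at this; linarith
  have hsub : S1 ∪ S2 ∪ S3 ⊆ {p | x < p.1 + p.2} := by
    rintro ⟨u, v⟩ ((⟨⟨h1, h2⟩, h3⟩ | ⟨h3, h1, h2⟩) | ⟨⟨h1, h2⟩, h3⟩) <;>
      simp only [Set.mem_Ioi, Set.mem_ofPred_eq] at * <;> linarith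
  have h1 := (measureReal_mono hsub (measure_ne_top (ν.prod ν) _)).trans hx
  rw [measureReal_union hd' hm3, measureReal_union hd hm2, measureReal_prod_prod,
    measureReal_prod_prod] at h1
  have h3 := h.real_Icc_add hB0
  change _ * tail ν x + tail ν x * _ + _ ≤ _ at h1
  rw [show ν.real (Set.Icc 0 B) = 1 - tail ν B by linarith] at h1
  have hp := h.tail_pos x
  nlinarith

end Subexponential

/-- Only the tails of `H` are compared with those of `ν`, so Fubini is used to integrate over `H`
first: each section in $y$ lies in a half-line, where the tail bound applies. A second use of Fubini
returns to $\nu\otimes\nu$. The product term comes from the sections at $u>x-B$, where only $y>B$ is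
retained. -/
theorem setLIntegral_tail_le {ν : Measure ℝ} [IsProbabilityMeasure ν] {H : Measure ℝ} [SFinite H]
    {C : ℝ≥0∞} {B x : ℝ} (hH : ∀ y, B ≤ y → H (Set.Ioi y) ≤ C * ν (Set.Ioi y)) :
    ∫⁻ y in Set.Ioc B (x - B), ν (Set.Ioi (x - y)) ∂H ≤
      C * ((ν.prod ν) {p | (B < p.1 ∧ p.1 ≤ x - B) ∧ x < p.1 + p.2}
        + ν (Set.Ioi B) * ν (Set.Ioi (x - B))) := by
  set S : Set (ℝ × ℝ) := {p | (B < p.1 ∧ p.1 ≤ x - B) ∧ x < p.1 + p.2}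
  have hm : MeasurableSet S := measurableSet_middle B x
  have h1 : ∫⁻ y in Set.Ioc B (x - B), ν (Set.Ioi (x - y)) ∂H = (H.prod ν) S := by
    rw [Measure.prod_apply hm, ← lintegral_indicator measurableSet_Ioc]
    refine lintegral_congr fun y => ?_
    by_cases hy : y ∈ Set.Ioc B (x - B)
    · rw [Set.indicator_of_mem hy]
      congr 1; ext u
      simp only [Set.mem_Ioi, Set.mem_preimage, S, Set.mem_ofPred_eq]
      exact ⟨fun h => ⟨hy, by linarith⟩, fun h => by linarith [h.2]⟩
    · rw [Set.indicator_of_notMem hy, eq_comm]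
      convert measure_empty (μ := ν)
      ext u
      simp only [Set.mem_preimage, S, Set.mem_ofPred_eq, Set.mem_empty_iff_false, iff_false]
      exact fun h => hy h.1
  rw [h1, Measure.prod_apply_symm hm]
  have h2 : ∀ u, H ((fun y => (y, u)) ⁻¹' S) ≤
      (Set.Ioc B (x - B)).indicator (fun u => C * ν (Set.Ioi (x - u))) u +
      (Set.Ioi (x - B)).indicator (fun _ => C * ν (Set.Ioi B)) u := by
    intro u
    rcases le_or_gt u B with hu | hu
    · refine le_of_eq_of_le ?_ zero_le
      convert measure_empty (μ := H)
      ext y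
      simp only [Set.mem_preimage, S, Set.mem_ofPred_eq, Set.mem_empty_iff_false, iff_false]
      rintro ⟨⟨h1, h2⟩, h3⟩; linarith
    rcases le_or_gt u (x - B) with hu' | hu'
    · rw [Set.indicator_of_mem (show u ∈ Set.Ioc B (x - B) from ⟨hu, hu'⟩)]
      refine le_add_right ?_
      refine (measure_mono ?_).trans (hH (x - u) (by linarith))
      rintro y ⟨_, h3⟩
      simp only [Set.mem_Ioi] at *; linarith
    · rw [Set.indicator_of_mem (show u ∈ Set.Ioi (x - B) from hu')]
      refine le_add_left ?_
      refine (measure_mono ?_).trans (hH B le_rfl)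
      rintro y ⟨⟨h2, _⟩, _⟩
      exact h2
  have hmeas : Measurable fun u => ν (Set.Ioi (x - u)) := by
    refine Monotone.measurable fun u v huv => measure_mono (Set.Ioi_subset_Ioi (by linarith))
  refine (lintegral_mono h2).trans ?_
  rw [lintegral_add_left ((hmeas.const_mul C).indicator measurableSet_Ioc),
    lintegral_indicator measurableSet_Ioc, lintegral_indicator measurableSet_Ioi,
    lintegral_const_mul _ hmeas, setLIntegral_const, mul_add, mul_assoc]
  gcongr
  rw [Measure.prod_apply hm, ← lintegral_indicator measurableSet_Ioc]
  refine lintegral_mono fun y => ?_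
  by_cases hy : y ∈ Set.Ioc B (x - B)
  · rw [Set.indicator_of_mem hy]
    refine measure_mono fun u hu => ?_
    simp only [Set.mem_Ioi] at hu
    exact ⟨hy, show x < y + u by linarith⟩
  · rw [Set.indicator_of_notMem hy]; exact zero_le

namespace Subexponential

variable {ν : Measure ℝ}

theorem eventually_measure_Ioi_sub_le (h : Subexponential ν) (B : ℝ) {C : ℝ≥0∞} (hC : 1 < C) :
    ∀ᶠ x in atTop, ν (Set.Ioi (x - B)) ≤ C * ν (Set.Ioi x) := by
  have := h.prob
  obtain ⟨D, h1, h2⟩ := ENNReal.lt_iff_exists_nnreal_btwn.1 hC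
  have h1 : 1 < D := by exact_mod_cast h1
  filter_upwards [h.eventually_tail_sub_le B (sub_pos.2 (NNReal.coe_lt_coe.2 h1))] with x hx
  refine le_trans ?_ (mul_le_mul_left h2.le _)
  rw [← ofReal_tail, ← ofReal_tail, ← ENNReal.ofReal_coe_nnreal,
    ← ENNReal.ofReal_mul (by positivity)]
  refine ENNReal.ofReal_le_ofReal ?_
  simpa using hx

/-- The bound $B_0$ depends only on `C` and `ε`, so that `B` may be raised afterwards to a level
beyond which a given `H` is dominated. -/
theorem eventually_setLIntegral_le (h : Subexponential ν) {C ε : ℝ≥0∞} (hC : C ≠ ∞) (hε : ε ≠ 0) :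
    ∃ B₀ : ℝ, ∀ B, B₀ ≤ B → ∀ᶠ x in atTop, ∀ (H : Measure ℝ) [SFinite H],
      (∀ y, B ≤ y → H (Set.Ioi y) ≤ C * ν (Set.Ioi y)) →
      ∫⁻ y in Set.Ioc B (x - B), ν (Set.Ioi (x - y)) ∂H ≤ ε * ν (Set.Ioi x) := by
  have := h.prob
  wlog hC0 : C ≠ 0 generalizing C
  · obtain ⟨B₀, hB⟩ := this ENNReal.one_ne_top one_ne_zero
    refine ⟨B₀, fun B h1 => (hB B h1).mono fun x hx H _ hH => hx H fun y hy => (hH y hy).trans ?_⟩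
    rw [not_ne_iff.1 hC0]; simp
  wlog hεt : ε ≠ ∞ generalizing ε
  · obtain ⟨B₀, hB⟩ := this one_ne_zero ENNReal.one_ne_top
    refine ⟨B₀, fun B h1 => (hB B h1).mono fun x hx H _ hH => (hx H hH).trans ?_⟩
    rw [not_ne_iff.1 hεt]; gcongr; simp
  -- The middle region costs $\delta$ and the product term $2\delta$ (a factor 2 for the shift by
  -- $B$), in total $3\delta C\le\varepsilon$.
  set δ := ε / C / 4
  have hδ0 : δ ≠ 0 := by simp [δ, hε, hC]
  have hδt : δ ≠ ∞ := by
    refine (ENNReal.div_lt_top (ENNReal.div_ne_top hεt hC0) (by simp)).ne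
  obtain ⟨B₁, hB₁⟩ := h.eventually_middle_le (ENNReal.toReal_pos hδ0 hδt)
  obtain ⟨B₂, hB₂⟩ := eventually_atTop.1
    ((tendsto_measure_Ioi_atTop ν).eventually_le_const (pos_iff_ne_zero.2 hδ0))
  refine ⟨max B₁ B₂, fun B hB => ?_⟩
  filter_upwards [hB₁ B ((le_max_left _ _).trans hB),
    h.eventually_measure_Ioi_sub_le B (C := 2) (by simp)] with x hx hx2 H _ hH
  refine (setLIntegral_tail_le hH).trans ?_
  have h1 : (ν.prod ν) {p | (B < p.1 ∧ p.1 ≤ x - B) ∧ x < p.1 + p.2} ≤ δ * ν (Set.Ioi x) := by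
    rw [← ENNReal.toReal_le_toReal (measure_ne_top _ _)
      (ENNReal.mul_ne_top hδt (measure_ne_top _ _)), ENNReal.toReal_mul]
    exact hx
  have h2 := hB₂ B ((le_max_right _ _).trans hB)
  calc _ ≤ C * (δ * ν (Set.Ioi x) + δ * (2 * ν (Set.Ioi x))) := by gcongr
    _ = C * (δ * 3) * ν (Set.Ioi x) := by ring
    _ ≤ C * (δ * 4) * ν (Set.Ioi x) := by gcongr; norm_num
    _ = ε * ν (Set.Ioi x) := by
      rw [ENNReal.div_mul_cancel (by simp) (by simp), ENNReal.mul_div_cancel hC0 hC]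

end Subexponential

/-! ### Integrals of decreasing functions and sums along arithmetic progressions. -/

section SumIntegral

variable {g : ℝ → ℝ≥0∞} (hg : Antitone g) {c : ℝ} (hc : 0 < c) (x : ℝ)

include hc in
theorem setLIntegral_Ioi_eq_tsum (g : ℝ → ℝ≥0∞) :
    ∫⁻ u in Set.Ioi x, g u = ∑' n : ℕ, ∫⁻ u in Set.Ioc (x + n * c) (x + (n + 1 : ℕ) * c), g u := by
  have hmono : Monotone fun n : ℕ => x + n * c := fun m n h => by
    have : (m : ℝ) ≤ n := by exact_mod_cast h
    simp only; nlinarith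
  have h1 : ⋃ n : ℕ, Set.Ioc (x + n * c) (x + (n + 1 : ℕ) * c) = Set.Ioi x := by
    have := iUnion_Ioc_map_succ_eq_Ioi (f := fun n : ℕ => x + n * c) (fun n => hmono (Nat.zero_le n))
      (by
        rintro ⟨b, hb⟩
        obtain ⟨n, hn⟩ := exists_nat_gt ((b - x) / c)
        rw [div_lt_iff₀ hc] at hn
        have := hb ⟨n, rfl⟩
        simp only at this
        linarith)
    simpa using this
  rw [← h1, lintegral_iUnion (fun _ => measurableSet_Ioc)
    (show Pairwise (Function.onFun Disjoint
      fun n : ℕ => Set.Ioc (x + n * c) (x + (n + 1 : ℕ) * c)) from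
      hmono.pairwise_disjoint_on_Ioc_succ)]

include hg hc

theorem tsum_le_setLIntegral :
    ∑' n : ℕ, ENNReal.ofReal c * g (x + (n + 1 : ℕ) * c) ≤ ∫⁻ u in Set.Ioi x, g u := by
  rw [setLIntegral_Ioi_eq_tsum hc]
  refine ENNReal.tsum_le_tsum fun n => ?_
  calc ENNReal.ofReal c * g (x + (n + 1 : ℕ) * c)
      = ∫⁻ _ in Set.Ioc (x + n * c) (x + (n + 1 : ℕ) * c), g (x + (n + 1 : ℕ) * c) := by
        rw [setLIntegral_const, Real.volume_Ioc, mul_comm]; congr 2; push_cast; ring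
    _ ≤ _ := setLIntegral_mono' measurableSet_Ioc fun u hu => hg hu.2

theorem setLIntegral_le_tsum :
    ∫⁻ u in Set.Ioi x, g u ≤ ∑' n : ℕ, ENNReal.ofReal c * g (x + n * c) := by
  rw [setLIntegral_Ioi_eq_tsum hc]
  refine ENNReal.tsum_le_tsum fun n => ?_
  calc ∫⁻ u in Set.Ioc (x + n * c) (x + (n + 1 : ℕ) * c), g u
      ≤ ∫⁻ _ in Set.Ioc (x + n * c) (x + (n + 1 : ℕ) * c), g (x + n * c) :=
        setLIntegral_mono' measurableSet_Ioc fun u hu => hg hu.1.le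
    _ = ENNReal.ofReal c * g (x + n * c) := by
        rw [setLIntegral_const, Real.volume_Ioc, mul_comm]; congr 2; push_cast; ring

theorem tsum_le_add_setLIntegral :
    ∑' n : ℕ, g (x + n * c) ≤ g x + (ENNReal.ofReal c)⁻¹ * ∫⁻ u in Set.Ioi x, g u := by
  have hc0 : ENNReal.ofReal c ≠ 0 := by simpa using hc
  rw [tsum_eq_zero_add' ENNReal.summable]
  simp only [Nat.cast_zero, zero_mul, add_zero]
  gcongr
  calc ∑' n : ℕ, g (x + (n + 1 : ℕ) * c)
      = (ENNReal.ofReal c)⁻¹ * ∑' n : ℕ, ENNReal.ofReal c * g (x + (n + 1 : ℕ) * c) := by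
        rw [ENNReal.tsum_mul_left, ← mul_assoc, ENNReal.inv_mul_cancel hc0 ENNReal.ofReal_ne_top,
          one_mul]
    _ ≤ _ := by gcongr; exact tsum_le_setLIntegral hg hc x

theorem inv_mul_setLIntegral_le_tsum :
    (ENNReal.ofReal c)⁻¹ * ∫⁻ u in Set.Ioi x, g u ≤ ∑' n : ℕ, g (x + n * c) := by
  have hc0 : ENNReal.ofReal c ≠ 0 := by simpa using hc
  calc _ ≤ (ENNReal.ofReal c)⁻¹ * ∑' n : ℕ, ENNReal.ofReal c * g (x + n * c) := by
        gcongr; exact setLIntegral_le_tsum hg hc x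
    _ = _ := by
        rw [ENNReal.tsum_mul_left, ← mul_assoc, ENNReal.inv_mul_cancel hc0 ENNReal.ofReal_ne_top,
          one_mul]

end SumIntegral

/-! ### The integrated tail and sums of tails along a line. -/

theorem measure_Ioi_antitone (F : Measure ℝ) : Antitone fun x => F (Set.Ioi x) :=
  fun _ _ h => measure_mono (Set.Ioi_subset_Ioi h)

/-- `F` and `ν` are subexponential, `ν` has the integrated tail of `F`, and the tail of `F` is
negligible with respect to that of `ν`. -/
structure IntegratedPair (F ν : Measure ℝ) : Prop where
  subexp : Subexponential F
  subexp_integrated : Subexponential ν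
  eventually_eq : ∀ᶠ x in atTop, ν (Set.Ioi x) = ∫⁻ u in Set.Ioi x, F (Set.Ioi u)
  negligible : Negligible ν fun x => F (Set.Ioi x)

/-- For $c=0$ the truncation sum is $(N_x+1)\overline F(x)$, whence $\overline F=o(\overline F^s)$.
The minimum with 1 disappears once the tail of `ν` is below 1. -/
theorem integratedPair_of_truncationLevel {F ν : Measure ℝ} {N : ℝ → ℕ} (hF : Subexponential F)
    (hν : Subexponential ν) (h : ∀ x, 0 ≤ x → tail ν x = integratedTail F x)
    (hN : TruncationLevel F N) : IntegratedPair F ν := by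
  have := hF.prob
  have := hν.prob
  refine ⟨hF, hν, ?_, ?_⟩
  · filter_upwards [eventually_ge_atTop 0,
      (tendsto_tail_atTop ν).eventually_lt_const zero_lt_one] with x hx hx1
    rw [h x hx, integratedTail] at hx1
    have h2 := hν.tail_pos x
    rw [h x hx, integratedTail, min_eq_right (by by_contra hc; simp [min_eq_left (not_le.1 hc).le] at hx1)] at h2
    -- A nonintegrable tail would have Bochner integral 0, contrary to the positivity of the tail of
    -- `ν`.
    have hint : IntegrableOn (tail F) (Set.Ioi x) := by
      by_contra hc
      rw [integral_undef hc] at h2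
      exact lt_irrefl _ h2
    rw [← ofReal_tail, h x hx, integratedTail, min_eq_right (by by_contra hc; simp [min_eq_left (not_le.1 hc).le] at hx1),
      ofReal_integral_eq_lintegral_ofReal hint (Eventually.of_forall fun u => tail_nonneg F u)]
    simp only [ofReal_tail]
  · refine Negligible.of_tendsto hν.tail_pos (fun x => measure_ne_top _ _) ?_
    have h0 := hN.negligible 0
    have h1 : (fun x => tail F x) =o[atTop] tail ν := by
      refine (IsBigO.trans_isLittleO (IsBigO.of_bound 1 (Eventually.of_forall fun x => ?_)) h0).trans_eventuallyEq ?_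
      · simp only [mul_zero, add_zero, Finset.sum_const, Finset.card_range, nsmul_eq_mul, one_mul,
          Real.norm_eq_abs, abs_of_nonneg (tail_nonneg F x)]
        rw [abs_of_nonneg (by have := tail_nonneg F x; positivity)]
        have := tail_nonneg F x
        push_cast
        nlinarith [Nat.cast_nonneg (α := ℝ) (N x)]
      · filter_upwards [eventually_ge_atTop 0] with x hx using (h x hx).symm
    exact h1.tendsto_div_nhds_zero

/-- If `T x / F (x, ∞) → d` then `T ≤ C F`. -/
theorem exists_forall_le_mul_tail {F : Measure ℝ} (hF : Subexponential F) {T : ℝ → ℝ≥0∞}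
    (hT1 : ∀ x, T x ≤ 1) {d : ℝ}
    (hT : Tendsto (fun x => (T x).toReal / tail F x) atTop (𝓝 d)) :
    ∃ C : ℝ≥0∞, C ≠ ∞ ∧ ∀ x, T x ≤ C * F (Set.Ioi x) := by
  have := hF.prob
  obtain ⟨x₀, hx₀⟩ := eventually_atTop.1 (hT.eventually_lt_const (lt_add_one d))
  have hd : ∀ x, T x ≠ ∞ := fun x => ne_top_of_le_ne_top ENNReal.one_ne_top (hT1 x)
  -- The first summand serves beyond $x_0$; below it $T\le1$ and
  -- $F(x_0,\infty)^{-1}F(x,\infty)\ge1$.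
  refine ⟨ENNReal.ofReal (d + 1) + (F (Set.Ioi x₀))⁻¹, ?_, fun x => ?_⟩
  · simpa using hF.measure_Ioi_ne_zero x₀
  rcases le_or_gt x₀ x with h | h
  · have h1 := hx₀ x h
    rw [div_lt_iff₀ (hF.tail_pos x)] at h1
    have hd0 : 0 ≤ d + 1 := by
      by_contra hc
      have := hF.tail_pos x
      have : 0 ≤ (T x).toReal := ENNReal.toReal_nonneg
      nlinarith
    rw [add_mul]
    refine le_add_right ?_
    rw [← ofReal_tail, ← ENNReal.ofReal_mul hd0, ← ENNReal.ofReal_toReal (hd x)]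
    exact ENNReal.ofReal_le_ofReal h1.le
  · rw [add_mul]
    refine le_add_left ((hT1 x).trans ?_)
    rw [← ENNReal.inv_mul_cancel (hF.measure_Ioi_ne_zero x₀) (measure_ne_top _ _)]
    gcongr

namespace IntegratedPair

variable {F ν : Measure ℝ} (h : IntegratedPair F ν)
include h

/-- The sum is at most its first term plus $1/c$ times the integral of the tail. The first term is
$o(\overline\nu)$, and the shift by $B$ is harmless because `ν` is long-tailed. -/
theorem eventually_tsum_le {c e : ℝ} (hc : 0 < c) (he : 0 < e) (B : ℝ) :
    ∀ᶠ x in atTop, ∑' n : ℕ, F (Set.Ioi (x - B + n * c)) ≤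
      ENNReal.ofReal (1 / c + e) * ν (Set.Ioi x) := by
  have := h.subexp_integrated.prob
  have hc0 : ENNReal.ofReal c ≠ 0 := by simpa using hc
  have h2 : (1 : ℝ≥0∞) < 1 + ENNReal.ofReal (e * c / 4) :=
    ENNReal.lt_add_right (by simp) (by simp; positivity)
  have ht : Tendsto (fun x : ℝ => x - B) atTop atTop := tendsto_atTop_add_const_right _ _ tendsto_id
  filter_upwards [ht.eventually h.eventually_eq,
    ht.eventually (h.negligible (ENNReal.ofReal (e / 4)) (by simpa using he)),
    h.subexp_integrated.eventually_measure_Ioi_sub_le B h2,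
    h.subexp_integrated.eventually_measure_Ioi_sub_le B (C := 2) (by simp)] with x h1 h3 h4 h5
  refine (tsum_le_add_setLIntegral (measure_Ioi_antitone F) hc (x - B)).trans ?_
  rw [← h1]
  calc _ ≤ ENNReal.ofReal (e / 4) * (2 * ν (Set.Ioi x)) +
        (ENNReal.ofReal c)⁻¹ * ((1 + ENNReal.ofReal (e * c / 4)) * ν (Set.Ioi x)) := by
        gcongr; exact h3.trans (by gcongr)
    _ = (ENNReal.ofReal (e / 4) * 2 + (ENNReal.ofReal c)⁻¹ * (1 + ENNReal.ofReal (e * c / 4)))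
        * ν (Set.Ioi x) := by ring
    _ ≤ _ := by
        gcongr
        rw [← ENNReal.ofReal_inv_of_pos hc, ← ENNReal.ofReal_one,
          ← ENNReal.ofReal_add zero_le_one (by positivity),
          ← ENNReal.ofReal_mul (by positivity), show (2 : ℝ≥0∞) = ENNReal.ofReal 2 by simp,
          ← ENNReal.ofReal_mul (by positivity), ← ENNReal.ofReal_add (by positivity) (by positivity)]
        refine ENNReal.ofReal_le_ofReal ?_
        field_simp
        nlinarith

theorem eventually_le_tsum {c : ℝ} (hc : 0 < c) :
    ∀ᶠ x in atTop, ENNReal.ofReal (1 / c) * ν (Set.Ioi x) ≤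
      ∑' n : ℕ, F (Set.Ioi (x + n * c)) := by
  filter_upwards [h.eventually_eq] with x hx
  rw [hx, one_div, ENNReal.ofReal_inv_of_pos hc]
  exact inv_mul_setLIntegral_le_tsum (measure_Ioi_antitone F) hc x

/-- Nearby slopes give nearby sums of tails. -/
theorem exists_tsum_sub_le {T : ℝ → ℝ≥0∞} (hTa : Antitone T) (hT1 : ∀ x, T x ≤ 1) {d : ℝ}
    (hT : Tendsto (fun x => (T x).toReal / tail F x) atTop (𝓝 d)) {c : ℝ} (hc : 0 < c) {ε : ℝ}
    (hε : 0 < ε) :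
    ∃ δ₀, 0 < δ₀ ∧ ∀ δ, 0 < δ → δ < δ₀ → δ < c ∧ ∀ B, 0 ≤ B → ∀ᶠ x in atTop,
      ∑' n : ℕ, (T (x - B + n * (c - δ)) - T (x + n * (c + δ))) ≤
        ENNReal.ofReal ε * ν (Set.Ioi x) := by
  have := h.subexp.prob
  have := h.subexp_integrated.prob
  have hTt : ∀ x, T x ≠ ∞ := fun x => ne_top_of_le_ne_top ENNReal.one_ne_top (hT1 x)
  have hd0 : 0 ≤ d := ge_of_tendsto' hT fun x =>
    div_nonneg ENNReal.toReal_nonneg (tail_nonneg F x)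
  -- With $\delta=t$, the sum along slope $c-t$ is at most $(d+t)(1/(c-t)+t)\overline\nu$ and the
  -- sum along $c+t$ at least $d\,\overline\nu/(c+t)$, up to a further $t(1/(c-t)+t)\overline\nu$.
  -- The total error tends to 0 with $t$, whatever $B$ is.
  have hlim : Tendsto (fun t : ℝ => (d + 2 * t) * (1 / (c - t) + t) - d * (1 / (c + t))) (𝓝 0)
      (𝓝 ((d + 2 * 0) * (1 / (c - 0) + 0) - d * (1 / (c + 0)))) := by
    have h1 : ContinuousAt (fun t : ℝ => (d + 2 * t) * (1 / (c - t) + t) - d * (1 / (c + t))) 0 := by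
      have h1 : c - 0 ≠ 0 := by simpa using hc.ne'
      have h2 : c + 0 ≠ 0 := by simpa using hc.ne'
      fun_prop (disch := assumption)
    exact h1
  have h0 : (d + 2 * 0) * (1 / (c - 0) + 0) - d * (1 / (c + 0)) < ε := by simpa using hε
  obtain ⟨δ₁, hδ₁, hδ⟩ := Metric.eventually_nhds_iff.1 (hlim.eventually_lt_const h0)
  refine ⟨min δ₁ c, lt_min hδ₁ hc, fun t ht htlt => ?_⟩
  have htc : t < c := htlt.trans_le (min_le_right _ _)
  have hlt := hδ (y := t) (by
    rw [Real.dist_eq, sub_zero, abs_of_pos ht]; exact htlt.trans_le (min_le_left _ _))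
  refine ⟨htc, fun B hB => ?_⟩
  have hc1 : 0 < c - t := by linarith
  have hc2 : 0 < c + t := by linarith
  obtain ⟨x₁, hx₁⟩ := eventually_atTop.1 (hT.eventually_lt_const (show d < d + t by linarith))
  obtain ⟨x₂, hx₂⟩ := eventually_atTop.1 (hT.eventually_const_lt (show d - t < d by linarith))
  have hup : ∀ y, x₁ ≤ y → T y ≤ ENNReal.ofReal (d + t) * F (Set.Ioi y) := fun y hy => by
    have h1 := hx₁ y hy
    rw [div_lt_iff₀ (h.subexp.tail_pos y)] at h1
    rw [← ofReal_tail, ← ENNReal.ofReal_mul (by positivity), ← ENNReal.ofReal_toReal (hTt y)]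
    exact ENNReal.ofReal_le_ofReal h1.le
  have hlo : ∀ y, x₂ ≤ y → ENNReal.ofReal d * F (Set.Ioi y) ≤
      T y + ENNReal.ofReal t * F (Set.Ioi y) := fun y hy => by
    have h1 := hx₂ y hy
    rw [lt_div_iff₀ (h.subexp.tail_pos y)] at h1
    have hp := tail_nonneg F y
    rw [← ofReal_tail, ← ENNReal.ofReal_mul hd0, ← ENNReal.ofReal_mul ht.le,
      ← ENNReal.ofReal_toReal (hTt y), ← ENNReal.ofReal_add ENNReal.toReal_nonneg (by positivity)]
    exact ENNReal.ofReal_le_ofReal (by linarith)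
  filter_upwards [h.eventually_tsum_le hc1 ht B, h.eventually_le_tsum hc2,
    eventually_ge_atTop (x₁ + B), eventually_ge_atTop x₂] with x h1 h2 h3 h4
  set S := ∑' n : ℕ, (T (x - B + n * (c - t)) - T (x + n * (c + t)))
  set G := ν (Set.Ioi x)
  have hle : ∀ n : ℕ, x - B + n * (c - t) ≤ x + n * (c + t) := fun n => by
    have : (0 : ℝ) ≤ n := n.cast_nonneg
    nlinarith
  have hF2 : ∑' n : ℕ, F (Set.Ioi (x + n * (c + t))) ≤ ENNReal.ofReal (1 / (c - t) + t) * G :=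
    (ENNReal.tsum_le_tsum fun n => measure_Ioi_antitone F (hle n)).trans h1
  have hsplit : S + ∑' n : ℕ, T (x + n * (c + t)) = ∑' n : ℕ, T (x - B + n * (c - t)) := by
    rw [← ENNReal.tsum_add]
    exact tsum_congr fun n => tsub_add_cancel_of_le (hTa (hle n))
  have hG : G ≠ ∞ := measure_ne_top _ _
  -- The smaller sum is moved to the left side, so that the truncated subtraction in `S` causes no
  -- loss; it is cancelled at the end.
  have key : S + ENNReal.ofReal d * (ENNReal.ofReal (1 / (c + t)) * G) ≤
      ENNReal.ofReal ((d + 2 * t) * (1 / (c - t) + t)) * G := by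
    calc S + ENNReal.ofReal d * (ENNReal.ofReal (1 / (c + t)) * G)
        ≤ S + ∑' n : ℕ, (T (x + n * (c + t)) + ENNReal.ofReal t * F (Set.Ioi (x + n * (c + t)))) := by
          gcongr
          refine (mul_le_mul_right h2 _).trans ?_
          rw [← ENNReal.tsum_mul_left]
          refine ENNReal.tsum_le_tsum fun n => hlo _ ?_
          have : (0 : ℝ) ≤ n := n.cast_nonneg
          nlinarith
      _ = ∑' n : ℕ, T (x - B + n * (c - t)) +
            ENNReal.ofReal t * ∑' n : ℕ, F (Set.Ioi (x + n * (c + t))) := by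
          rw [ENNReal.tsum_add, ← add_assoc, hsplit, ENNReal.tsum_mul_left]
      _ ≤ ENNReal.ofReal (d + t) * (ENNReal.ofReal (1 / (c - t) + t) * G) +
            ENNReal.ofReal t * (ENNReal.ofReal (1 / (c - t) + t) * G) := by
          refine add_le_add (le_trans ?_ (mul_le_mul_right h1 _)) (mul_le_mul_right hF2 _)
          rw [← ENNReal.tsum_mul_left]
          refine ENNReal.tsum_le_tsum fun n => hup _ ?_
          have : (0 : ℝ) ≤ n := n.cast_nonneg
          nlinarith
      _ = _ := by
          rw [ENNReal.ofReal_mul (by positivity), show d + 2 * t = (d + t) + t by ring,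
            ENNReal.ofReal_add (p := d + t) (by positivity) ht.le]
          ring
  have h5 : S + ENNReal.ofReal (d * (1 / (c + t))) * G ≤
      ENNReal.ofReal ε * G + ENNReal.ofReal (d * (1 / (c + t))) * G := by
    rw [← add_mul, ← ENNReal.ofReal_add hε.le (by positivity), ENNReal.ofReal_mul hd0, mul_assoc]
    refine key.trans (mul_le_mul_left (ENNReal.ofReal_le_ofReal ?_) _)
    linarith
  exact (ENNReal.add_le_add_iff_right (ENNReal.mul_ne_top ENNReal.ofReal_ne_top hG)).1 h5

end IntegratedPair

theorem Subexponential.tendsto_tail_sub_div {F : Measure ℝ} (hF : Subexponential F) {B : ℝ}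
    (hB : 0 ≤ B) : Tendsto (fun x => tail F (x - B) / tail F x) atTop (𝓝 1) := by
  have := hF.prob
  refine tendsto_order.2 ⟨fun a ha => Eventually.of_forall fun x => ?_, fun a ha => ?_⟩
  · refine ha.trans_le ((one_le_div (hF.tail_pos x)).2 (tail_antitone F (by linarith)))
  · filter_upwards [hF.eventually_tail_sub_le B (half_pos (sub_pos.2 ha))] with x hx
    rw [div_lt_iff₀ (hF.tail_pos x)]
    have := hF.tail_pos x
    nlinarith

/-! ### Sums of independent heavy-tailed variables. -/

section Independent

variable {Ω : Type*} [MeasurableSpace Ω] {P : Measure Ω}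

theorem measure_mem_eq_lintegral_of_indepFun {E E' : Type*} [MeasurableSpace E] [MeasurableSpace E']
    [IsFiniteMeasure P] {V : Ω → E} {W : Ω → E'} (h : V ⟂ᵢ[P] W) (hV : Measurable V)
    (hW : Measurable W) {S : Set (E × E')} (hS : MeasurableSet S) :
    P {ω | (V ω, W ω) ∈ S} = ∫⁻ v, P {ω | (v, W ω) ∈ S} ∂(P.map V) := by
  have h1 : P {ω | (V ω, W ω) ∈ S} = (P.map fun ω => (V ω, W ω)) S := by
    rw [Measure.map_apply (hV.prodMk hW) hS]; rfl
  rw [h1, (indepFun_iff_map_prod_eq_prod_map_map hV.aemeasurable hW.aemeasurable).1 h,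
    Measure.prod_apply hS]
  refine lintegral_congr fun v => ?_
  rw [Measure.map_apply hW (measurable_prodMk_left hS)]
  rfl

/-- The right side does not involve `g`: this is the source of every shift invariance used below. -/
theorem map_comp_eq_infinitePi {E ι κ : Type*} [MeasurableSpace E] {V : κ → Ω → E}
    [IsProbabilityMeasure P]
    (hV : ∀ k, Measurable (V k)) (h : iIndepFun V P) (k₀ : κ)
    (hid : ∀ k, IdentDistrib (V k) (V k₀) P P) {g : ι → κ} (hg : Function.Injective g) :
    P.map (fun ω i => V (g i) ω) = Measure.infinitePi fun _ : ι => P.map (V k₀) := by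
  rw [(h.precomp hg).map_fun_eq_infinitePi_map fun i => hV _]
  congr 1
  funext i
  exact (hid (g i)).map_eq

variable [IsProbabilityMeasure P]

/-- The probability is a difference of two tails, both equivalent to $\alpha\overline F(y)$ because
`F` is long-tailed. -/
theorem negligible_window {F : Measure ℝ} (hF : Subexponential F) {V : Ω → ℝ} (hV : Measurable V)
    {α : ℝ} (hα : Tendsto (fun y => P.real {ω | y < V ω} / tail F y) atTop (𝓝 α)) {B : ℝ}
    (hB : 0 ≤ B) : Negligible F fun y => P {ω | y - B < V ω ∧ V ω ≤ y} := by
  have := hF.prob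
  refine Negligible.of_tendsto hF.tail_pos (fun _ => measure_ne_top _ _) ?_
  have h1 : Tendsto (fun y : ℝ => y - B) atTop atTop :=
    tendsto_atTop_add_const_right _ _ tendsto_id
  have h2 := ((hα.comp h1).mul (hF.tendsto_tail_sub_div hB)).sub hα
  rw [mul_one, sub_self] at h2
  refine h2.congr fun y => ?_
  have h3 : P.real {ω | y - B < V ω ∧ V ω ≤ y} = P.real {ω | y - B < V ω} - P.real {ω | y < V ω} := by
    have hdisj : Disjoint {ω | y - B < V ω ∧ V ω ≤ y} {ω | y < V ω} :=
      Set.disjoint_left.2 fun ω h1 h2 => absurd h1.2 (not_le.2 h2)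
    rw [eq_sub_iff_add_eq, ← measureReal_union hdisj (measurableSet_lt measurable_const hV)]
    congr 1
    ext ω
    simp only [Set.mem_union, Set.mem_ofPred_eq]
    constructor
    · rintro (h | h)
      · exact h.1
      · linarith
    · intro h
      rcases le_or_gt (V ω) y with h' | h'
      exacts [Or.inl ⟨h, h'⟩, Or.inr h']
  change _ = P.real _ / _
  rw [h3, sub_div]
  have h4 := (hF.tail_pos (y - B)).ne'
  have h5 := (hF.tail_pos y).ne'
  simp only [Function.comp_apply]
  field_simp

/-- A sum of two independent heavy-tailed variables is large because one of them is. -/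
theorem negligible_add_of_le {F : Measure ℝ} (hF : Subexponential F) {V W : Ω → ℝ}
    (hV : Measurable V) (hW : Measurable W) (h : V ⟂ᵢ[P] W) {α β : ℝ}
    (hα : Tendsto (fun y => P.real {ω | y < V ω} / tail F y) atTop (𝓝 α))
    (hβ : Tendsto (fun y => P.real {ω | y < W ω} / tail F y) atTop (𝓝 β)) :
    Negligible F fun y => P {ω | V ω ≤ y ∧ W ω ≤ y ∧ y < V ω + W ω} := by
  have := hF.prob
  obtain ⟨C, hC, hVC⟩ := exists_forall_le_mul_tail hF (fun y => prob_le_one) hα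
  obtain ⟨D, hD, hWD⟩ := exists_forall_le_mul_tail hF (fun y => prob_le_one) hβ
  have hmid : ∀ ε : ℝ≥0∞, ε ≠ 0 → ∃ B : ℝ, 0 ≤ B ∧ ∀ᶠ y in atTop,
      P {ω | (B < V ω ∧ V ω ≤ y - B) ∧ y < V ω + W ω} ≤ ε * F (Set.Ioi y) := by
    intro ε hε
    obtain ⟨B₀, hB₀⟩ := hF.eventually_setLIntegral_le (C := C) (ε := ε / (D + 1)) hC
      (by simp [hε, hD])
    refine ⟨max B₀ 0, le_max_right _ _, ?_⟩
    set B := max B₀ 0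
    filter_upwards [hB₀ B (le_max_left _ _)] with y hy
    have hy := hy (P.map V) fun z _ => by
      rw [Measure.map_apply hV measurableSet_Ioi]; exact hVC z
    have h1 := measure_mem_eq_lintegral_of_indepFun h hV hW (measurableSet_middle B y)
    change P {ω | (B < V ω ∧ V ω ≤ y - B) ∧ y < V ω + W ω} = _ at h1
    rw [h1]
    calc _ ≤ ∫⁻ v, (Set.Ioc B (y - B)).indicator (fun v => D * F (Set.Ioi (y - v))) v ∂(P.map V) := by
          refine lintegral_mono fun v => ?_
          by_cases hv : v ∈ Set.Ioc B (y - B)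
          · rw [Set.indicator_of_mem hv]
            refine (measure_mono ?_).trans (hWD (y - v))
            rintro ω ⟨_, h3⟩
            simp only [Set.mem_ofPred_eq] at *
            linarith
          · rw [Set.indicator_of_notMem hv]
            refine le_of_eq ?_
            convert measure_empty (μ := P)
            ext ω
            simp only [Set.mem_ofPred_eq, Set.mem_empty_iff_false, iff_false]
            exact fun h => hv h.1
      _ = D * ∫⁻ v in Set.Ioc B (y - B), F (Set.Ioi (y - v)) ∂(P.map V) := by
          rw [lintegral_indicator measurableSet_Ioc, lintegral_const_mul]
          exact Monotone.measurable fun u v huv => measure_mono (Set.Ioi_subset_Ioi (by linarith))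
      _ ≤ (D + 1) * (ε / (D + 1) * F (Set.Ioi y)) := by gcongr; simp
      _ = ε * F (Set.Ioi y) := by
          rw [← mul_assoc, ENNReal.mul_div_cancel (by simp) (by simp [hD])]
  intro ε hε
  obtain ⟨B, hB, hev⟩ := hmid (ε / 2) (by simpa using hε)
  filter_upwards [hev, ((negligible_window hF hV hα hB).add (negligible_window hF hW hβ hB)) (ε / 2)
    (by simpa using hε)] with y h1 h2
  calc P {ω | V ω ≤ y ∧ W ω ≤ y ∧ y < V ω + W ω}
      ≤ P ({ω | (B < V ω ∧ V ω ≤ y - B) ∧ y < V ω + W ω} ∪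
          ({ω | y - B < V ω ∧ V ω ≤ y} ∪ {ω | y - B < W ω ∧ W ω ≤ y})) := by
        -- Either a summand lies within $B$ of $y$, or both are at most $y-B$; in the latter case
        -- each exceeds $B$, which is the moderate regime of `hmid`.
        refine measure_mono fun ω ⟨ha, hb, hc⟩ => ?_
        simp only [Set.mem_union, Set.mem_ofPred_eq]
        rcases le_or_gt (V ω) (y - B) with h3 | h3
        · rcases le_or_gt (W ω) (y - B) with h4 | h4
          · exact Or.inl ⟨⟨by linarith, h3⟩, hc⟩
          · exact Or.inr (Or.inr ⟨h4, hb⟩)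
        · exact Or.inr (Or.inl ⟨h3, ha⟩)
    _ ≤ ε / 2 * F (Set.Ioi y) + ε / 2 * F (Set.Ioi y) :=
        (measure_union_le _ _).trans (add_le_add h1 ((measure_union_le _ _).trans h2))
    _ = ε * F (Set.Ioi y) := by rw [← add_mul, ENNReal.add_halves]

/-- For nonnegative summands, $\{V+W>y\}$ is the union of $\{V>y\}$, $\{W>y\}$ and the negligible
event of `negligible_add_of_le`. By independence the overlap of the first two is $O(\overline
F(y)^2)$. -/
theorem tendsto_tail_add {F : Measure ℝ} (hF : Subexponential F) {V W : Ω → ℝ}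
    (hV : Measurable V) (hW : Measurable W) (h : V ⟂ᵢ[P] W) {α β : ℝ}
    (hV0 : ∀ᵐ ω ∂P, 0 ≤ V ω) (hW0 : ∀ᵐ ω ∂P, 0 ≤ W ω)
    (hα : Tendsto (fun y => P.real {ω | y < V ω} / tail F y) atTop (𝓝 α))
    (hβ : Tendsto (fun y => P.real {ω | y < W ω} / tail F y) atTop (𝓝 β)) :
    Tendsto (fun y => P.real {ω | y < V ω + W ω} / tail F y) atTop (𝓝 (α + β)) := by
  have := hF.prob
  have hn := (negligible_add_of_le hF hV hW h hα hβ).isLittleO.tendsto_div_nhds_zero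
  have hp : Tendsto (fun y => P.real {ω | y < V ω} / tail F y * P.real {ω | y < W ω} / tail F y * tail F y)
      atTop (𝓝 (α * β * 0)) := by
    simp only [mul_div_assoc]
    exact (hα.mul hβ).mul (tendsto_tail_atTop F)
  have hlim := ((hα.add hβ).sub hp).add hn
  simp only [mul_zero, sub_zero, add_zero] at hlim
  refine hlim.congr fun y => ?_
  have hmV : MeasurableSet {ω | y < V ω} := measurableSet_lt measurable_const hV
  have hmW : MeasurableSet {ω | y < W ω} := measurableSet_lt measurable_const hW
  have h1 : P.real {ω | y < V ω + W ω} = P.real ({ω | y < V ω} ∪ {ω | y < W ω}) +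
      P.real {ω | V ω ≤ y ∧ W ω ≤ y ∧ y < V ω + W ω} := by
    rw [← measureReal_union']
    · refine measureReal_congr ?_
      filter_upwards [hV0, hW0] with ω h1 h2
      refine propext ?_
      change _ ↔ ((_ ∨ _) ∨ _)
      change y < V ω + W ω ↔ ((y < V ω ∨ y < W ω) ∨ V ω ≤ y ∧ W ω ≤ y ∧ y < V ω + W ω)
      constructor
      · intro h3
        rcases le_or_gt (V ω) y with h4 | h4
        · rcases le_or_gt (W ω) y with h5 | h5
          · exact Or.inr ⟨h4, h5, h3⟩
          · exact Or.inl (Or.inr h5)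
        · exact Or.inl (Or.inl h4)
      · rintro ((h3 | h3) | ⟨_, _, h3⟩) <;> linarith
    · refine Set.disjoint_left.2 ?_
      rintro ω (h1 | h1) ⟨h2, h3, _⟩
      · exact absurd h2 (not_le.2 h1)
      · exact absurd h3 (not_le.2 h1)
    · exact hmV.union hmW
  have h2 : P.real ({ω | y < V ω} ∪ {ω | y < W ω}) = P.real {ω | y < V ω} + P.real {ω | y < W ω} -
      P.real {ω | y < V ω} * P.real {ω | y < W ω} := by
    have h3 := measureReal_union_add_inter (μ := P) (s := {ω | y < V ω}) hmW
    have h4 : P.real ({ω | y < V ω} ∩ {ω | y < W ω}) = P.real {ω | y < V ω} * P.real {ω | y < W ω} := by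
      have := h.measure_inter_preimage_eq_mul (Set.Ioi y) (Set.Ioi y) measurableSet_Ioi measurableSet_Ioi
      simp only [Measure.real, ← ENNReal.toReal_mul]
      exact congrArg ENNReal.toReal this
    linarith
  rw [h1, h2]
  have h5 := (hF.tail_pos y).ne'
  simp only [Measure.real]
  field_simp

/-- Both claims are proved in one induction: the tail of the partial sum is needed to add the next
summand to it. -/
theorem negligible_sum_of_le {F : Measure ℝ} (hF : Subexponential F) {W : ℕ → Ω → ℝ}
    (hW : ∀ i, Measurable (W i)) (h : iIndepFun W P) {β : ℝ}
    (hW0 : ∀ i, ∀ᵐ ω ∂P, 0 ≤ W i ω)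
    (hβ : ∀ i, Tendsto (fun y => P.real {ω | y < W i ω} / tail F y) atTop (𝓝 β)) (k : ℕ) :
    Tendsto (fun y => P.real {ω | y < ∑ i ∈ Finset.range k, W i ω} / tail F y) atTop (𝓝 (k * β)) ∧
    Negligible F fun y => P {ω | (∀ i < k, W i ω ≤ y) ∧ y < ∑ i ∈ Finset.range k, W i ω} := by
  induction k with
  | zero =>
    have h1 : ∀ y : ℝ, 0 ≤ y → {ω : Ω | y < 0} = ∅ := fun y hy => by
      ext ω; simpa using hy
    constructor
    · simp only [Finset.range_zero, Finset.sum_empty, CharP.cast_eq_zero, zero_mul]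
      refine tendsto_const_nhds.congr' ?_
      filter_upwards [eventually_ge_atTop 0] with y hy
      simp [h1 y hy]
    · refine Negligible.zero.mono ?_
      filter_upwards [eventually_ge_atTop 0] with y hy
      simp only [Finset.range_zero, Finset.sum_empty]
      refine (measure_mono (t := {ω : Ω | y < 0}) fun ω hω => hω.2).trans ?_
      simp [h1 y hy]
  | succ k ih =>
    have hS : Measurable fun ω => ∑ i ∈ Finset.range k, W i ω := by fun_prop
    have hi : (fun ω => ∑ i ∈ Finset.range k, W i ω) ⟂ᵢ[P] W k := by
      have := h.indepFun_sum_range_succ hW k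
      simpa only [← Finset.sum_apply] using this
    have hS0 : ∀ᵐ ω ∂P, 0 ≤ ∑ i ∈ Finset.range k, W i ω := by
      filter_upwards [ae_all_iff.2 hW0] with ω hω using Finset.sum_nonneg fun i _ => hω i
    simp only [Finset.sum_range_succ]
    constructor
    · have := tendsto_tail_add hF hS (hW k) hi hS0 (hW0 k) ih.1 (hβ k)
      push_cast
      rwa [add_mul, one_mul]
    · refine ((negligible_add_of_le hF hS (hW k) hi ih.1 (hβ k)).add ih.2).mono
        (Eventually.of_forall fun y => ?_)
      refine (measure_mono ?_).trans (measure_union_le _ _)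
      rintro ω ⟨h1, h2⟩
      rcases le_or_gt (∑ i ∈ Finset.range k, W i ω) y with h3 | h3
      · exact Or.inl ⟨h3, h1 k (by omega), h2⟩
      · exact Or.inr ⟨fun i hi => h1 i (by omega), h3⟩

end Independent

/-! ### The principle of a single big jump for descending random walks. -/

section Walk

variable {Ω : Type*}

/-- The random walk `∑ i ≤ k, X i`. -/
def walk (X : ℕ → Ω → ℝ) (k : ℕ) (ω : Ω) : ℝ := ∑ i ∈ Finset.range (k + 1), X i ω

theorem walk_add (n j : ℕ) (ω : Ω) :
    walk X (n + j) ω = walk X n ω + ∑ i ∈ Finset.range j, X (n + 1 + i) ω := by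
  rw [walk, walk, show n + j + 1 = (n + 1) + j by ring, Finset.sum_range_add]

/-- The first passage of the walk above the line `A - n m` is at time `n`. -/
def firstPassage (X : ℕ → Ω → ℝ) (m A : ℝ) (n : ℕ) : Set Ω :=
  {ω | A - n * m < walk X n ω ∧ ∀ k < n, walk X k ω ≤ A - k * m}

theorem firstPassage_disjoint (X : ℕ → Ω → ℝ) (m A : ℝ) :
    Pairwise (Function.onFun Disjoint (firstPassage X m A)) := by
  have key : ∀ i j, i < j → Disjoint (firstPassage X m A i) (firstPassage X m A j) := fun i j h =>
    Set.disjoint_left.2 fun ω h1 h2 => absurd (h2.2 i h) (not_le.2 h1.1)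
  intro i j hij
  rcases lt_or_gt_of_ne hij with h | h
  exacts [key i j h, (key j i h).symm]

theorem measurable_walk_of_le {mΩ : MeasurableSpace Ω} {X : ℕ → Ω → ℝ} {n : ℕ}
    (h : ∀ i ≤ n, Measurable (X i)) : Measurable (walk X n) :=
  Finset.measurable_sum _ fun i hi => h i (Nat.lt_succ_iff.1 (Finset.mem_range.1 hi))

theorem comap_pi_le {mΩ : MeasurableSpace Ω} {V : ℕ → Ω → ℝ} (h : ∀ i, Measurable (V i)) :
    MeasurableSpace.comap (fun ω i => V i ω) inferInstance ≤ mΩ :=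
  measurable_iff_comap_le.1 (measurable_pi_iff.2 h)

variable [MeasurableSpace Ω]

theorem measure_mem_eq_lintegral_of_indepFun' {E E' : Type*} [MeasurableSpace E]
    [MeasurableSpace E'] {P : Measure Ω}
    [IsFiniteMeasure P] {V : Ω → E} {W : Ω → E'} (h : V ⟂ᵢ[P] W) (hV : Measurable V)
    (hW : Measurable W) {S : Set (E × E')} (hS : MeasurableSet S) :
    P {ω | (V ω, W ω) ∈ S} = ∫⁻ ω, P {ω' | (V ω, W ω') ∈ S} ∂P := by
  have h1 : ∀ v, P {ω | (v, W ω) ∈ S} = (P.map W) (Prod.mk v ⁻¹' S) := fun v => by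
    rw [Measure.map_apply hW (measurable_prodMk_left hS)]; rfl
  rw [measure_mem_eq_lintegral_of_indepFun h hV hW hS]
  simp only [h1]
  rw [lintegral_map (measurable_measure_prodMk_left hS) hV]

/-- A random walk with i.i.d. increments, started from an independent nonnegative variable, which
almost surely stays below a line of slope `-m < 0`. -/
structure DescendingWalk (P : Measure Ω) (X : ℕ → Ω → ℝ) (m : ℝ) : Prop where
  measurable : ∀ n, Measurable (X n)
  indep : iIndepFun X P
  ident : ∀ n, IdentDistrib (X (n + 1)) (X 1) P P
  nonneg : ∀ᵐ ω ∂P, 0 ≤ X 0 ω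
  slope_pos : 0 < m
  bounded : ∀ᵐ ω ∂P, ∃ A : ℝ, ∀ k : ℕ, walk X k ω ≤ A - k * m

/-- The probability that the walk with increments `X 1, X 2, …` exceeds `z`. -/
def exceedance (P : Measure Ω) (X : ℕ → Ω → ℝ) (z : ℝ) : ℝ≥0∞ :=
  P {ω | ∃ j, z < ∑ i ∈ Finset.range j, X (i + 1) ω}

/-- The law of the position of the walk at the first passage. -/
noncomputable def passageLaw (P : Measure Ω) (X : ℕ → Ω → ℝ) (m A : ℝ) : Measure ℝ :=
  Measure.sum fun n => (P.restrict (firstPassage X m A n)).map (walk X n)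

namespace DescendingWalk

variable {P : Measure Ω} [IsProbabilityMeasure P] {X : ℕ → Ω → ℝ} {m : ℝ}
  (h : DescendingWalk P X m)
include h

omit [IsProbabilityMeasure P] in
theorem measurable_walk (k : ℕ) : Measurable (walk X k) :=
  measurable_walk_of_le fun i _ => h.measurable i

omit [IsProbabilityMeasure P] in
theorem measurableSet_firstPassage (A : ℝ) (n : ℕ) : MeasurableSet (firstPassage X m A n) := by
  refine (measurableSet_lt measurable_const (h.measurable_walk n)).inter ?_
  have : {ω | ∀ k < n, walk X k ω ≤ A - k * m} = ⋂ k, ⋂ _ : k < n, {ω | walk X k ω ≤ A - k * m} := by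
    ext ω; simp
  change MeasurableSet {ω | ∀ k < n, walk X k ω ≤ A - k * m}
  rw [this]
  exact MeasurableSet.iInter fun k => MeasurableSet.iInter fun _ =>
    measurableSet_le (h.measurable_walk k) measurable_const

omit [IsProbabilityMeasure P] in
-- The past is encoded by the path stopped at `n`, so that it is a single random sequence to which
-- the first passage event belongs.
theorem indepFun_past_future (n : ℕ) :
    (fun ω k => walk X (min k n) ω) ⟂ᵢ[P] fun ω i => X (n + 1 + i) ω := by
  have hd : Disjoint (Set.Iic n) (Set.Ioi n) :=
    Set.disjoint_left.2 fun i (h1 : i ≤ n) (h2 : n < i) => absurd h1 (not_le.2 h2)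
  have hi := indep_iSup_of_disjoint (fun i => (h.measurable i).comap_le) h.indep.iIndep hd
  have hle : ∀ (S : Set ℕ) i, i ∈ S →
      Measurable[⨆ i ∈ S, MeasurableSpace.comap (X i) inferInstance] (X i) := fun S i hi =>
    measurable_iff_comap_le.2 (le_iSup₂_of_le i hi le_rfl)
  rw [IndepFun_iff_Indep]
  refine indep_of_indep_of_le_left (indep_of_indep_of_le_right hi ?_) ?_
  · refine comap_pi_le fun i => hle _ _ ?_
    simp only [Set.mem_Ioi]; omega
  · refine comap_pi_le fun k => measurable_walk_of_le fun i hi => hle _ _ ?_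
    simp only [Set.mem_Iic]; omega

theorem measure_future (n : ℕ) (z : ℝ) :
    P {ω | ∃ j, z < ∑ i ∈ Finset.range j, X (n + 1 + i) ω} = exceedance P X z := by
  have hS : MeasurableSet {w : ℕ → ℝ | ∃ j, z < ∑ i ∈ Finset.range j, w i} := by
    rw [Set.ofPred_exists]
    exact MeasurableSet.iUnion fun j => measurableSet_lt measurable_const (by fun_prop)
  have hlaw : ∀ n, P {ω | ∃ j, z < ∑ i ∈ Finset.range j, X (n + 1 + i) ω} =
      (Measure.infinitePi fun _ : ℕ => P.map (X 1)) {w | ∃ j, z < ∑ i ∈ Finset.range j, w i} := by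
    intro n
    have h1 := map_comp_eq_infinitePi (P := P) (V := fun i => X (i + 1))
      (fun k => h.measurable _) (h.indep.precomp fun a b => by simp) 0 h.ident
      (g := fun i : ℕ => n + i) (fun a b => by simp)
    simp only [zero_add] at h1
    rw [← h1, Measure.map_apply (measurable_pi_iff.2 fun i => h.measurable _) hS]
    simp only [Set.preimage_ofPred_eq, add_right_comm n 1]
  rw [hlaw, exceedance]
  have := hlaw 0
  simp only [zero_add, add_comm 1] at this
  exact this.symm

theorem measure_firstPassage_inter_future (A z : ℝ) (n : ℕ) :
    P (firstPassage X m A n ∩ {ω | ∃ j, z < ∑ i ∈ Finset.range j, X (n + 1 + i) ω}) =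
      P (firstPassage X m A n) * exceedance P X z := by
  have hS : MeasurableSet {w : ℕ → ℝ | ∃ j, z < ∑ i ∈ Finset.range j, w i} := by
    rw [Set.ofPred_exists]
    exact MeasurableSet.iUnion fun j => measurableSet_lt measurable_const (by fun_prop)
  have hE : MeasurableSet {v : ℕ → ℝ | A - n * m < v n ∧ ∀ k < n, v k ≤ A - k * m} := by
    refine (measurableSet_lt measurable_const (measurable_pi_apply n)).inter ?_
    have : {v : ℕ → ℝ | ∀ k < n, v k ≤ A - k * m} = ⋂ k, ⋂ _ : k < n, {v | v k ≤ A - k * m} := by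
      ext v; simp
    change MeasurableSet {v : ℕ → ℝ | ∀ k < n, v k ≤ A - k * m}
    rw [this]
    exact MeasurableSet.iInter fun k => MeasurableSet.iInter fun _ =>
      measurableSet_le (measurable_pi_apply k) measurable_const
  have h1 := (h.indepFun_past_future n).measure_inter_preimage_eq_mul _ _ hE hS
  have h2 : (fun ω k => walk X (min k n) ω) ⁻¹'
      {v : ℕ → ℝ | A - n * m < v n ∧ ∀ k < n, v k ≤ A - k * m} = firstPassage X m A n := by
    ext ω
    simp only [Set.mem_preimage, Set.mem_ofPred_eq, firstPassage, min_self]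
    refine and_congr Iff.rfl (forall₂_congr fun k hk => ?_)
    rw [min_eq_left hk.le]
  rw [h2] at h1
  rw [← h.measure_future n z]
  exact h1

/-- Conditionally on the path up to `n`, with the walk at height $y$, the independent future has to
climb by more than $x-y$. -/
theorem measure_firstPassage_middle_le (A B x : ℝ) (n : ℕ) :
    P {ω | ω ∈ firstPassage X m A n ∧ (B < walk X n ω ∧ walk X n ω ≤ x - B) ∧
        ∃ j, x - walk X n ω < ∑ i ∈ Finset.range j, X (n + 1 + i) ω} ≤
      ∫⁻ y in Set.Ioc B (x - B), exceedance P X (x - y)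
        ∂((P.restrict (firstPassage X m A n)).map (walk X n)) := by
  set S : Set ((ℕ → ℝ) × (ℕ → ℝ)) := {p | (A - n * m < p.1 n ∧ ∀ k < n, p.1 k ≤ A - k * m) ∧
    (B < p.1 n ∧ p.1 n ≤ x - B) ∧ ∃ j, x - p.1 n < ∑ i ∈ Finset.range j, p.2 i}
  have hS : MeasurableSet S := by
    have e1 : {p : (ℕ → ℝ) × (ℕ → ℝ) | ∀ k < n, p.1 k ≤ A - k * m} =
        ⋂ k, ⋂ _ : k < n, {p | p.1 k ≤ A - k * m} := by
      ext v; simp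
    have h1 : MeasurableSet {p : (ℕ → ℝ) × (ℕ → ℝ) | ∀ k < n, p.1 k ≤ A - k * m} := by
      rw [e1]
      exact MeasurableSet.iInter fun k => MeasurableSet.iInter fun _ =>
        measurableSet_le (by fun_prop) measurable_const
    have h2 : MeasurableSet {p : (ℕ → ℝ) × (ℕ → ℝ) | ∃ j, x - p.1 n < ∑ i ∈ Finset.range j, p.2 i} := by
      rw [Set.ofPred_exists]
      exact MeasurableSet.iUnion fun j => measurableSet_lt (by fun_prop) (by fun_prop)
    have h3 : MeasurableSet {p : (ℕ → ℝ) × (ℕ → ℝ) | A - n * m < p.1 n} :=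
      measurableSet_lt measurable_const (by fun_prop)
    have h4 : MeasurableSet {p : (ℕ → ℝ) × (ℕ → ℝ) | B < p.1 n} :=
      measurableSet_lt measurable_const (by fun_prop)
    have h5 : MeasurableSet {p : (ℕ → ℝ) × (ℕ → ℝ) | p.1 n ≤ x - B} :=
      measurableSet_le (by fun_prop) measurable_const
    exact (h3.inter h1).inter ((h4.inter h5).inter h2)
  have hpast : Measurable fun ω k => walk X (min k n) ω :=
    measurable_pi_iff.2 fun k => h.measurable_walk _
  have hfut : Measurable fun ω i => X (n + 1 + i) ω := measurable_pi_iff.2 fun i => h.measurable _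
  have h1 := measure_mem_eq_lintegral_of_indepFun' (h.indepFun_past_future n) hpast hfut hS
  have hmem : ∀ ω ω', ((fun k => walk X (min k n) ω, fun i => X (n + 1 + i) ω') ∈ S) ↔
      ω ∈ firstPassage X m A n ∧ (B < walk X n ω ∧ walk X n ω ≤ x - B) ∧
        ∃ j, x - walk X n ω < ∑ i ∈ Finset.range j, X (n + 1 + i) ω' := by
    intro ω ω'
    simp only [S, Set.mem_ofPred_eq, firstPassage, min_self]
    refine and_congr (and_congr Iff.rfl (forall₂_congr fun k hk => ?_)) Iff.rfl
    rw [min_eq_left hk.le]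
  simp only [hmem] at h1
  have hmono : Measurable fun y => exceedance P X (x - y) := by
    refine Monotone.measurable fun u v huv => measure_mono ?_
    rintro ω ⟨j, hj⟩
    exact ⟨j, by linarith⟩
  rw [h1, ← lintegral_indicator measurableSet_Ioc,
    lintegral_map (hmono.indicator measurableSet_Ioc) (h.measurable_walk n),
    ← lintegral_indicator (h.measurableSet_firstPassage A n)]
  refine lintegral_mono fun ω => ?_
  by_cases h2 : ω ∈ firstPassage X m A n ∧ (B < walk X n ω ∧ walk X n ω ≤ x - B)
  · rw [Set.indicator_of_mem h2.1, Set.indicator_of_mem (show walk X n ω ∈ Set.Ioc _ _ from h2.2),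
      ← h.measure_future n]
    exact measure_mono fun ω' h3 => h3.2.2
  · refine le_of_eq_of_le ?_ zero_le
    convert measure_empty (μ := P)
    ext ω'
    simp only [Set.mem_ofPred_eq, Set.mem_empty_iff_false, iff_false]
    exact fun h3 => h2 ⟨h3.1, h3.2.1⟩

/-- The walk exceeds `x` by restarting after its first passage above a line, which is rare. -/
theorem measure_exceed_le {A B x : ℝ} (hx : A ≤ x) :
    P {ω | (∃ k, x < walk X k ω) ∧ ∀ n, ω ∈ firstPassage X m A n → walk X n ω ≤ x - B} ≤
      P {ω | ∃ k : ℕ, A - k * m < walk X k ω} * exceedance P X (x - B) +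
      ∫⁻ y in Set.Ioc B (x - B), exceedance P X (x - y) ∂(passageLaw P X m A) := by
  have hsub : {ω | (∃ k, x < walk X k ω) ∧ ∀ n, ω ∈ firstPassage X m A n → walk X n ω ≤ x - B} ⊆
      (⋃ n, firstPassage X m A n ∩ {ω | ∃ j, x - B < ∑ i ∈ Finset.range j, X (n + 1 + i) ω}) ∪
      ⋃ n, {ω | ω ∈ firstPassage X m A n ∧ (B < walk X n ω ∧ walk X n ω ≤ x - B) ∧
        ∃ j, x - walk X n ω < ∑ i ∈ Finset.range j, X (n + 1 + i) ω} := by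
    classical
    rintro ω ⟨⟨k, hk⟩, hR⟩
    -- Since $A\le x$ and the line descends, exceeding $x$ requires a passage above the line no
    -- later.
    have hex : ∃ n : ℕ, A - n * m < walk X n ω := ⟨k, by
      have : (0 : ℝ) ≤ k * m := mul_nonneg k.cast_nonneg h.slope_pos.le
      linarith⟩
    have hn : ω ∈ firstPassage X m A (Nat.find hex) :=
      ⟨Nat.find_spec hex, fun i hi => not_lt.1 (Nat.find_min hex hi)⟩
    have hnk : Nat.find hex ≤ k := Nat.find_min' hex (by
      have : (0 : ℝ) ≤ k * m := mul_nonneg k.cast_nonneg h.slope_pos.le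
      linarith)
    obtain ⟨j, rfl⟩ := Nat.exists_eq_add_of_le hnk
    rw [walk_add] at hk
    -- After a landing at or below $B$ the future must still climb by more than $x-B$, which yields
    -- a product; a landing in $(B,x-B]$ yields the integral.
    rcases le_or_gt (walk X (Nat.find hex) ω) B with h1 | h1
    · refine Or.inl (Set.mem_iUnion.2 ⟨_, hn, j, ?_⟩)
      linarith
    · refine Or.inr (Set.mem_iUnion.2 ⟨_, hn, ⟨h1, hR _ hn⟩, j, ?_⟩)
      linarith
  refine (measure_mono hsub).trans ((measure_union_le _ _).trans (add_le_add ?_ ?_))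
  · refine (measure_iUnion_le _).trans ?_
    simp only [h.measure_firstPassage_inter_future]
    rw [ENNReal.tsum_mul_right, ← measure_iUnion (firstPassage_disjoint X m A)
      (h.measurableSet_firstPassage A)]
    gcongr
    exact Set.iUnion_subset fun n ω hω => ⟨n, hω.1⟩
  · refine (measure_iUnion_le _).trans ?_
    rw [passageLaw, Measure.restrict_sum _ measurableSet_Ioc, lintegral_sum_measure]
    exact ENNReal.tsum_le_tsum fun n => h.measure_firstPassage_middle_le A B x n

omit [IsProbabilityMeasure P] in
-- Just before the passage the walk is at most $A-(n-1)m$, so the last increment alone accounts for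
-- the height. At time 0 the increment is the position itself, and $A\ge0$, $m>0$ leave room.
theorem increment_gt {A y : ℝ} (hA : 0 ≤ A) {n : ℕ} {ω : Ω} (hω : ω ∈ firstPassage X m A n)
    (hy : y < walk X n ω) : y - (A + m) + n * m < X n ω := by
  have hm := h.slope_pos
  rcases n with _ | n
  · simp only [walk, zero_add, Finset.range_one, Finset.sum_singleton, CharP.cast_eq_zero,
      zero_mul, add_zero] at hy ⊢
    linarith
  · have h1 := hω.2 n (Nat.lt_succ_self n)
    rw [walk, Finset.sum_range_succ] at hy
    change y < walk X n ω + _ at hy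
    push_cast
    linarith

omit [IsProbabilityMeasure P] in
theorem passageLaw_Ioi_le {A : ℝ} (hA : 0 ≤ A) (y : ℝ) :
    passageLaw P X m A (Set.Ioi y) ≤ ∑' n : ℕ, P {ω | y - (A + m) + n * m < X n ω} := by
  rw [passageLaw, Measure.sum_apply _ measurableSet_Ioi]
  refine ENNReal.tsum_le_tsum fun n => ?_
  rw [Measure.map_apply (h.measurable_walk n) measurableSet_Ioi,
    Measure.restrict_apply (h.measurable_walk n measurableSet_Ioi)]
  exact measure_mono fun ω hω => h.increment_gt hA hω.2 hω.1

omit [IsProbabilityMeasure P] in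
theorem measure_passage_gt_le (A y : ℝ) :
    P {ω | ∃ n, ω ∈ firstPassage X m A n ∧ y < walk X n ω} ≤ passageLaw P X m A (Set.Ioi y) := by
  rw [Set.ofPred_exists, passageLaw, Measure.sum_apply _ measurableSet_Ioi]
  refine (measure_iUnion_le _).trans (ENNReal.tsum_le_tsum fun n => ?_)
  rw [Measure.map_apply (h.measurable_walk n) measurableSet_Ioi,
    Measure.restrict_apply (h.measurable_walk n measurableSet_Ioi)]
  exact measure_mono fun ω hω => ⟨hω.2, hω.1⟩

omit [IsProbabilityMeasure P] in
-- As $X_0\ge0$, a bound on the whole walk applies to the restarted one; this makes the recursion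
-- below close up.
theorem exceedance_le (z : ℝ) : exceedance P X z ≤ P {ω | ∃ k, z < walk X k ω} := by
  refine measure_mono_ae ?_
  filter_upwards [h.nonneg] with ω hω
  rintro ⟨j, hj⟩
  refine ⟨j, ?_⟩
  rw [walk, Finset.sum_range_succ']
  linarith

/-- The passage events decrease as $A$ grows, and their intersection is null because almost every
path stays below some line of this slope. -/
theorem exists_measure_passage_le {δ : ℝ≥0∞} (hδ : δ ≠ 0) :
    ∃ A : ℝ, 0 ≤ A ∧ P {ω | ∃ k : ℕ, A - k * m < walk X k ω} ≤ δ := by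
  have hlim := tendsto_measure_iInter_atTop (μ := P)
    (s := fun A : ℕ => {ω | ∃ k : ℕ, (A : ℝ) - k * m < walk X k ω})
    (fun A => by
      rw [Set.ofPred_exists]
      exact (MeasurableSet.iUnion fun k =>
        measurableSet_lt measurable_const (h.measurable_walk k)).nullMeasurableSet)
    (fun A A' hA ω => by
      rintro ⟨k, hk⟩
      have : (A : ℝ) ≤ A' := by exact_mod_cast hA
      exact ⟨k, by linarith⟩)
    ⟨0, measure_ne_top _ _⟩
  have h0 : P (⋂ A : ℕ, {ω | ∃ k : ℕ, (A : ℝ) - k * m < walk X k ω}) = 0 := by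
    rw [← compl_mem_ae_iff]
    filter_upwards [h.bounded] with ω ⟨A, hA⟩ hmem
    obtain ⟨n, hn⟩ := exists_nat_ge A
    obtain ⟨k, hk⟩ := Set.mem_iInter.1 hmem n
    have := hA k
    linarith
  rw [h0] at hlim
  obtain ⟨n, hn⟩ := (hlim.eventually_le_const (pos_iff_ne_zero.2 hδ)).exists
  exact ⟨n, n.cast_nonneg, hn⟩

variable {ν : Measure ℝ} (hν : Subexponential ν) {C : ℝ≥0∞} (hC : C ≠ ∞)
  (hsum : ∀ᶠ y in atTop, ∑' n : ℕ, P {ω | y + n * m < X n ω} ≤ C * ν (Set.Ioi y))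
include hν hsum

omit hν [IsProbabilityMeasure P] in
theorem exists_passageLaw_le (hν : Subexponential ν) {A : ℝ} (hA : 0 ≤ A) :
    ∃ y₀, ∀ y, y₀ ≤ y → passageLaw P X m A (Set.Ioi y) ≤ C * 2 * ν (Set.Ioi y) := by
  have ht : Tendsto (fun x : ℝ => x - (A + m)) atTop atTop :=
    tendsto_atTop_add_const_right _ _ tendsto_id
  refine eventually_atTop.1 ?_
  filter_upwards [ht.eventually hsum,
    hν.eventually_measure_Ioi_sub_le (A + m) (C := 2) (by simp)] with y h1 h2
  refine (h.passageLaw_Ioi_le hA y).trans (h1.trans ?_)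
  rw [mul_assoc]
  gcongr

include hC

/-- A bound of Kesten type, uniform in $x$, proved by induction over levels in steps of length $B$.
After a passage not above $x-B$, the future has to exceed a level at most $x-B$, where the bound is
already known; rarity of passage keeps the constant from growing. -/
theorem exists_measure_exceed_le :
    ∃ Q : ℝ≥0∞, Q ≠ ∞ ∧ ∀ x, P {ω | ∃ k, x < walk X k ω} ≤ Q * ν (Set.Ioi x) := by
  have := hν.prob
  obtain ⟨A, hA, hδ⟩ := h.exists_measure_passage_le (δ := 4⁻¹) (by simp)
  obtain ⟨y₀, hy₀⟩ := h.exists_passageLaw_le hsum hν hA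
  obtain ⟨B₀, hB₀⟩ := hν.eventually_setLIntegral_le (C := C * 2) (ε := 4⁻¹)
    (ENNReal.mul_ne_top hC (by simp)) (by simp)
  set B := max (max B₀ y₀) 1
  have hB1 : 0 < B := lt_of_lt_of_le one_pos (le_max_right _ _)
  have hBB : B₀ ≤ B := (le_max_left _ _).trans (le_max_left _ _)
  have hBy : y₀ ≤ B := (le_max_right _ _).trans (le_max_left _ _)
  obtain ⟨x₀, hx₀⟩ := eventually_atTop.1 ((hB₀ B hBB).and
    ((hν.eventually_measure_Ioi_sub_le B (C := 2) (by simp)).and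
      ((eventually_ge_atTop A).and (eventually_ge_atTop (y₀ + B)))))
  -- The inverse makes $t\,\overline\nu(x)\ge1$ for $x\le x_0$. Beyond $x_0$, a landing above $x-B$
  -- costs $4C$, a restart from a low landing $2t$, a middle landing $t$, and $4C+3t\le4t$.
  set t : ℝ≥0∞ := (ν (Set.Ioi x₀))⁻¹ + C * 2 * 2
  have ht : t ≠ ∞ := by
    simp only [t, ne_eq, ENNReal.add_eq_top, ENNReal.inv_eq_top, not_or]
    exact ⟨hν.measure_Ioi_ne_zero x₀, by finiteness⟩
  have h4 : ∀ a : ℝ≥0∞, 4⁻¹ * (4 * a) = a := fun a => by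
    rw [← mul_assoc, ENNReal.inv_mul_cancel (by simp) (by simp), one_mul]
  have key : ∀ n : ℕ, ∀ x, x ≤ x₀ + n * B →
      P {ω | ∃ k, x < walk X k ω} ≤ 4 * t * ν (Set.Ioi x) := by
    have base : ∀ x, x ≤ x₀ → P {ω | ∃ k, x < walk X k ω} ≤ 4 * t * ν (Set.Ioi x) := by
      intro x hx
      calc P {ω | ∃ k, x < walk X k ω} ≤ 1 := prob_le_one
        _ = 1 * ((ν (Set.Ioi x₀))⁻¹ * ν (Set.Ioi x₀)) := by
            rw [ENNReal.inv_mul_cancel (hν.measure_Ioi_ne_zero x₀) (measure_ne_top _ _), one_mul]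
        _ ≤ 4 * (t * ν (Set.Ioi x)) := by
            gcongr
            · norm_num
            · exact le_self_add
        _ = _ := (mul_assoc _ _ _).symm
    intro n
    induction n with
    | zero => simpa using base
    | succ n ih =>
      intro x hx
      rcases le_or_gt x x₀ with hxx | hxx
      · exact base x hxx
      push_cast at hx
      obtain ⟨h1, h2, h3, h5⟩ := hx₀ x hxx.le
      have hsplit : P {ω | ∃ k, x < walk X k ω} ≤
          P {ω | ∃ n, ω ∈ firstPassage X m A n ∧ x - B < walk X n ω} +
          P {ω | (∃ k, x < walk X k ω) ∧ ∀ n, ω ∈ firstPassage X m A n → walk X n ω ≤ x - B} := by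
        refine (measure_mono fun ω hω => ?_).trans (measure_union_le _ _)
        by_cases hc : ∃ n, ω ∈ firstPassage X m A n ∧ x - B < walk X n ω
        · exact Or.inl hc
        · push Not at hc
          exact Or.inr ⟨hω, hc⟩
      have hex : ∀ z, z ≤ x - B → exceedance P X z ≤ 4 * t * ν (Set.Ioi z) := fun z hz =>
        (h.exceedance_le z).trans (ih z (by linarith))
      have hint : ∫⁻ y in Set.Ioc B (x - B), exceedance P X (x - y) ∂(passageLaw P X m A) ≤
          4 * t * (4⁻¹ * ν (Set.Ioi x)) := by
        have : SFinite (passageLaw P X m A) := by unfold passageLaw; infer_instance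
        refine le_trans ?_ (mul_le_mul_right (h1 (passageLaw P X m A)
          fun y hy => hy₀ y (hBy.trans hy)) _)
        rw [← lintegral_const_mul _ (Monotone.measurable fun u v huv =>
          measure_mono (Set.Ioi_subset_Ioi (by linarith)))]
        exact setLIntegral_mono' measurableSet_Ioc fun y hy => hex _ (by linarith [hy.1])
      calc _ ≤ C * 2 * ν (Set.Ioi (x - B)) + (4⁻¹ * (4 * t * ν (Set.Ioi (x - B))) +
            4 * t * (4⁻¹ * ν (Set.Ioi x))) := by
            refine hsplit.trans (add_le_add ((h.measure_passage_gt_le A _).trans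
              (hy₀ _ (by linarith))) ((h.measure_exceed_le h3).trans ?_))
            gcongr
            exact hex _ le_rfl
        _ = C * 2 * ν (Set.Ioi (x - B)) + (t * ν (Set.Ioi (x - B)) + t * ν (Set.Ioi x)) := by
            rw [mul_assoc 4 t, h4, mul_assoc 4 t, mul_left_comm t, mul_left_comm 4, h4]
        _ ≤ C * 2 * (2 * ν (Set.Ioi x)) + (t * (2 * ν (Set.Ioi x)) + t * ν (Set.Ioi x)) := by
            gcongr
        _ = (C * 2 * 2 + 3 * t) * ν (Set.Ioi x) := by ring
        _ ≤ (t + 3 * t) * ν (Set.Ioi x) := by gcongr; exact le_add_self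
        _ = _ := by ring
  refine ⟨4 * t, by finiteness, fun x => ?_⟩
  obtain ⟨n, hn⟩ := exists_nat_ge ((x - x₀) / B)
  rw [div_le_iff₀ hB1] at hn
  exact key n x (by linarith)

/-- The walk exceeds a high level because of a single big increment. -/
theorem exists_measure_exceed_without_jump_le {ε : ℝ≥0∞} (hε : ε ≠ 0) :
    ∃ B : ℝ, 0 ≤ B ∧ ∀ᶠ x in atTop,
      P {ω | (∃ k, x < walk X k ω) ∧ ∀ n : ℕ, X n ω ≤ x - B + n * m} ≤ ε * ν (Set.Ioi x) := by
  have := hν.prob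
  obtain ⟨Q, hQ, hQle⟩ := h.exists_measure_exceed_le hν hC hsum
  -- The low and middle landings will cost $2Q\varepsilon/R$ and $Q\varepsilon/R$; adding 1 to $Q$
  -- keeps $R$ nonzero.
  set R := 4 * (Q + 1)
  have hR : R ≠ ∞ := by finiteness
  have hR0 : R ≠ 0 := by simp [R]
  have hεR : ε / R ≠ 0 := by simp [hε, hR]
  obtain ⟨A, hA, hδ⟩ := h.exists_measure_passage_le hεR
  obtain ⟨y₀, hy₀⟩ := h.exists_passageLaw_le hsum hν hA
  obtain ⟨B₀, hB₀⟩ := hν.eventually_setLIntegral_le (C := C * 2) (ε := ε / R)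
    (ENNReal.mul_ne_top hC (by simp)) hεR
  set B := max (max B₀ y₀) 1
  have hB1 : 0 < B := lt_of_lt_of_le one_pos (le_max_right _ _)
  have hBB : B₀ ≤ B := (le_max_left _ _).trans (le_max_left _ _)
  have hBy : y₀ ≤ B := (le_max_right _ _).trans (le_max_left _ _)
  -- By `increment_gt`, landing above $x-B$ at time $n$ needs an increment above $x-B-(A+m)+nm$; so
  -- without such increments all landings are at most $x-B$.
  refine ⟨B + (A + m), by linarith [h.slope_pos], ?_⟩
  filter_upwards [hB₀ B hBB, hν.eventually_measure_Ioi_sub_le B (C := 2) (by simp),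
    eventually_ge_atTop A] with x h1 h2 h3
  have hex : ∀ z, exceedance P X z ≤ Q * ν (Set.Ioi z) := fun z =>
    (h.exceedance_le z).trans (hQle z)
  have hint : ∫⁻ y in Set.Ioc B (x - B), exceedance P X (x - y) ∂(passageLaw P X m A) ≤
      Q * (ε / R * ν (Set.Ioi x)) := by
    have : SFinite (passageLaw P X m A) := by unfold passageLaw; infer_instance
    refine le_trans ?_ (mul_le_mul_right (h1 (passageLaw P X m A)
      fun y hy => hy₀ y (hBy.trans hy)) _)
    rw [← lintegral_const_mul _ (Monotone.measurable fun u v huv =>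
      measure_mono (Set.Ioi_subset_Ioi (by linarith)))]
    exact setLIntegral_mono' measurableSet_Ioc fun y hy => hex _
  calc _ ≤ P {ω | (∃ k, x < walk X k ω) ∧
            ∀ n, ω ∈ firstPassage X m A n → walk X n ω ≤ x - B} := by
        refine measure_mono fun ω ⟨ha, hb⟩ => ⟨ha, fun n hn => ?_⟩
        by_contra hc
        have := h.increment_gt hA hn (not_le.1 hc)
        have := hb n
        linarith
    _ ≤ ε / R * (Q * (2 * ν (Set.Ioi x))) + Q * (ε / R * ν (Set.Ioi x)) := by
        refine (h.measure_exceed_le h3).trans (add_le_add (mul_le_mul' hδ ?_) hint)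
        exact (hex _).trans (by gcongr)
    _ = (3 * Q) * (ε / R) * ν (Set.Ioi x) := by ring
    _ ≤ R * (ε / R) * ν (Set.Ioi x) := by
        gcongr
        exact mul_le_mul' (by norm_num) le_self_add
    _ = ε * ν (Set.Ioi x) := by rw [ENNReal.mul_div_cancel hR0 hR]

end DescendingWalk

end Walk

/-! ### Pathwise comparisons in a monotone-separable network. -/

section Deterministic

variable {M : Type*}

theorem lastActivity_congr (f : (l : ℕ) → (Fin l → ℝ) → (Fin l → M) → ℝ) {m n : ℤ}
    {t t' : ℤ → ℝ} (z : ℤ → M) (h : ∀ i, m ≤ i → i ≤ n → t i = t' i) :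
    lastActivity f m n t z = lastActivity f m n t' z := by
  unfold lastActivity
  congr 1
  funext i
  have := i.2
  exact h _ (by omega) (by omega)

variable [MeasurableSpace M] {f : (l : ℕ) → (Fin l → ℝ) → (Fin l → M) → ℝ}

namespace MonotoneSeparable

variable (hf : MonotoneSeparable f) {t : ℤ → ℝ} (ht : Monotone t) (z : ℤ → M)
include hf

theorem lastActivity_const {m n : ℤ} (hmn : m ≤ n) (c : ℝ) :
    lastActivity f m n (fun _ => c) z = c + dater f m n (fun _ => 0) z := by
  have := hf.homogeneity (fun _ => 0) z c m n monotone_const hmn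
  simp only [add_zero] at this
  rw [this, dater]; ring

theorem dater_zero_nonneg {m n : ℤ} (hmn : m ≤ n) : 0 ≤ dater f m n (fun _ => 0) z :=
  sub_nonneg.2 (hf.causality _ z m n monotone_const hmn)

theorem dater_self (t : ℤ → ℝ) (n : ℤ) :
    dater f n n t z = dater f n n (fun _ => 0) z := by
  rw [dater, lastActivity_congr f (t' := fun _ => t n) z fun i h1 h2 => by rw [le_antisymm h2 h1],
    hf.lastActivity_const z le_rfl]
  ring

include ht

/-- Pull all points before $T_m$ back until the network is empty at $T_m$. Separability then forgets
the point $m-1$, and restoring the original points can only increase the last activity. -/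
theorem lastActivity_le_sub_one {m n : ℤ} (hmn : m ≤ n) :
    lastActivity f m n t z ≤ lastActivity f (m - 1) n t z := by
  set s := max 0 (lastActivity f (m - 1) (m - 1) t z - t m)
  have hs : 0 ≤ s := le_max_left _ _
  set t' : ℤ → ℝ := fun i => if i < m then -s + t i else t i
  have ht' : Monotone t' := fun i j hij => by
    have := ht hij
    simp only [t']
    split_ifs <;> linarith
  have h1 : lastActivity f (m - 1) (m - 1) t' z ≤ t' (m - 1 + 1) := by
    rw [lastActivity_congr f (t' := fun i => -s + t i) z fun i h1 h2 => by
      simp only [t']; rw [if_pos (by omega)],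
      hf.homogeneity t z (-s) _ _ ht le_rfl]
    simp only [t', sub_add_cancel, lt_irrefl, if_false]
    have : lastActivity f (m - 1) (m - 1) t z - t m ≤ s := le_max_right _ _
    linarith
  have h2 := hf.separability t' z (m - 1) (m - 1) n ht' le_rfl (by omega) h1
  rw [sub_add_cancel] at h2
  rw [lastActivity_congr f (t' := t') z fun i h1 _ => by
    simp only [t']; rw [if_neg (by omega)], ← h2]
  refine hf.external_monotonicity t' t z _ _ ht' ht (fun i => ?_) (by omega)
  simp only [t']
  split_ifs <;> linarith

theorem lastActivity_antitone {m' m n : ℤ} (h : m' ≤ m) (hmn : m ≤ n) :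
    lastActivity f m n t z ≤ lastActivity f m' n t z := by
  induction m', h using Int.leInductionDown with
  | base => exact le_rfl
  | pred k hk ih => exact ih.trans (hf.lastActivity_le_sub_one ht z (by omega))

/-- Delay the points after $l$ by the overrun `s` of the earlier ones: separability then applies,
homogeneity evaluates the delayed part, and delaying only increases the last activity. -/
theorem lastActivity_le_add {m l n : ℤ} (hml : m ≤ l) (hln : l < n) :
    lastActivity f m n t z ≤
      lastActivity f (l + 1) n t z + max 0 (lastActivity f m l t z - t (l + 1)) := by
  set s := max 0 (lastActivity f m l t z - t (l + 1))
  have hs : 0 ≤ s := le_max_left _ _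
  set t' : ℤ → ℝ := fun i => if i ≤ l then t i else s + t i
  have ht' : Monotone t' := fun i j hij => by
    have := ht hij
    simp only [t']
    split_ifs <;> linarith
  have h1 : lastActivity f m l t' z ≤ t' (l + 1) := by
    rw [lastActivity_congr f (t' := t) z fun i _ h2 => by simp only [t']; rw [if_pos h2]]
    simp only [t']
    rw [if_neg (by omega)]
    have : lastActivity f m l t z - t (l + 1) ≤ s := le_max_right _ _
    linarith
  have h2 := hf.separability t' z m l n ht' hml hln h1
  have h3 : lastActivity f (l + 1) n t' z = lastActivity f (l + 1) n t z + s := by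
    rw [lastActivity_congr f (t' := fun i => s + t i) z fun i h1 _ => by
      simp only [t']; rw [if_neg (by omega)], hf.homogeneity t z s _ _ ht (by omega)]
  rw [← h3, ← h2]
  refine hf.external_monotonicity t t' z _ _ ht ht' (fun i => ?_) (by omega)
  simp only [t']
  split_ifs <;> linarith

/-- All points are delayed to $T_n$; the maximum keeps the sequence nondecreasing. -/
theorem dater_le_dater_zero {m n : ℤ} (hmn : m ≤ n) :
    dater f m n t z ≤ dater f m n (fun _ => 0) z := by
  have h1 := hf.external_monotonicity t (fun i => max (t i) (t n)) z m n ht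
    (fun i j hij => max_le_max (ht hij) le_rfl) (fun i => le_max_left _ _) hmn
  rw [lastActivity_congr f (t' := fun _ => t n) z fun i _ h2 => max_eq_right (ht h2),
    hf.lastActivity_const z hmn] at h1
  rw [dater]
  linarith

/-- All points are advanced to $T_m$, which loses at most the span $T_n-T_m$. -/
theorem dater_zero_sub_le {m n : ℤ} (hmn : m ≤ n) :
    dater f m n (fun _ => 0) z - (t n - t m) ≤ dater f m n t z := by
  have h1 := hf.external_monotonicity (fun i => min (t i) (t m)) t z m n
    (fun i j hij => min_le_min (ht hij) le_rfl) ht (fun i => min_le_left _ _) hmn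
  rw [lastActivity_congr f (t' := fun _ => t m) z fun i h1 _ => min_eq_right (ht h1),
    hf.lastActivity_const z hmn] at h1
  change _ ≤ lastActivity f m n t z - t n
  linarith

omit ht in
theorem dater_zero_le_add {m l n : ℤ} (hml : m ≤ l) (hln : l < n) :
    dater f m n (fun _ => 0) z ≤ dater f m l (fun _ => 0) z + dater f (l + 1) n (fun _ => 0) z := by
  have h1 := hf.lastActivity_le_add (t := fun _ => 0) monotone_const z hml hln
  have h2 := hf.dater_zero_nonneg z hml
  simp only [dater, sub_zero] at *
  rw [max_eq_right h2] at h1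
  linarith

omit ht in
theorem dater_zero_le_sum (m : ℤ) (k : ℕ) :
    dater f m (m + k) (fun _ => 0) z ≤
      ∑ i ∈ Finset.range (k + 1), dater f (m + i) (m + i) (fun _ => 0) z := by
  induction k with
  | zero => simp
  | succ k ih =>
    rw [Finset.sum_range_succ]
    have h1 := hf.dater_zero_le_add z (m := m) (l := m + k) (n := m + (k + 1 : ℕ)) (by omega)
      (by push_cast; omega)
    have h2 : m + (k : ℤ) + 1 = m + (k + 1 : ℕ) := by push_cast; ring
    rw [h2] at h1
    linarith

end MonotoneSeparable

/-- The maximal dater of the `k`-th batch of `L` points, counted backwards from the point `0`, when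
all its points arrive together. -/
def batchDater (f : (l : ℕ) → (Fin l → ℝ) → (Fin l → M) → ℝ) (L : ℕ) (z : ℤ → M) (k : ℕ) : ℝ :=
  dater f (-((k + 1) * L : ℤ) + 1) (-(k * L : ℤ)) (fun _ => 0) z

namespace MonotoneSeparable

variable (hf : MonotoneSeparable f) {t : ℤ → ℝ} (ht : Monotone t) (z : ℤ → M) {L : ℕ} (hL : 0 < L)
include hf ht hL

/-- Lindley's recursion: the dater of a group of batches is at most the saturated dater of the
latest batch plus the positive part of what the earlier batches leave over. The map
$i\mapsto-L\lfloor -i/L\rfloor$ sends each index to the last one of its batch. The latest batch is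
split off at each step, so `k` and `x` vary in the induction. -/
theorem dater_batches_le (j : ℕ) : ∀ (k : ℕ) (x : ℝ),
    (∀ i ≤ j, ∑ p ∈ Finset.range (i + 1), batchDater f L z (k + p)
      - (t (-(k * L : ℤ)) - t (-((k + i) * L : ℤ))) ≤ x) →
    dater f (-((k + j + 1) * L : ℤ) + 1) (-(k * L : ℤ))
      (fun i => t (-(L * (-i / L)))) z ≤ x := by
  have hL0 : (0 : ℤ) < L := by exact_mod_cast hL
  have ht' : Monotone fun i : ℤ => t (-(L * (-i / L))) := fun i j hij => by
    refine ht (neg_le_neg (mul_le_mul_of_nonneg_left (Int.ediv_le_ediv hL0 (by omega)) hL0.le))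
  have hval : ∀ k : ℤ, -(L * (-(-(k * L)) / L) : ℤ) = -(k * L) := fun k => by
    rw [neg_neg, Int.mul_ediv_cancel _ hL0.ne']; ring
  induction j with
  | zero =>
    intro k x hx
    have h1 := hx 0 le_rfl
    simp only [zero_add, Finset.range_one, Finset.sum_singleton, add_zero, CharP.cast_eq_zero,
      sub_self, sub_zero] at h1
    have h2 := hf.dater_le_dater_zero ht' z (m := -((k + 1) * L : ℤ) + 1) (n := -(k * L : ℤ))
      (by nlinarith)
    simp only [CharP.cast_eq_zero, add_zero]
    exact h2.trans h1
  | succ j ih =>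
    intro k x hx
    have h0 := hx 0 (Nat.zero_le _)
    simp only [zero_add, Finset.range_one, Finset.sum_singleton, add_zero, CharP.cast_eq_zero,
      sub_self, sub_zero] at h0
    set σ := t (-(k * L : ℤ)) - t (-((k + 1) * L : ℤ))
    have h1 := ih (k + 1) (x - batchDater f L z k + σ) (fun i hi => by
      have h2 := hx (i + 1) (by omega)
      rw [Finset.sum_range_succ'] at h2
      have h3 : ∀ p, k + 1 + p = k + (p + 1) := fun p => by ring
      simp only [add_zero] at h2
      simp only [h3, σ]
      push_cast at h2 ⊢
      rw [show ((k : ℤ) + 1 + i) = k + (i + 1) by ring]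
      linarith)
    have h2 := hf.lastActivity_le_add ht' z
      (m := -((k + (j + 1 : ℕ) + 1) * L : ℤ) + 1) (l := -((k + 1) * L : ℤ)) (n := -(k * L : ℤ))
      (by push_cast; nlinarith) (by nlinarith)
    have h3 := hf.dater_le_dater_zero ht' z (m := -((k + 1) * L : ℤ) + 1) (n := -(k * L : ℤ))
      (by nlinarith)
    change _ ≤ batchDater f L z k at h3
    -- The earliest point of batch $k$ has been moved to $T_{-kL}$ too, so the overrun is measured
    -- from there.
    have h4 : (-(L * (-(-((k + 1) * L : ℤ) + 1) / L)) : ℤ) = -(k * L : ℤ) := by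
      rw [show (-(-((k + 1) * L : ℤ) + 1)) = (L - 1) + k * L by ring,
        Int.add_mul_ediv_right _ _ hL0.ne', Int.ediv_eq_zero_of_lt (by omega) (by omega)]
      ring
    have h5 := hval (k + 1)
    have h6 := hval k
    rw [dater] at h1 h3 ⊢
    push_cast at h1 h2 ⊢
    rw [h4] at h2
    rw [h6] at h3 ⊢
    rw [h5, show ((k : ℤ) + 1 + j + 1) = k + (j + 1) + 1 by ring] at h1
    rcases max_cases 0 (lastActivity f (-((k + (j + 1) + 1) * L : ℤ) + 1) (-((k + 1) * L : ℤ))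
      (fun i => t (-(L * (-i / L)))) z - t (-(k * L : ℤ))) with ⟨h7, _⟩ | ⟨h7, _⟩
    · rw [h7] at h2; linarith
    · rw [h7] at h2; simp only [σ] at h1; linarith

/-- The network is dominated by a queue in which batches of `L` points are served in turn. -/
theorem dater_le_of_batches {x : ℝ}
    (hx : ∀ k : ℕ, ∑ p ∈ Finset.range (k + 1), batchDater f L z p - (t 0 - t (-(k * L : ℤ))) ≤ x)
    (n : ℕ) : dater f (-(n : ℤ)) 0 t z ≤ x := by
  have hL0 : (0 : ℤ) < L := by exact_mod_cast hL
  have ht' : Monotone fun i : ℤ => t (-(L * (-i / L))) := fun i j hij => by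
    refine ht (neg_le_neg (mul_le_mul_of_nonneg_left (Int.ediv_le_ediv hL0 (by omega)) hL0.le))
  have h1 := hf.dater_batches_le ht z hL n 0 x (by simpa using fun i _ => hx i)
  simp only [CharP.cast_eq_zero, zero_mul, neg_zero, zero_add] at h1
  refine le_trans ?_ h1
  -- The window is enlarged to $n+1$ complete batches, which only increases the dater.
  have hle : -((n + 1) * L : ℤ) + 1 ≤ -(n : ℤ) := by nlinarith
  have h2 := hf.lastActivity_antitone ht z (n := 0) hle (by omega)
  have h3 := hf.external_monotonicity t _ z (-((n + 1) * L : ℤ) + 1) 0 ht ht' (fun i => ht (by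
    have := Int.mul_ediv_self_le (x := -i) hL0.ne'
    omega)) (by nlinarith)
  rw [dater, dater]
  simp only [neg_zero, Int.zero_ediv, mul_zero]
  linarith

end MonotoneSeparable

end Deterministic

section Dater

variable {Ω M : Type*} [MeasurableSpace M]
  {f : (l : ℕ) → (Fin l → ℝ) → (Fin l → M) → ℝ} (hf : MonotoneSeparable f)
  {T : ℤ → Ω → ℝ} {ζ : ℤ → Ω → M} {ω : Ω} (hT : Monotone fun n => T n ω)
include hf hT

theorem maximalDater_eq_iSup :
    maximalDater f T ζ ω =
      ⨆ n : ℕ, ((dater f (-(n : ℤ)) 0 (fun i => T i ω) (fun i => ζ i ω) : ℝ) : EReal) := by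
  refine (tendsto_atTop_iSup fun m n h => EReal.coe_le_coe_iff.2 ?_).limUnder_eq
  exact sub_le_sub_right (hf.lastActivity_antitone hT _ (by omega) (by omega)) _

theorem lt_maximalDater_iff (x : ℝ) :
    (x : EReal) < maximalDater f T ζ ω ↔
      ∃ n : ℕ, x < dater f (-(n : ℤ)) 0 (fun i => T i ω) (fun i => ζ i ω) := by
  rw [maximalDater_eq_iSup hf hT, lt_iSup_iff]
  simp only [EReal.coe_lt_coe_iff]

end Dater

/-! ### Blocks and pairs of i.i.d. sequences. -/

section Iid

variable {Ω : Type*} [MeasurableSpace Ω] {P : Measure Ω} [IsProbabilityMeasure P]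

/-- The joint law of the whole doubly indexed family is a product measure; currying it gives a
product over blocks of equal block laws. -/
theorem iIndepFun_blocks {E G J κ : Type*} [MeasurableSpace E] [MeasurableSpace G] [Countable J]
    {V : κ → Ω → E} (hV : ∀ k, Measurable (V k)) (h : iIndepFun V P) (k₀ : κ)
    (hid : ∀ k, IdentDistrib (V k) (V k₀) P P) {e : ℕ → J → κ}
    (he : Function.Injective fun p : ℕ × J => e p.1 p.2) {φ : (J → E) → G} (hφ : Measurable φ) :
    iIndepFun (fun (k : ℕ) ω => φ fun i => V (e k i) ω) P ∧
      ∀ k l, IdentDistrib (fun ω => φ fun i => V (e k i) ω) (fun ω => φ fun i => V (e l i) ω) P P := by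
  have hp : IsProbabilityMeasure (P.map (V k₀)) :=
    Measure.isProbabilityMeasure_map (hV k₀).aemeasurable
  have hmeas : ∀ k, Measurable fun ω i => V (e k i) ω := fun k => measurable_pi_iff.2 fun i => hV _
  have hblock : ∀ k, P.map (fun ω i => V (e k i) ω) = Measure.infinitePi fun _ => P.map (V k₀) :=
    fun k => map_comp_eq_infinitePi hV h k₀ hid (g := e k) fun i j hij => by
      have := @he (k, i) (k, j) hij
      exact (Prod.mk.inj this).2
  constructor
  · refine iIndepFun.comp (f := fun k ω i => V (e k i) ω) ?_ (fun _ => φ) fun _ => hφ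
    rw [iIndepFun_iff_map_fun_eq_infinitePi_map hmeas]
    simp only [hblock]
    rw [← Measure.infinitePi_map_curry (fun (_ : ℕ) (_ : J) => P.map (V k₀)),
      ← map_comp_eq_infinitePi hV h k₀ hid he, Measure.map_map (MeasurableEquiv.measurable _)
        (measurable_pi_iff.2 fun p => hV _)]
    rfl
  · intro k l
    refine IdentDistrib.comp ⟨(hmeas k).aemeasurable, (hmeas l).aemeasurable, ?_⟩ hφ
    rw [hblock, hblock]

omit [IsProbabilityMeasure P] in
-- It suffices to test rectangles, a π-system generating each pair; there the probability factors
-- over the two sequences first and over the indices next.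
theorem iIndepFun_prodMk {ι E E' : Type*} [MeasurableSpace E] [MeasurableSpace E']
    {A : ι → Ω → E} {B : ι → Ω → E'} (hAm : ∀ i, Measurable (A i)) (hBm : ∀ i, Measurable (B i))
    (hA : iIndepFun A P) (hB : iIndepFun B P)
    (hAB : IndepFun (fun ω i => A i ω) (fun ω i => B i ω) P) :
    iIndepFun (fun i ω => (A i ω, B i ω)) P := by
  set π : ι → Set (Set Ω) := fun i =>
    {u | ∃ s t, MeasurableSet s ∧ MeasurableSet t ∧ A i ⁻¹' s ∩ B i ⁻¹' t = u}
  rw [iIndepFun_iff_iIndep]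
  refine iIndepSets.iIndep (fun i => ((hAm i).prodMk (hBm i)).comap_le) π ?_ ?_ ?_
  · rintro i _ ⟨s, t, hs, ht, rfl⟩ _ ⟨s', t', hs', ht', rfl⟩ -
    refine ⟨s ∩ s', t ∩ t', hs.inter hs', ht.inter ht', ?_⟩
    ext ω
    simp only [Set.mem_inter_iff, Set.mem_preimage]
    tauto
  · intro i
    rw [← generateFrom_prod, MeasurableSpace.comap_generateFrom]
    congr 1
    ext u
    constructor
    · rintro ⟨_, ⟨s, hs, t, ht, rfl⟩, rfl⟩
      exact ⟨s, t, hs, ht, rfl⟩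
    · rintro ⟨s, t, hs, ht, rfl⟩
      exact ⟨s ×ˢ t, ⟨s, hs, t, ht, rfl⟩, rfl⟩
  · rw [iIndepSets_iff]
    intro S f hf
    choose! s t hs ht hst using hf
    have hSs : MeasurableSet {x : ι → E | ∀ i ∈ S, x i ∈ s i} := by
      rw [show {x : ι → E | ∀ i ∈ S, x i ∈ s i} = ⋂ i ∈ S, {x | x i ∈ s i} by ext; simp]
      exact Finset.measurableSet_biInter S fun i hi => measurable_pi_apply i (hs i hi)
    have hSt : MeasurableSet {x : ι → E' | ∀ i ∈ S, x i ∈ t i} := by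
      rw [show {x : ι → E' | ∀ i ∈ S, x i ∈ t i} = ⋂ i ∈ S, {x | x i ∈ t i} by ext; simp]
      exact Finset.measurableSet_biInter S fun i hi => measurable_pi_apply i (ht i hi)
    have h1 := hAB.measure_inter_preimage_eq_mul _ _ hSs hSt
    have h2 : (fun ω i => A i ω) ⁻¹' {x | ∀ i ∈ S, x i ∈ s i} = ⋂ i ∈ S, A i ⁻¹' s i := by
      ext; simp
    have h3 : (fun ω i => B i ω) ⁻¹' {x | ∀ i ∈ S, x i ∈ t i} = ⋂ i ∈ S, B i ⁻¹' t i := by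
      ext; simp
    have h4 : ⋂ i ∈ S, f i = (⋂ i ∈ S, A i ⁻¹' s i) ∩ ⋂ i ∈ S, B i ⁻¹' t i := by
      rw [Set.iInter₂_congr fun i hi => (hst i hi).symm]
      ext ω
      simp only [Set.mem_iInter, Set.mem_inter_iff]
      exact ⟨fun h => ⟨fun i hi => (h i hi).1, fun i hi => (h i hi).2⟩,
        fun h i hi => ⟨h.1 i hi, h.2 i hi⟩⟩
    rw [h2, h3, hA.measure_inter_preimage_eq_mul S hs, hB.measure_inter_preimage_eq_mul S ht] at h1
    rw [h4, h1, ← Finset.prod_mul_distrib]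
    refine Finset.prod_congr rfl fun i hi => ?_
    rw [← hst i hi]
    exact ((hAB.comp (measurable_pi_apply i) (measurable_pi_apply i)).measure_inter_preimage_eq_mul
      _ _ (hs i hi) (ht i hi)).symm

theorem identDistrib_prodMk {E E' : Type*} [MeasurableSpace E] [MeasurableSpace E']
    {A A' : Ω → E} {B B' : Ω → E'} (hA : IdentDistrib A A' P P) (hB : IdentDistrib B B' P P)
    (h : A ⟂ᵢ[P] B) (h' : A' ⟂ᵢ[P] B') :
    IdentDistrib (fun ω => (A ω, B ω)) (fun ω => (A' ω, B' ω)) P P := by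
  refine ⟨hA.aemeasurable_fst.prodMk hB.aemeasurable_fst,
    hA.aemeasurable_snd.prodMk hB.aemeasurable_snd, ?_⟩
  rw [(indepFun_iff_map_prod_eq_prod_map_map hA.aemeasurable_fst hB.aemeasurable_fst).1 h,
    (indepFun_iff_map_prod_eq_prod_map_map hA.aemeasurable_snd hB.aemeasurable_snd).1 h',
    hA.map_eq, hB.map_eq]

end Iid

theorem bddAbove_of_eventually_le {u : ℕ → ℝ} {c : ℝ} (h : ∀ᶠ n in atTop, u n ≤ c) :
    ∃ A, ∀ n, u n ≤ A := by
  obtain ⟨n₀, hn⟩ := eventually_atTop.1 h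
  refine ⟨max c (∑ n ∈ Finset.range n₀, |u n|), fun n => ?_⟩
  rcases le_or_gt n₀ n with h1 | h1
  · exact (hn n h1).trans (le_max_left _ _)
  · refine le_max_of_le_right ((le_abs_self _).trans ?_)
    exact Finset.single_le_sum (f := fun n => |u n|) (fun _ _ => abs_nonneg _)
      (Finset.mem_range.2 h1)

/-! ### The saturated network and the constant $\gamma(0)$. -/

section Network

variable {M : Type*}

theorem dater_eq_of_length (f : (l : ℕ) → (Fin l → ℝ) → (Fin l → M) → ℝ) {m n : ℤ} {l : ℕ}
    (h : (n - m + 1).toNat = l) (z : ℤ → M) :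
    dater f m n (fun _ => 0) z = f l (fun _ => 0) fun i => z (m + (i : ℕ)) := by
  subst h
  simp [dater, lastActivity]

variable [MeasurableSpace M] {Ω : Type*} [MeasurableSpace Ω] {P : Measure Ω} [IsProbabilityMeasure P]
  {f : (l : ℕ) → (Fin l → ℝ) → (Fin l → M) → ℝ} (hf : MonotoneSeparable f)
  {T : ℤ → Ω → ℝ} {ζ : ℤ → Ω → M} (hinput : NetworkInput P f T ζ) (hIA : IA P T ζ)

include hf in
theorem MonotoneSeparable.measurable_zero (l : ℕ) :
    Measurable fun v : Fin l → M => f l (fun _ => 0) v :=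
  (hf.measurable l).comp (measurable_const.prodMk measurable_id)

include hf hinput

omit [IsProbabilityMeasure P] in
theorem measurable_dater_zero (m n : ℤ) :
    Measurable fun ω => dater f m n (fun _ => 0) fun i => ζ i ω := by
  refine Measurable.sub ((hf.measurable _).comp (Measurable.prodMk ?_ ?_)) measurable_const
  · exact measurable_const
  · exact measurable_pi_iff.2 fun i => hinput.measurable_marks _

omit [IsProbabilityMeasure P] in
-- Subadditivity bounds the saturated dater by the sum of the one-point daters, which do not depend
-- on the points.
theorem integrable_dater_zero {m n : ℤ} (hmn : m ≤ n) :
    Integrable (fun ω => dater f m n (fun _ => 0) fun i => ζ i ω) P := by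
  obtain ⟨k, rfl⟩ := Int.le.dest hmn
  have h1 : Integrable (fun ω => ∑ i ∈ Finset.range (k + 1),
      dater f (m + i) (m + i) (fun _ => 0) fun i => ζ i ω) P := by
    refine integrable_finsetSum _ fun i _ => (hinput.integrable_dater (m + i)).congr ?_
    exact Eventually.of_forall fun ω => hf.dater_self _ _ _
  refine h1.mono' (measurable_dater_zero hf hinput _ _).aestronglyMeasurable
    (Eventually.of_forall fun ω => ?_)
  rw [Real.norm_of_nonneg (hf.dater_zero_nonneg _ hmn)]
  exact hf.dater_zero_le_sum _ m k

include hIA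

omit hf in
theorem identDistrib_block {l : ℕ} (m m' : ℤ) :
    IdentDistrib (fun ω (i : Fin l) => ζ (m + (i : ℕ)) ω) (fun ω (i : Fin l) => ζ (m' + (i : ℕ)) ω)
      P P := by
  have hlaw : ∀ m : ℤ, P.map (fun ω (i : Fin l) => ζ (m + (i : ℕ)) ω) =
      Measure.infinitePi fun _ => P.map (ζ 0) := fun m =>
    map_comp_eq_infinitePi hinput.measurable_marks hIA.indep_marks 0 hIA.ident_marks
      (g := fun i : Fin l => m + (i : ℕ)) fun i j hij => by
        ext; simpa using hij
  refine ⟨(measurable_pi_iff.2 fun i => hinput.measurable_marks _).aemeasurable,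
    (measurable_pi_iff.2 fun i => hinput.measurable_marks _).aemeasurable, ?_⟩
  rw [hlaw, hlaw]

theorem integral_dater_zero_shift {m n m' n' : ℤ} (h : n - m = n' - m') :
    ∫ ω, dater f m n (fun _ => 0) (fun i => ζ i ω) ∂P =
      ∫ ω, dater f m' n' (fun _ => 0) (fun i => ζ i ω) ∂P := by
  have h1 : (n - m + 1).toNat = (n' - m' + 1).toNat := by rw [h]
  simp only [dater_eq_of_length f h1, dater_eq_of_length f (rfl : (n' - m' + 1).toNat = _)]
  exact ((identDistrib_block hinput hIA m m').comp (hf.measurable_zero _)).integral_eq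

/-- The expected dater per customer under saturation. -/
theorem tendsto_gammaZero :
    0 ≤ gammaZero P f ζ ∧ Tendsto (fun n : ℕ =>
      (∫ ω, dater f (-(n : ℤ)) (-1) (fun _ => 0) (fun i => ζ i ω) ∂P) / (n : ℝ)) atTop
      (𝓝 (gammaZero P f ζ)) := by
  set u : ℕ → ℝ := fun n => ∫ ω, dater f (-(n : ℤ)) (-1) (fun _ => 0) (fun i => ζ i ω) ∂P
  -- At $n=0$ the window $[0,-1]$ is empty and the axioms say nothing, so the value is set to 0
  -- before Fekete's lemma is applied.
  set u' : ℕ → ℝ := fun n => if n = 0 then 0 else u n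
  have hpos : ∀ n, 0 ≤ u' n := fun n => by
    simp only [u']
    split_ifs with h
    · exact le_rfl
    · exact integral_nonneg fun ω => hf.dater_zero_nonneg _ (by omega)
  have hsub : Subadditive u' := by
    intro m n
    rcases Nat.eq_zero_or_pos m with rfl | hm
    · simp [u']
    rcases Nat.eq_zero_or_pos n with rfl | hn
    · simp [u']
    simp only [u']
    rw [if_neg (by omega), if_neg (by omega), if_neg (by omega)]
    have h1 : u m = ∫ ω, dater f (-((m + n : ℕ) : ℤ)) (-(n : ℤ) - 1) (fun _ => 0) (fun i => ζ i ω) ∂P :=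
      integral_dater_zero_shift hf hinput hIA (by push_cast; ring)
    rw [h1, ← integral_add (integrable_dater_zero hf hinput (by push_cast; omega))
      (integrable_dater_zero hf hinput (by omega))]
    refine integral_mono (integrable_dater_zero hf hinput (by push_cast; omega))
      ((integrable_dater_zero hf hinput (by push_cast; omega)).add
      (integrable_dater_zero hf hinput (by omega))) fun ω => ?_
    have h2 := hf.dater_zero_le_add (fun i => ζ i ω) (m := -((m + n : ℕ) : ℤ)) (l := -(n : ℤ) - 1)
      (n := -1) (by push_cast; omega) (by omega)
    rw [sub_add_cancel] at h2
    exact h2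
  have hbdd : BddBelow (Set.range fun n => u' n / n) := ⟨0, by
    rintro _ ⟨n, rfl⟩
    exact div_nonneg (hpos n) n.cast_nonneg⟩
  have h1 := hsub.tendsto_lim hbdd
  have h2 : Tendsto (fun n : ℕ => u n / n) atTop (𝓝 hsub.lim) := by
    refine h1.congr' ?_
    filter_upwards [eventually_ne_atTop 0] with n hn
    simp [u', hn]
  have h3 : gammaZero P f ζ = hsub.lim := h2.limUnder_eq
  rw [h3]
  exact ⟨ge_of_tendsto' h1 fun n => div_nonneg (hpos n) n.cast_nonneg, h2⟩

omit hf hIA [IsProbabilityMeasure P] in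
theorem measurable_interarrival (n : ℤ) : Measurable (interarrival T n) :=
  (hinput.measurable_points _).sub (hinput.measurable_points _)

end Network

/-! ### The dominating batch queue as a random walk. -/

/-- The increments of the walk which dominates the maximal dater: service times of batches of `L`
points minus the times between batches. -/
def batchIncrement {Ω M : Type*} (f : (l : ℕ) → (Fin l → ℝ) → (Fin l → M) → ℝ) (T : ℤ → Ω → ℝ)
    (ζ : ℤ → Ω → M) (L : ℕ) (k : ℕ) (ω : Ω) : ℝ :=
  batchDater f L (fun i => ζ i ω) k -
    if k = 0 then 0 else T (-(k * L : ℤ) + L) ω - T (-(k * L : ℤ)) ω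

theorem walk_batchIncrement {Ω M : Type*} (f : (l : ℕ) → (Fin l → ℝ) → (Fin l → M) → ℝ)
    (T : ℤ → Ω → ℝ) (ζ : ℤ → Ω → M) (L : ℕ) (k : ℕ) (ω : Ω) :
    walk (batchIncrement f T ζ L) k ω =
      ∑ p ∈ Finset.range (k + 1), batchDater f L (fun i => ζ i ω) p
        - (T 0 ω - T (-(k * L : ℤ)) ω) := by
  induction k with
  | zero => simp [walk, batchIncrement]
  | succ k ih =>
    rw [walk, Finset.sum_range_succ, Finset.sum_range_succ _ (k + 1)]
    change walk _ k ω + _ = _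
    rw [ih, batchIncrement, if_neg (Nat.succ_ne_zero k)]
    have : (-((k + 1 : ℕ) * L : ℤ) + L) = -(k * L : ℤ) := by push_cast; ring
    rw [this]
    ring

section Network

variable {M : Type*} [MeasurableSpace M]
  {Ω : Type*} [MeasurableSpace Ω] {P : Measure Ω} [IsProbabilityMeasure P]
  {f : (l : ℕ) → (Fin l → ℝ) → (Fin l → M) → ℝ} (hf : MonotoneSeparable f)
  {T : ℤ → Ω → ℝ} {ζ : ℤ → Ω → M} (hinput : NetworkInput P f T ζ) (hIA : IA P T ζ)
include hf hinput

omit [IsProbabilityMeasure P] in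
theorem exists_lt_walk_of_lt_maximalDater {L : ℕ} (hL : 0 < L) (x : ℝ) (ω : Ω)
    (h : (x : EReal) < maximalDater f T ζ ω) : ∃ k, x < walk (batchIncrement f T ζ L) k ω := by
  obtain ⟨n, hn⟩ := (lt_maximalDater_iff hf (hinput.monotone_points ω) x).1 h
  by_contra hc
  push Not at hc
  refine absurd (hf.dater_le_of_batches (hinput.monotone_points ω) (fun i => ζ i ω) hL (x := x)
    (fun k => ?_) n) (not_le.2 hn)
  rw [← walk_batchIncrement f T ζ L k ω]
  exact hc k

include hIA

/-- Service times depend on disjoint blocks of marks and gaps on disjoint blocks of interarrival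
times, so the increments are independent, and identically distributed from index 1 on. Their mean is
below $-m$, and the strong law keeps almost every path under a line of slope $-m$. -/
theorem descendingWalk_batchIncrement {L : ℕ} (hL : 0 < L) {m : ℝ} (hm : 0 < m)
    (hmL : m < L * (∫ ω, interarrival T 0 ω ∂P) -
      ∫ ω, dater f (-(L : ℤ)) (-1) (fun _ => 0) (fun i => ζ i ω) ∂P) :
    DescendingWalk P (batchIncrement f T ζ L) m := by
  have hL0 : (0 : ℤ) < L := by exact_mod_cast hL
  have he : ∀ c : ℤ, Function.Injective fun p : ℕ × Fin L => c - p.1 * L + (p.2 : ℕ) := by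
    rintro c ⟨k, i⟩ ⟨k', i'⟩ h
    have hi := i.2
    have hi' := i'.2
    simp only at h
    have h1 : (k : ℤ) = k' := by
      by_contra hne
      rcases lt_or_gt_of_ne hne with h2 | h2
      · have : ((k : ℤ) + 1) * L ≤ k' * L := mul_le_mul_of_nonneg_right h2 hL0.le
        nlinarith
      · have : ((k' : ℤ) + 1) * L ≤ k * L := mul_le_mul_of_nonneg_right h2 hL0.le
        nlinarith
    have h2 : (i : ℕ) = i' := by rw [h1] at h; omega
    exact Prod.ext (by exact_mod_cast h1) (Fin.ext h2)
  set s : ℕ → Ω → ℝ := fun k ω => batchDater f L (fun i => ζ i ω) k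
  set σ : ℕ → Ω → ℝ := fun k ω => T (-(k * L : ℤ) + L) ω - T (-(k * L : ℤ)) ω
  have hs : ∀ k, s k = fun ω => f L (fun _ => 0) fun i : Fin L => ζ (1 - L - k * L + (i : ℕ)) ω := by
    intro k
    funext ω
    simp only [s, batchDater]
    rw [dater_eq_of_length f (l := L) (by
      rw [show (-(k * L : ℤ) - (-((k + 1) * L : ℤ) + 1) + 1) = L by ring]; rfl)]
    congr 1
    funext i
    congr 1
    ring
  have hσ : ∀ k, σ k = fun ω => ∑ i : Fin L, interarrival T (0 - k * L + (i : ℕ)) ω := by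
    intro k
    funext ω
    simp only [σ, zero_sub]
    rw [Fin.sum_univ_eq_sum_range (fun i => interarrival T (-(k * L : ℤ) + (i : ℕ)) ω)]
    have := Finset.sum_range_sub (fun i : ℕ => T (-(k * L : ℤ) + i) ω) L
    simp only [CharP.cast_eq_zero, add_zero, Nat.cast_add, Nat.cast_one] at this
    rw [← this]
    refine Finset.sum_congr rfl fun i _ => ?_
    rw [interarrival, add_assoc]
  have hmζ := hinput.measurable_marks
  have hmτ := measurable_interarrival hinput
  have hsm : ∀ k, Measurable (s k) := fun k => measurable_dater_zero hf hinput _ _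
  have hσm : ∀ k, Measurable (σ k) := fun k =>
    (hinput.measurable_points _).sub (hinput.measurable_points _)
  obtain ⟨hsi, hsd⟩ := iIndepFun_blocks hmζ hIA.indep_marks 0 hIA.ident_marks
    (e := fun k (i : Fin L) => 1 - L - k * L + (i : ℕ)) (he (1 - L))
    (hf.measurable_zero L)
  obtain ⟨hσi, hσd⟩ := iIndepFun_blocks hmτ hIA.indep_interarrival 0 hIA.ident_interarrival
    (e := fun k (i : Fin L) => 0 - k * L + (i : ℕ)) (he 0)
    (φ := fun v : Fin L → ℝ => ∑ i, v i) (by fun_prop)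
  rw [← (funext hs : s = _)] at hsi
  rw [← (funext hσ : σ = _)] at hσi
  replace hsd : ∀ k l, IdentDistrib (s k) (s l) P P := fun k l => by rw [hs, hs]; exact hsd k l
  replace hσd : ∀ k l, IdentDistrib (σ k) (σ l) P P := fun k l => by rw [hσ, hσ]; exact hσd k l
  have hindep : IndepFun (fun ω k => s k ω) (fun ω k => σ k ω) P := by
    have h1 := hIA.indep.symm.comp
      (φ := fun (z : ℤ → M) (k : ℕ) => f L (fun _ => 0) fun i : Fin L => z (1 - L - k * L + (i : ℕ)))
      (ψ := fun (v : ℤ → ℝ) (k : ℕ) => ∑ i : Fin L, v (0 - k * L + (i : ℕ)))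
      (measurable_pi_iff.2 fun k => (hf.measurable_zero L).comp
        (measurable_pi_iff.2 fun i => measurable_pi_apply _)) (by fun_prop)
    have e1 : (fun ω k => s k ω) = fun ω (k : ℕ) => f L (fun _ => 0)
        fun i : Fin L => ζ (1 - L - k * L + (i : ℕ)) ω := by
      funext ω k; exact congrFun (hs k) ω
    have e2 : (fun ω k => σ k ω) = fun ω (k : ℕ) =>
        ∑ i : Fin L, interarrival T (0 - k * L + (i : ℕ)) ω := by
      funext ω k; exact congrFun (hσ k) ω
    rw [e1, e2]
    exact h1
  have hpair := iIndepFun_prodMk hsm hσm hsi hσi hindep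
  have hX : batchIncrement f T ζ L = fun k ω =>
      (fun p : ℝ × ℝ => p.1 - if k = 0 then 0 else p.2) (s k ω, σ k ω) := rfl
  have hg : ∀ k : ℕ, Measurable fun p : ℝ × ℝ => p.1 - if k = 0 then 0 else p.2 := fun k => by
    split_ifs <;> fun_prop
  have hXm : ∀ k, Measurable (batchIncrement f T ζ L k) := fun k =>
    (hg k).comp ((hsm k).prodMk (hσm k))
  have hXi : iIndepFun (batchIncrement f T ζ L) P := hpair.comp _ hg
  have hXd : ∀ k, IdentDistrib (batchIncrement f T ζ L (k + 1)) (batchIncrement f T ζ L 1) P P := by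
    intro k
    have hi : ∀ k, s k ⟂ᵢ[P] σ k := fun k =>
      hindep.comp (measurable_pi_apply k) (measurable_pi_apply k)
    exact (identDistrib_prodMk (hsd (k + 1) 1) (hσd (k + 1) 1) (hi _) (hi _)).comp (hg 1)
  have hsint : ∀ k, Integrable (s k) P := fun k =>
    integrable_dater_zero hf hinput (by nlinarith)
  have hσint : ∀ k, Integrable (σ k) P := fun k => by
    rw [hσ]
    exact integrable_finsetSum _ fun i _ => hinput.integrable_interarrival _
  have hmean : ∫ ω, batchIncrement f T ζ L 1 ω ∂P < -m := by
    have e1 : ∫ ω, batchIncrement f T ζ L 1 ω ∂P = ∫ ω, s 1 ω ∂P - ∫ ω, σ 1 ω ∂P :=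
      integral_sub (hsint 1) (hσint 1)
    have e2 : ∫ ω, s 1 ω ∂P = ∫ ω, dater f (-(L : ℤ)) (-1) (fun _ => 0) (fun i => ζ i ω) ∂P :=
      integral_dater_zero_shift hf hinput hIA (by push_cast; ring)
    have e3 : ∫ ω, σ 1 ω ∂P = L * ∫ ω, interarrival T 0 ω ∂P := by
      rw [hσ, integral_finsetSum _ fun i _ => hinput.integrable_interarrival _]
      simp only [(hIA.ident_interarrival _).integral_eq]
      simp
    rw [e1, e2, e3]
    linarith
  refine ⟨hXm, hXi, hXd, Eventually.of_forall fun ω => ?_, hm, ?_⟩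
  · simp only [batchIncrement, if_true, sub_zero]
    exact hf.dater_zero_nonneg _ (by simp; omega)
  · have hslln := strong_law_ae_real (fun k => batchIncrement f T ζ L (k + 1))
      ((hsint 1).sub (hσint 1)) (fun i j hij => hXi.indepFun (by simpa using hij)) hXd
    filter_upwards [hslln] with ω hω
    have h1 := hω.eventually_lt_const hmean
    -- Eventually the increments from 1 to $n$ sum to less than $-nm$, so the walk plus $nm$ is
    -- below its starting value; finitely many indices remain.
    obtain ⟨A, hA⟩ := bddAbove_of_eventually_le (c := batchIncrement f T ζ L 0 ω)
      (u := fun k => walk (batchIncrement f T ζ L) k ω + k * m) (by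
        filter_upwards [h1, eventually_gt_atTop 0] with n hn hn0
        have hn0 : (0 : ℝ) < n := by exact_mod_cast hn0
        rw [div_lt_iff₀ hn0] at hn
        rw [walk, Finset.sum_range_succ']
        linarith)
    exact ⟨A, fun k => by have := hA k; linarith⟩

end Network

/-! ### From one index to sums over all indices. -/

namespace IntegratedPair

variable {F ν : Measure ℝ} (h : IntegratedPair F ν)
include h

/-- Summation along a line turns $o(\overline F)$ into $o(\overline F^s)$; this is how estimates for
a single batch are used. -/
theorem negligible_tsum {g : ℝ → ℝ≥0∞} (hg : Negligible F g) {c : ℝ} (hc : 0 < c) (B : ℝ) :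
    Negligible ν fun x => ∑' n : ℕ, g (x - B + n * c) := by
  intro ε hε
  have hD : ENNReal.ofReal (1 / c + 1) ≠ 0 := by
    simp only [ne_eq, ENNReal.ofReal_eq_zero, not_le]; positivity
  obtain ⟨y₀, hy₀⟩ := eventually_atTop.1
    (hg (ε / ENNReal.ofReal (1 / c + 1)) (by simp [hε]))
  filter_upwards [h.eventually_tsum_le hc one_pos B, eventually_ge_atTop (y₀ + B)] with x h1 h2
  calc _ ≤ ∑' n : ℕ, ε / ENNReal.ofReal (1 / c + 1) * F (Set.Ioi (x - B + n * c)) := by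
        refine ENNReal.tsum_le_tsum fun n => hy₀ _ ?_
        have : (0 : ℝ) ≤ n * c := by positivity
        linarith
    _ ≤ ε / ENNReal.ofReal (1 / c + 1) * (ENNReal.ofReal (1 / c + 1) * ν (Set.Ioi x)) := by
        rw [ENNReal.tsum_mul_left]; gcongr
    _ = ε * ν (Set.Ioi x) := by
        rw [← mul_assoc, ENNReal.div_mul_cancel hD ENNReal.ofReal_ne_top]

/-- This is the truncation condition; the shift by $B$ costs a factor 2 because `F` is long-tailed.
-/
theorem negligible_sum_lt {N : ℝ → ℕ} (hν : ∀ x, 0 ≤ x → tail ν x = integratedTail F x)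
    (hN : TruncationLevel F N) {c : ℝ} (hc : 0 < c) (B : ℝ) :
    Negligible ν fun x => ∑ n ∈ Finset.range (N x), F (Set.Ioi (x - B + n * c)) := by
  have := h.subexp.prob
  have := h.subexp_integrated.prob
  have h1 : Negligible ν fun x => ∑ n ∈ Finset.range (N x + 1), F (Set.Ioi (x + n * c)) := by
    refine Negligible.of_tendsto h.subexp_integrated.tail_pos (fun x => ?_) ?_
    · exact (ENNReal.sum_lt_top.2 fun n _ => measure_lt_top _ _).ne
    · have h2 : (fun x : ℝ => ∑ n ∈ Finset.range (N x + 1), tail F (x + n * c)) =o[atTop] tail ν :=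
        (hN.negligible c).trans_eventuallyEq (by
          filter_upwards [eventually_ge_atTop 0] with x hx using (hν x hx).symm)
      refine h2.tendsto_div_nhds_zero.congr fun x => ?_
      rw [ENNReal.toReal_sum fun n _ => measure_ne_top _ _]
      rfl
  refine (h1.const_mul (C := 2) (by simp)).mono ?_
  obtain ⟨y₀, hy₀⟩ := eventually_atTop.1 (h.subexp.eventually_measure_Ioi_sub_le B (C := 2) (by simp))
  filter_upwards [eventually_ge_atTop y₀] with x hx
  rw [Finset.mul_sum]
  refine (Finset.sum_le_sum fun n _ => ?_).trans
    (Finset.sum_le_sum_of_subset (Finset.range_mono (Nat.le_succ _)))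
  have : (0 : ℝ) ≤ n * c := by positivity
  have h3 := hy₀ (x + n * c) (by linarith)
  rwa [add_sub_right_comm] at h3

end IntegratedPair

theorem tendsto_max_tail {Ω : Type*} [MeasurableSpace Ω] {P : Measure Ω} {r : ℕ}
    {Y : Fin r → ℤ → Ω → ℝ} {F : Measure ℝ} {d : Fin r → ℝ} (hSE : SE P F Y d) (hH : HypH P Y) :
    Tendsto (fun y => P.real {ω | ∃ j, y < Y j 1 ω} / tail F y) atTop (𝓝 (∑ j, d j)) := by
  have h1 : Tendsto (fun y => (∑ j, P.real {ω | y < Y j 1 ω}) / tail F y) atTop (𝓝 (∑ j, d j)) := by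
    simp only [Finset.sum_div]
    exact tendsto_finsetSum _ fun j _ => hSE.tail_equiv j
  have h2 := (hH.max_equiv_sum.div (IsEquivalent.refl (u := tail F))).symm
  exact h2.tendsto_nhds h1

/-! ### From a big batch to a single big component. -/

section Summands

variable {Ω M : Type*} [MeasurableSpace Ω] [MeasurableSpace M] {P : Measure Ω}
  [IsProbabilityMeasure P] {f : (l : ℕ) → (Fin l → ℝ) → (Fin l → M) → ℝ}
  {T : ℤ → Ω → ℝ} {ζ : ℤ → Ω → M} {r : ℕ} {Y : Fin r → ℤ → Ω → ℝ} (hAA : AA P f T ζ Y)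
  {F : Measure ℝ} {d : Fin r → ℝ} (hSE : SE P F Y d)

include hAA

omit [IsProbabilityMeasure P] in
theorem AA.measure_gt (j : Fin r) (i : ℤ) (y : ℝ) :
    P {ω | y < Y j i ω} = P {ω | y < Y j 1 ω} := by
  have h1 : ∀ i, P {ω | y < Y j i ω} = P {ω | y < Y j 0 ω} := fun i =>
    ((hAA.ident i).comp (measurable_pi_apply j)).measure_mem_eq (measurableSet_Ioi (a := y))
  rw [h1 i, h1 1]

theorem AA.measure_block {L : ℕ} {S : Set (Fin L → Fin r → ℝ)} (hS : MeasurableSet S) (c c' : ℤ) :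
    P {ω | (fun (i : Fin L) j => Y j (c + (i : ℕ)) ω) ∈ S} =
      P {ω | (fun (i : Fin L) j => Y j (c' + (i : ℕ)) ω) ∈ S} := by
  have hm : ∀ i, Measurable fun ω j => Y j i ω := fun i => measurable_pi_iff.2 fun j => hAA.measurable j i
  have hlaw : ∀ c : ℤ, P {ω | (fun (i : Fin L) j => Y j (c + (i : ℕ)) ω) ∈ S} =
      Measure.infinitePi (fun _ : Fin L => P.map fun ω j => Y j 0 ω) S := fun c => by
    rw [← map_comp_eq_infinitePi hm hAA.indep 0 hAA.ident
      (g := fun i : Fin L => c + (i : ℕ)) (fun i j hij => by ext; simpa using hij),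
      Measure.map_apply (measurable_pi_iff.2 fun i => hm _) hS]
    rfl
  rw [hlaw, hlaw]

include hSE

omit [IsProbabilityMeasure P] in
theorem tendsto_sum_tail (hH : HypH P Y) (i : ℤ) :
    Tendsto (fun y => P.real {ω | y < ∑ j, Y j i ω} / tail F y) atTop (𝓝 (∑ j, d j)) := by
  have h2 := (hH.sum_equiv_max.div (IsEquivalent.refl (u := tail F))).symm
  refine (h2.tendsto_nhds (tendsto_max_tail hSE hH)).congr fun y => ?_
  have hS : MeasurableSet {v : Fin r → ℝ | y < ∑ j, v j} :=
    measurableSet_lt measurable_const (by fun_prop)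
  have h1 : ∀ i, P {ω | y < ∑ j, Y j i ω} = P {ω | y < ∑ j, Y j 0 ω} := fun i =>
    (hAA.ident i).measure_mem_eq hS
  simp only [Measure.real, h1 i, h1 1, Pi.div_apply]

/-- For nonnegative components $\{\max>y\}\subseteq\{\sum>y\}$, so this probability is the
difference of two tails that (H) makes equivalent. -/
theorem negligible_sum_without_max (hH : HypH P Y) (i : ℤ) :
    Negligible F fun y => P {ω | (∀ j, Y j i ω ≤ y) ∧ y < ∑ j, Y j i ω} := by
  have := hSE.subexp.prob
  refine Negligible.of_tendsto hSE.subexp.tail_pos (fun _ => measure_ne_top _ _) ?_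
  have h0 := (tendsto_sum_tail hAA hSE hH 1).sub (tendsto_max_tail hSE hH)
  rw [sub_self] at h0
  refine h0.congr' ?_
  filter_upwards [eventually_ge_atTop 0] with y hy
  have hS : MeasurableSet {v : Fin r → ℝ | (∀ j, v j ≤ y) ∧ y < ∑ j, v j} := by
    have : {v : Fin r → ℝ | ∀ j, v j ≤ y} = ⋂ j, {v | v j ≤ y} := by ext; simp
    have h2 : MeasurableSet {v : Fin r → ℝ | y < ∑ j, v j} :=
      measurableSet_lt measurable_const (by fun_prop)
    refine MeasurableSet.inter (s₁ := {v : Fin r → ℝ | ∀ j, v j ≤ y}) ?_ h2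
    rw [this]
    exact MeasurableSet.iInter fun j => measurableSet_le (by fun_prop) measurable_const
  have h1 : ∀ i, P {ω | (∀ j, Y j i ω ≤ y) ∧ y < ∑ j, Y j i ω} =
      P {ω | (∀ j, Y j 0 ω ≤ y) ∧ y < ∑ j, Y j 0 ω} := fun i => (hAA.ident i).measure_mem_eq hS
  have hmax : MeasurableSet {ω | ∃ j, y < Y j 1 ω} := by
    rw [Set.ofPred_exists]
    exact MeasurableSet.iUnion fun j => measurableSet_lt measurable_const (hAA.measurable j 1)
  have h2 : P.real {ω | y < ∑ j, Y j 1 ω} = P.real {ω | ∃ j, y < Y j 1 ω} +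
      P.real {ω | (∀ j, Y j 1 ω ≤ y) ∧ y < ∑ j, Y j 1 ω} := by
    rw [← measureReal_union' (Set.disjoint_left.2 ?_) hmax]
    · refine measureReal_congr ?_
      filter_upwards [ae_all_iff.2 fun j => hAA.nonneg j 1] with ω hω
      refine propext ?_
      change y < ∑ j, Y j 1 ω ↔ (∃ j, y < Y j 1 ω) ∨ ((∀ j, Y j 1 ω ≤ y) ∧ y < ∑ j, Y j 1 ω)
      constructor
      · intro h3
        by_cases h4 : ∃ j, y < Y j 1 ω
        · exact Or.inl h4
        · push Not at h4
          exact Or.inr ⟨h4, h3⟩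
      · rintro (⟨j, hj⟩ | h3)
        · exact hj.trans_le (Finset.single_le_sum (f := fun j => Y j 1 ω) (fun j _ => hω j)
            (Finset.mem_univ j))
        · exact h3.2
    · rintro ω ⟨j, hj⟩ ⟨h3, _⟩
      exact absurd (h3 j) (not_le.2 hj)
  change _ = P.real _ / _
  rw [← sub_div, h2, add_sub_cancel_left]
  simp only [Measure.real, h1 i, h1 1]

/-- A block of summands is large because a single summand is. -/
theorem negligible_block (hH : HypH P Y) (L : ℕ) :
    (∃ C : ℝ≥0∞, C ≠ ∞ ∧ ∀ (c : ℤ) y,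
      P {ω | y < ∑ i : Fin L, ∑ j, Y j (c + (i : ℕ)) ω} ≤ C * F (Set.Ioi y)) ∧
    ∃ g : ℝ → ℝ≥0∞, Negligible F g ∧ ∀ (c : ℤ) y,
      P {ω | (∀ (i : Fin L) j, Y j (c + (i : ℕ)) ω ≤ y) ∧
        y < ∑ i : Fin L, ∑ j, Y j (c + (i : ℕ)) ω} ≤ g y := by
  have hWm : ∀ i : ℤ, Measurable fun ω => ∑ j, Y j i ω := fun i =>
    Finset.measurable_sum _ fun j _ => hAA.measurable j i
  have hind : iIndepFun (fun (i : ℕ) ω => ∑ j, Y j (0 + (i : ℤ)) ω) P :=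
    (hAA.indep.precomp (g := fun i : ℕ => (0 + (i : ℤ))) fun i j hij => by simpa using hij).comp
      (fun _ v => ∑ j, v j) fun _ => by fun_prop
  obtain ⟨h1, h2⟩ := negligible_sum_of_le hSE.subexp (fun i : ℕ => hWm (0 + (i : ℤ))) hind
    (fun i => by
      filter_upwards [ae_all_iff.2 fun j => hAA.nonneg j (0 + (i : ℤ))] with ω hω
      exact Finset.sum_nonneg fun j _ => hω j)
    (fun i => tendsto_sum_tail hAA hSE hH (0 + (i : ℤ))) L
  constructor
  · obtain ⟨C, hC, hle⟩ := exists_forall_le_mul_tail hSE.subexp (fun y => prob_le_one) h1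
    refine ⟨C, hC, fun c y => le_of_eq_of_le ?_ (hle y)⟩
    have hS : MeasurableSet {v : Fin L → Fin r → ℝ | y < ∑ i, ∑ j, v i j} :=
      measurableSet_lt measurable_const (by fun_prop)
    have h3 := hAA.measure_block hS c 0
    simp only [← Fin.sum_univ_eq_sum_range (fun i : ℕ => ∑ j, Y j (0 + (i : ℤ)) _)]
    exact h3
  · refine ⟨_, h2.add (Negligible.sum (s := Finset.univ) fun (i : Fin L) _ =>
      negligible_sum_without_max hAA hSE hH (0 + ((i : ℕ) : ℤ))), fun c y => ?_⟩
    have hS : MeasurableSet {v : Fin L → Fin r → ℝ | (∀ i j, v i j ≤ y) ∧ y < ∑ i, ∑ j, v i j} := by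
      have : {v : Fin L → Fin r → ℝ | ∀ i j, v i j ≤ y} = ⋂ i, ⋂ j, {v | v i j ≤ y} := by ext; simp
      have h2 : MeasurableSet {v : Fin L → Fin r → ℝ | y < ∑ i, ∑ j, v i j} :=
        measurableSet_lt measurable_const (by fun_prop)
      refine MeasurableSet.inter (s₁ := {v : Fin L → Fin r → ℝ | ∀ i j, v i j ≤ y}) ?_ h2
      rw [this]
      exact MeasurableSet.iInter fun i => MeasurableSet.iInter fun j =>
        measurableSet_le (by fun_prop) measurable_const
    refine (hAA.measure_block hS c 0).trans_le ?_
    refine (measure_mono (t := _ ∪ ⋃ i : Fin L, _) ?_).trans ((measure_union_le _ _).trans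
      (add_le_add le_rfl (measure_iUnion_fintype_le _ _)))
    rintro ω ⟨h3, h4⟩
    -- Either no point has a total above $y$, and several moderate totals add up, or some point has
    -- a large total with all its components at most $y$.
    by_cases h5 : ∀ i < L, ∑ j, Y j (0 + (i : ℤ)) ω ≤ y
    · refine Or.inl ⟨h5, ?_⟩
      rw [← Fin.sum_univ_eq_sum_range (fun i : ℕ => ∑ j, Y j (0 + (i : ℤ)) ω)]
      exact h4
    · push Not at h5
      obtain ⟨i, hi, h6⟩ := h5
      exact Or.inr (Set.mem_iUnion.2 ⟨⟨i, hi⟩, h3 ⟨i, hi⟩, h6⟩)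

end Summands

section Batches

variable {Ω M : Type*} [MeasurableSpace Ω] [MeasurableSpace M] {P : Measure Ω}
  {f : (l : ℕ) → (Fin l → ℝ) → (Fin l → M) → ℝ} (hf : MonotoneSeparable f)
  {T : ℤ → Ω → ℝ} {ζ : ℤ → Ω → M} (hinput : NetworkInput P f T ζ)
  {r : ℕ} {Y : Fin r → ℤ → Ω → ℝ} (hAA : AA P f T ζ Y)
include hf hinput hAA

/-- The time between batches is discarded; by subadditivity the batch dater is at most the sum of
its one-point daters, which (AA) identifies. -/
theorem ae_batchIncrement_le {L : ℕ} (hL : 0 < L) : ∀ᵐ ω ∂P, ∀ k : ℕ,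
    batchIncrement f T ζ L k ω ≤
      ∑ i : Fin L, ∑ j, Y j (-((k + 1) * L : ℤ) + 1 + (i : ℕ)) ω := by
  filter_upwards [ae_all_iff.2 hAA.dater_eq_sum] with ω hω k
  rw [Fin.sum_univ_eq_sum_range (fun i : ℕ => ∑ j, Y j (-((k + 1) * L : ℤ) + 1 + (i : ℤ)) ω)]
  have h1 := hf.dater_zero_le_sum (fun i => ζ i ω) (-((k + 1) * L : ℤ) + 1) (L - 1)
  rw [Nat.sub_add_cancel hL] at h1
  have h2 : (-((k + 1) * L : ℤ) + 1) + ((L - 1 : ℕ) : ℤ) = -(k * L : ℤ) := by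
    push_cast [Nat.cast_sub hL]; ring
  rw [h2] at h1
  have h3 : batchIncrement f T ζ L k ω ≤ batchDater f L (fun i => ζ i ω) k := by
    rw [batchIncrement]
    split_ifs
    · simp
    · have := hinput.monotone_points ω (show -(k * L : ℤ) ≤ -(k * L : ℤ) + L by omega)
      simp only at this
      linarith
  refine h3.trans (h1.trans (le_of_eq (Finset.sum_congr rfl fun i _ => ?_)))
  rw [← hω, hf.dater_self _ fun k => T k ω]

end Batches

/-- One $\delta$ serves the finitely many components. It precedes $B$ because $B$ will depend on the
batch length, which depends on $\delta$. -/
theorem IntegratedPair.exists_slope_forall_tsum_sub_le {F ν : Measure ℝ} (h : IntegratedPair F ν)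
    {r : ℕ} {S : Fin r → ℝ → ℝ≥0∞} (hSa : ∀ j, Antitone (S j)) (hS1 : ∀ j x, S j x ≤ 1)
    {d : Fin r → ℝ} (hS : ∀ j, Tendsto (fun x => (S j x).toReal / tail F x) atTop (𝓝 (d j)))
    {c : ℝ} (hc : 0 < c) {ε : ℝ} (hε : 0 < ε) :
    ∃ δ, 0 < δ ∧ δ < c ∧ ∀ B, 0 ≤ B → ∀ᶠ x in atTop, ∀ j,
      ∑' n : ℕ, (S j (x - B + n * (c - δ)) - S j (x + n * (c + δ))) ≤
        ENNReal.ofReal ε * ν (Set.Ioi x) := by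
  choose δ₀ h₀ h₁ using fun j => h.exists_tsum_sub_le (hSa j) (hS1 j) (hS j) hc hε
  obtain ⟨δ, hδ, hlt⟩ : ∃ δ, 0 < δ ∧ (δ < c ∧ ∀ j, δ < δ₀ j) := by
    have h1 : ∀ᶠ δ in 𝓝[>] (0 : ℝ), δ < c ∧ ∀ j, δ < δ₀ j :=
      Eventually.and (mem_of_superset (Ioo_mem_nhdsGT hc) fun x hx => hx.2)
        (eventually_all.2 fun j => Filter.mem_of_superset (Ioo_mem_nhdsGT (h₀ j)) fun x hx => hx.2)
    obtain ⟨δ, h2, h3⟩ := (h1.and self_mem_nhdsWithin).exists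
    exact ⟨δ, h3, h2⟩
  exact ⟨δ, hδ, hlt.1, fun B hB => eventually_all.2 fun j => (h₁ j δ hδ (hlt.2 j)).2 B hB⟩

/-! ### A large dater without the typical event. -/

section Typical

variable {Ω M : Type*} [MeasurableSpace Ω] [MeasurableSpace M] {P : Measure Ω}
  [IsProbabilityMeasure P] {f : (l : ℕ) → (Fin l → ℝ) → (Fin l → M) → ℝ}
  {T : ℤ → Ω → ℝ} {ζ : ℤ → Ω → M} {r : ℕ} {Y : Fin r → ℤ → Ω → ℝ}
  {F ν : Measure ℝ} {d : Fin r → ℝ} {N : ℝ → ℕ} {K : Fin r → ℕ → ℝ → Set Ω}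
  {η : Fin r → ℕ → ℝ}

theorem measure_compl_inter_preimage {A : Set Ω} (hA : MeasurableSet A) {V : Ω → ℝ} {B : Set ℝ}
    (h : P (A ∩ V ⁻¹' B) = P A * P (V ⁻¹' B)) :
    P (Aᶜ ∩ V ⁻¹' B) = P Aᶜ * P (V ⁻¹' B) := by
  have h1 := measure_inter_add_sdiff (μ := P) (V ⁻¹' B) hA
  rw [Set.inter_comm, h, Set.sdiff_eq, Set.inter_comm _ Aᶜ] at h1
  have h2 : P A * P (V ⁻¹' B) + P Aᶜ * P (V ⁻¹' B) = P (V ⁻¹' B) := by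
    rw [← add_mul, prob_add_prob_compl hA, one_mul]
  exact (ENNReal.add_right_inj (measure_ne_top _ _ |> ENNReal.mul_ne_top (measure_ne_top _ _))).1
    (h1.trans h2.symm)

/-- Independence factors each term; the complements of `K` have uniformly small probability for
$n\ge N_x$, and the remaining sum of tails is $O(\overline F^s(x))$. -/
theorem negligible_tsum_compl (hFν : IntegratedPair F ν) (hAA : AA P f T ζ Y) (hSE : SE P F Y d)
    (hKmeas : ∀ j n x, MeasurableSet (K j n x))
    (hKindep : ∀ j n x, ∀ B : Set ℝ, MeasurableSet B →
      P (K j n x ∩ Y j (-(n : ℤ)) ⁻¹' B) = P (K j n x) * P (Y j (-(n : ℤ)) ⁻¹' B))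
    (hKunif : ∀ j, ∀ ε : ℝ, 0 < ε → ∀ᶠ x in atTop, ∀ n : ℕ, N x ≤ n → 1 - ε < P.real (K j n x))
    (j : Fin r) {c : ℝ} (hc : 0 < c) (B : ℝ) :
    Negligible ν fun x => ∑' n : {n : ℕ // N x ≤ n},
      P ((K j n x)ᶜ ∩ {ω | x - B + (n : ℕ) * c < Y j (-((n : ℕ) : ℤ)) ω}) := by
  obtain ⟨C, hC, hCle⟩ := exists_forall_le_mul_tail hSE.subexp
    (T := fun y => P {ω | y < Y j 1 ω}) (fun y => prob_le_one) (hSE.tail_equiv j)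
  intro ε hε
  have hD0 : ENNReal.ofReal (1 / c + 1) ≠ 0 := by
    simp only [ne_eq, ENNReal.ofReal_eq_zero, not_le]; positivity
  set D := (C + 1) * ENNReal.ofReal (1 / c + 1)
  have hD : D ≠ ∞ := by finiteness
  have hDne : D ≠ 0 := by simp only [D, ne_eq, mul_eq_zero, not_or]; exact ⟨by simp, hD0⟩
  obtain ⟨e, he0, he⟩ := ENNReal.lt_iff_exists_nnreal_btwn.1
    (pos_iff_ne_zero.2 (show ε / D ≠ 0 by simp [hε, hD]))
  have he0 : 0 < e := by exact_mod_cast he0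
  filter_upwards [hKunif j e (by exact_mod_cast he0),
    hFν.eventually_tsum_le hc one_pos B] with x h1 h2
  have h3 : ∀ n : {n : ℕ // N x ≤ n},
      P ((K j n x)ᶜ ∩ {ω | x - B + (n : ℕ) * c < Y j (-((n : ℕ) : ℤ)) ω}) ≤
        e * (C * F (Set.Ioi (x - B + (n : ℕ) * c))) := by
    rintro ⟨n, hn⟩
    have h4 := measure_compl_inter_preimage (hKmeas j n x)
      (hKindep j n x (Set.Ioi (x - B + n * c)) measurableSet_Ioi)
    refine h4.trans_le (mul_le_mul' ?_ ?_)
    · have h5 := h1 n hn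
      have h6 := probReal_compl_eq_one_sub (μ := P) (hKmeas j n x)
      rw [← ENNReal.ofReal_coe_nnreal, ← ofReal_measureReal]
      exact ENNReal.ofReal_le_ofReal (by linarith)
    · exact (hAA.measure_gt j _ _).trans_le (hCle _)
  calc _ ≤ ∑' n : {n : ℕ // N x ≤ n}, e * (C * F (Set.Ioi (x - B + (n : ℕ) * c))) :=
        ENNReal.tsum_le_tsum h3
    _ ≤ ∑' n : ℕ, e * (C * F (Set.Ioi (x - B + n * c))) :=
        ENNReal.tsum_comp_le_tsum_of_injective Subtype.val_injective
          fun n : ℕ => e * (C * F (Set.Ioi (x - B + n * c)))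
    _ ≤ ε / D * ((C + 1) * (ENNReal.ofReal (1 / c + 1) * ν (Set.Ioi x))) := by
        rw [ENNReal.tsum_mul_left, ENNReal.tsum_mul_left]
        gcongr
        exact le_self_add
    _ = ε * ν (Set.Ioi x) := by
        rw [← mul_assoc (C + 1), ← mul_assoc, ENNReal.div_mul_cancel hDne hD]

/-- The maximal dater is large only if the typical event occurs. -/
theorem negligible_exceed_diff_typical (hf : MonotoneSeparable f) (hinput : NetworkInput P f T ζ)
    (hIA : IA P T ζ) (hAA : AA P f T ζ Y) (hSE : SE P F Y d) (hH : HypH P Y)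
    (hFν : IntegratedPair F ν) (hν : ∀ x, 0 ≤ x → tail ν x = integratedTail F x)
    {a b : ℝ} (ha : a = ∫ ω, interarrival T 0 ω ∂P) (hb : b = gammaZero P f ζ)
    (hstable : b < a) (hN : TruncationLevel F N)
    (hKmeas : ∀ j n x, MeasurableSet (K j n x))
    (hKindep : ∀ j n x, ∀ B : Set ℝ, MeasurableSet B →
      P (K j n x ∩ Y j (-(n : ℤ)) ⁻¹' B) = P (K j n x) * P (Y j (-(n : ℤ)) ⁻¹' B))
    (hKunif : ∀ j, ∀ ε : ℝ, 0 < ε → ∀ᶠ x in atTop, ∀ n : ℕ, N x ≤ n → 1 - ε < P.real (K j n x))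
    (hη : ∀ j, Tendsto (η j) atTop (𝓝 0)) :
    Negligible ν fun x : ℝ => P ({ω | (x : EReal) < maximalDater f T ζ ω} \
      ⋃ j, ⋃ n : ℕ, ⋃ _ : N x ≤ n, typicalEvent Y K η a b j n x) := by
  set S : Fin r → ℝ → ℝ≥0∞ := fun j y => P {ω | y < Y j 1 ω}
  have hSa : ∀ j, Antitone (S j) := fun j u v huv => measure_mono fun ω (hω : v < _) =>
    lt_of_le_of_lt huv hω
  intro ε hε
  wlog hεt : ε ≠ ∞ generalizing ε
  · exact (this 1 one_ne_zero ENNReal.one_ne_top).mono fun x hx => hx.trans (by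
      rw [not_ne_iff.1 hεt]; gcongr; simp)
  have hc : 0 < a - b := sub_pos.2 hstable
  have hεr : 0 < ε.toReal := ENNReal.toReal_pos hε hεt
  obtain ⟨δ, hδ, hδc, hwin⟩ := hFν.exists_slope_forall_tsum_sub_le hSa (fun j x => prob_le_one)
    hSE.tail_equiv hc (show 0 < ε.toReal / 4 / (r + 1) by positivity)
  -- a batch length for which the dominating queue has a drift close to `b - a`
  obtain ⟨L, hL, hLb⟩ : ∃ L : ℕ, 0 < L ∧
      ∫ ω, dater f (-(L : ℤ)) (-1) (fun _ => 0) (fun i => ζ i ω) ∂P < L * (b + δ) := by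
    have h1 := (tendsto_gammaZero hf hinput hIA).2.eventually_lt_const
      (show gammaZero P f ζ < b + δ by rw [← hb]; linarith)
    obtain ⟨L, h2, h3⟩ := (h1.and (eventually_gt_atTop 0)).exists
    refine ⟨L, h3, ?_⟩
    rw [div_lt_iff₀ (by exact_mod_cast h3)] at h2
    linarith
  have hLr : (0 : ℝ) < L := by exact_mod_cast hL
  set c₁ := a - b - δ
  have hc₁ : 0 < c₁ := by simp only [c₁]; linarith
  -- The slope $c_1$ per point becomes the slope $m$ per batch.
  set m := L * c₁
  have hm : 0 < m := by positivity
  have hwalk := descendingWalk_batchIncrement hf hinput hIA hL hm (by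
    simp only [m, c₁]; rw [← ha]; nlinarith)
  obtain ⟨⟨C, hC, hCle⟩, g, hg, hgle⟩ := negligible_block hAA hSE hH L
  have hbatch := ae_batchIncrement_le hf hinput hAA hL
  have hsum : ∀ᶠ y in atTop, ∑' n : ℕ, P {ω | y + n * m < batchIncrement f T ζ L n ω} ≤
      C * ENNReal.ofReal (1 / m + 1) * ν (Set.Ioi y) := by
    filter_upwards [hFν.eventually_tsum_le hm one_pos 0] with y hy
    simp only [sub_zero] at hy
    calc _ ≤ ∑' n : ℕ, C * F (Set.Ioi (y + n * m)) := by
          refine ENNReal.tsum_le_tsum fun n => (measure_mono_ae ?_).trans (hCle (-((n + 1) * L : ℤ) + 1) _)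
          filter_upwards [hbatch] with ω hω h1 using lt_of_lt_of_le h1 (hω n)
      _ ≤ _ := by rw [ENNReal.tsum_mul_left, mul_assoc]; gcongr
  obtain ⟨B, hB, hjump⟩ := hwalk.exists_measure_exceed_without_jump_le hFν.subexp_integrated
    (by finiteness) hsum (ε := ε / 4) (by simp [hε])
  -- The exceptional events that are $o(\overline F^s)$: a big batch without a big component, a big
  -- component at an index below $N_x$, and a failure of `K`.
  have hsmall : Negligible ν fun x => ∑' k : ℕ, g (x - B + k * m) + ∑ j,
      (∑ l ∈ Finset.range (N x), S j (x - (B + m) + l * c₁) + ∑' n : {n : ℕ // N x ≤ n},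
      P ((K j n x)ᶜ ∩ {ω | x - (B + m) + (n : ℕ) * c₁ < Y j (-((n : ℕ) : ℤ)) ω})) := by
    refine (hFν.negligible_tsum hg hm B).add (Negligible.sum fun j _ => ?_)
    refine Negligible.add ?_ (negligible_tsum_compl hFν hAA hSE hKmeas hKindep hKunif j hc₁ _)
    obtain ⟨D, hD, hDle⟩ := exists_forall_le_mul_tail hSE.subexp
      (T := S j) (fun y => prob_le_one) (hSE.tail_equiv j)
    refine ((hFν.negligible_sum_lt hν hN hc₁ (B + m)).const_mul hD).mono
      (Eventually.of_forall fun x => ?_)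
    rw [Finset.mul_sum]
    exact Finset.sum_le_sum fun n _ => hDle _
  have hηev : ∀ᶠ x in atTop, ∀ j, ∀ n, N x ≤ n → |η j n| < δ := by
    refine eventually_all.2 fun j => ?_
    obtain ⟨n₀, hn₀⟩ := Metric.tendsto_atTop.1 (hη j) δ hδ
    filter_upwards [hN.tendsto.eventually_ge_atTop n₀] with x hx n hn
    simpa [Real.dist_eq] using hn₀ n (hx.trans hn)
  filter_upwards [hjump, hsmall (ε / 2) (by simp [hε]), hwin (B + m) (by positivity), hηev]
    with x h1 h2 h3 h4
  set J : Set Ω := {ω | (∃ k, x < walk (batchIncrement f T ζ L) k ω) ∧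
    ∀ n : ℕ, batchIncrement f T ζ L n ω ≤ x - B + n * m}
  set bad : ℕ → Set Ω := fun k => {ω |
    (∀ (i : Fin L) j, Y j (-((k + 1) * L : ℤ) + 1 + (i : ℕ)) ω ≤ x - B + k * m) ∧
      x - B + k * m < ∑ i : Fin L, ∑ j, Y j (-((k + 1) * L : ℤ) + 1 + (i : ℕ)) ω}
  set big : Fin r → ℕ → Set Ω := fun j l => {ω | x - (B + m) + l * c₁ < Y j (-(l : ℤ)) ω}
  -- The gap between the line reached by the domination argument and a line lying above the
  -- threshold of the typical event for $l\ge N_x$.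
  set win : Fin r → ℕ → Set Ω := fun j l =>
    {ω | x - (B + m) + l * c₁ < Y j (-(l : ℤ)) ω} \ {ω | x + l * (a - b + δ) < Y j (-(l : ℤ)) ω}
  have hcover : ∀ᵐ ω ∂P, ω ∈ {ω | (x : EReal) < maximalDater f T ζ ω} \
      (⋃ j, ⋃ n : ℕ, ⋃ _ : N x ≤ n, typicalEvent Y K η a b j n x) →
      ω ∈ J ∪ ((⋃ k, bad k) ∪ ⋃ j, (((⋃ l ∈ Finset.range (N x), big j l) ∪
        ⋃ n : {n : ℕ // N x ≤ n}, (K j n x)ᶜ ∩ big j n) ∪ ⋃ l, win j l)) := by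
    filter_upwards [hbatch] with ω hω ⟨hZ, hA⟩
    have hw := exists_lt_walk_of_lt_maximalDater hf hinput hL x ω hZ
    by_cases hnj : ∀ n : ℕ, batchIncrement f T ζ L n ω ≤ x - B + n * m
    · exact Or.inl ⟨hw, hnj⟩
    push Not at hnj
    obtain ⟨k, hk⟩ := hnj
    refine Or.inr ?_
    by_cases hbd : ∀ (i : Fin L) j, Y j (-((k + 1) * L : ℤ) + 1 + (i : ℕ)) ω ≤ x - B + k * m
    · exact Or.inl (Set.mem_iUnion.2 ⟨k, hbd, hk.trans_le (hω k)⟩)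
    push Not at hbd
    obtain ⟨i, j, hij⟩ := hbd
    refine Or.inr (Set.mem_iUnion.2 ⟨j, ?_⟩)
    have hi := i.2
    -- Position $i$ of batch $k$ is the customer of index $-l$.
    obtain ⟨l, hl⟩ : ∃ l : ℕ, l + 1 + (i : ℕ) = (k + 1) * L := by
      refine ⟨(k + 1) * L - 1 - i, ?_⟩
      have : L ≤ (k + 1) * L := Nat.le_mul_of_pos_left _ (Nat.succ_pos k)
      omega
    have hlz : (-((k + 1) * L : ℤ) + 1 + (i : ℕ)) = -(l : ℤ) := by
      have : ((l : ℤ) + 1 + (i : ℕ)) = (k + 1) * L := by exact_mod_cast hl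
      linarith
    rw [hlz] at hij
    have hbig : ω ∈ big j l := by
      refine lt_of_le_of_lt ?_ hij
      -- Hence $lc_1\le km+m$: passing from batch to point numbering costs the extra $m$ in `big`.
      have h5 : (l : ℝ) ≤ (k + 1) * L := by
        have : l ≤ (k + 1) * L := by omega
        exact_mod_cast this
      have h6 : (l : ℝ) * c₁ ≤ (k + 1) * L * c₁ := by gcongr
      simp only [m]
      linarith
    rcases lt_or_ge l (N x) with hlN | hlN
    · exact Or.inl (Or.inl (Set.mem_iUnion₂.2 ⟨l, Finset.mem_range.2 hlN, hbig⟩))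
    by_cases hK : ω ∈ K j l x
    · refine Or.inr (Set.mem_iUnion.2 ⟨l, hbig, fun h5 => hA ?_⟩)
      refine Set.mem_iUnion.2 ⟨j, Set.mem_iUnion₂.2 ⟨l, hlN, hK, ?_⟩⟩
      have h6 : x + l * (a - b + δ) < Y j (-(l : ℤ)) ω := h5
      refine lt_of_le_of_lt ?_ h6
      have h7 := (abs_lt.1 (h4 j l hlN)).2
      gcongr
    · exact Or.inl (Or.inr (Set.mem_iUnion.2 ⟨⟨l, hlN⟩, hK, hbig⟩))
  have hbigS : ∀ j l, P (big j l) = S j (x - (B + m) + l * c₁) := fun j l => hAA.measure_gt j _ _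
  have hwinS : ∀ j l, P (win j l) = S j (x - (B + m) + l * c₁) - S j (x + l * (a - b + δ)) := by
    intro j l
    have hle : x - (B + m) + l * c₁ ≤ x + l * (a - b + δ) := by
      have : (l : ℝ) * c₁ ≤ l * (a - b + δ) := by
        gcongr; simp only [c₁]; linarith
      linarith
    have hsub : {ω | x + l * (a - b + δ) < Y j (-(l : ℤ)) ω} ⊆ big j l :=
      fun ω h5 => lt_of_le_of_lt hle h5
    rw [measure_sdiff hsub
      (measurableSet_lt measurable_const (hAA.measurable _ _)).nullMeasurableSet
      (measure_ne_top _ _), hbigS, hAA.measure_gt]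
  calc _ ≤ P (J ∪ ((⋃ k, bad k) ∪ ⋃ j, (((⋃ l ∈ Finset.range (N x), big j l) ∪
        ⋃ n : {n : ℕ // N x ≤ n}, (K j n x)ᶜ ∩ big j n) ∪ ⋃ l, win j l))) := measure_mono_ae hcover
    _ ≤ P J + (∑' k, P (bad k) + ∑ j, ((∑ l ∈ Finset.range (N x), P (big j l) +
        ∑' n : {n : ℕ // N x ≤ n}, P ((K j n x)ᶜ ∩ big j n)) + ∑' l, P (win j l))) := by
        refine (measure_union_le _ _).trans (add_le_add_right ((measure_union_le _ _).trans
          (add_le_add (measure_iUnion_le _) ((measure_iUnion_fintype_le _ _).trans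
          (Finset.sum_le_sum fun j _ => (measure_union_le _ _).trans (add_le_add
          ((measure_union_le _ _).trans (add_le_add (measure_biUnion_finset_le _ _)
          (measure_iUnion_le _))) (measure_iUnion_le _)))))) _)
    -- No big jump costs $\varepsilon/4$, the negligible events $\varepsilon/2$, and the windows of
    -- all components together $\varepsilon/4$.
    _ ≤ ε / 4 * ν (Set.Ioi x) + (ε / 2 * ν (Set.Ioi x) +
        ∑ _j : Fin r, ENNReal.ofReal (ε.toReal / 4 / (r + 1)) * ν (Set.Ioi x)) := by
        refine add_le_add h1 ?_
        rw [Finset.sum_add_distrib, ← add_assoc]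
        refine add_le_add (le_trans ?_ h2) (Finset.sum_le_sum fun j _ => ?_)
        · simp only [hbigS]
          exact add_le_add (ENNReal.tsum_le_tsum fun k => hgle (-((k + 1) * L : ℤ) + 1) _) le_rfl
        · simp only [hwinS]
          exact h3 j
    _ ≤ ε / 4 * ν (Set.Ioi x) + (ε / 2 * ν (Set.Ioi x) + ε / 4 * ν (Set.Ioi x)) := by
        gcongr
        rw [Finset.sum_const, Finset.card_univ, Fintype.card_fin, nsmul_eq_mul, ← mul_assoc]
        gcongr
        rw [← ENNReal.ofReal_natCast, ← ENNReal.ofReal_mul (by positivity)]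
        have h5 : ε / 4 = ENNReal.ofReal (ε.toReal / 4) := by
          rw [ENNReal.ofReal_div_of_pos (by norm_num), ENNReal.ofReal_toReal hεt]
          norm_num
        rw [h5]
        refine ENNReal.ofReal_le_ofReal ?_
        rw [mul_div_assoc', div_le_iff₀ (by positivity)]
        nlinarith
    _ = (ε / 4 + ε / 2 + ε / 4) * ν (Set.Ioi x) := by ring
    _ = ε * ν (Set.Ioi x) := by
        congr 1
        have h5 : ε / 4 + ε / 4 = ε / 2 := by
          rw [← ENNReal.toReal_eq_toReal_iff' (by finiteness) (by finiteness),
            ENNReal.toReal_add (by finiteness) (by finiteness)]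
          simp only [ENNReal.toReal_div, ENNReal.toReal_ofNat]
          ring
        rw [add_right_comm, h5, ENNReal.add_halves]

end Typical

/-! ### Overlaps of exceedances. -/

/-- A Bonferroni inequality for countable families. -/
theorem tsum_measure_le_measure_iUnion_add {Ω ι : Type*} [MeasurableSpace Ω] [Countable ι]
    (μ : Measure Ω) {E : ι → Set Ω} (hE : ∀ i, MeasurableSet (E i)) :
    ∑' i, μ (E i) ≤ μ (⋃ i, E i) + ∑' i, ∑' k : {k // k ≠ i}, μ (E i ∩ E k) := by
  -- The part of $E_i$ met by no other event: these parts are disjoint, and the rest of $E_i$ is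
  -- covered by pairwise intersections.
  set D : ι → Set Ω := fun i => E i \ ⋃ k : {k // k ≠ i}, E k
  have hD : ∀ i, MeasurableSet (D i) := fun i => (hE i).diff (.iUnion fun k => hE k)
  have hdisj : Pairwise (Function.onFun Disjoint D) := fun i k hik =>
    Set.disjoint_left.2 fun ω h1 h2 => h1.2 (Set.mem_iUnion.2 ⟨⟨k, hik.symm⟩, h2.1⟩)
  calc ∑' i, μ (E i) ≤ ∑' i, (μ (D i) + ∑' k : {k // k ≠ i}, μ (E i ∩ E k)) := by
        refine ENNReal.tsum_le_tsum fun i => ?_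
        have h1 : E i ⊆ D i ∪ ⋃ k : {k // k ≠ i}, E i ∩ E k := fun ω hω => by
          by_cases h : ω ∈ ⋃ k : {k // k ≠ i}, E k
          · obtain ⟨k, hk⟩ := Set.mem_iUnion.1 h
            exact Or.inr (Set.mem_iUnion.2 ⟨k, hω, hk⟩)
          · exact Or.inl ⟨hω, h⟩
        exact (measure_mono h1).trans ((measure_union_le _ _).trans
          (add_le_add_right (measure_iUnion_le _) _))
    _ ≤ _ := by
        rw [ENNReal.tsum_add, ← measure_iUnion hdisj hD]
        gcongr
        exact Set.sdiff_subset

section Pairs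

variable {Ω M : Type*} [MeasurableSpace Ω] [MeasurableSpace M] {P : Measure Ω}
  [IsProbabilityMeasure P] {f : (l : ℕ) → (Fin l → ℝ) → (Fin l → M) → ℝ}
  {T : ℤ → Ω → ℝ} {ζ : ℤ → Ω → M} {r : ℕ} {Y : Fin r → ℤ → Ω → ℝ}
  {F ν : Measure ℝ} {d : Fin r → ℝ}

/-- `Y_{-n}^{(j)}` exceeds the line of slope `c` starting from `x`, where `p = (j, n)`. -/
def exceedLine (Y : Fin r → ℤ → Ω → ℝ) (c x : ℝ) (p : Fin r × ℕ) : Set Ω :=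
  {ω | x + p.2 * c < Y p.1 (-(p.2 : ℤ)) ω}

/-- The sum of the probabilities of pairs of distinct exceedances. -/
noncomputable def pairSum (P : Measure Ω) (Y : Fin r → ℤ → Ω → ℝ) (c x : ℝ) : ℝ≥0∞ :=
  ∑' p : Fin r × ℕ, ∑' q : {q // q ≠ p}, P (exceedLine Y c x p ∩ exceedLine Y c x q)

omit [IsProbabilityMeasure P] in
-- Bonferroni for `P` restricted to `S`. The error does not depend on `S`, so $S$ may be $\{\tilde
-- Z>x\}$ for any $\tilde Z$.
theorem tsum_measure_inter_le_add_pairSum {c x : ℝ} {E : Fin r × ℕ → Set Ω}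
    (hE : ∀ p, MeasurableSet (E p)) (hle : ∀ p, E p ⊆ exceedLine Y c x p) (S : Set Ω) :
    ∑' p, P (S ∩ E p) ≤ P (S ∩ ⋃ p, E p) + pairSum P Y c x := by
  have h1 := tsum_measure_le_measure_iUnion_add (P.restrict S) hE
  rw [Measure.restrict_apply (.iUnion hE), Set.inter_comm] at h1
  simp only [Measure.restrict_apply (hE _), Set.inter_comm _ S] at h1
  refine h1.trans (add_le_add_right (ENNReal.tsum_le_tsum fun p => ENNReal.tsum_le_tsum fun q => ?_) _)
  exact (Measure.restrict_apply_le _ _).trans (measure_mono (Set.inter_subset_inter (hle p) (hle q)))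

omit [IsProbabilityMeasure P] in
theorem measurableSet_exceedLine (hAA : AA P f T ζ Y) (c x : ℝ) (p : Fin r × ℕ) :
    MeasurableSet (exceedLine Y c x p) :=
  measurableSet_lt measurable_const (hAA.measurable _ _)

/-- The excess of the sum of the component tails over the tail of the maximum is $o(\overline F)$ by
(H), and it counts every overlap of two components at least once. -/
theorem negligible_simultaneous (hAA : AA P f T ζ Y) (hSE : SE P F Y d) (hH : HypH P Y) :
    ∃ g : ℝ → ℝ≥0∞, Negligible F g ∧ ∀ (i : ℤ) (j k : Fin r), j ≠ k → ∀ y,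
      P ({ω | y < Y j i ω} ∩ {ω | y < Y k i ω}) ≤ g y := by
  have := hSE.subexp.prob
  set g : ℝ → ℝ≥0∞ := fun y => ∑ j, P {ω | y < Y j 1 ω} - P {ω | ∃ j, y < Y j 1 ω}
  have hmj : ∀ (j : Fin r) (i : ℤ) y, MeasurableSet {ω | y < Y j i ω} := fun j i y =>
    measurableSet_lt measurable_const (hAA.measurable _ _)
  have hsub : ∀ y, P {ω | ∃ j, y < Y j 1 ω} ≤ ∑ j, P {ω | y < Y j 1 ω} := fun y => by
    rw [Set.ofPred_exists]
    exact measure_iUnion_fintype_le _ _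
  refine ⟨g, ?_, fun i j k hjk y => ?_⟩
  · refine Negligible.of_tendsto hSE.subexp.tail_pos (fun y => ?_) ?_
    · exact ENNReal.sub_ne_top (ENNReal.sum_ne_top.2 fun j _ => measure_ne_top _ _)
    · have h1 : Tendsto (fun y => (∑ j, P.real {ω | y < Y j 1 ω}) / tail F y) atTop
          (𝓝 (∑ j, d j)) := by
        simp only [Finset.sum_div]
        exact tendsto_finsetSum _ fun j _ => hSE.tail_equiv j
      have h2 := h1.sub (tendsto_max_tail hSE hH)
      rw [sub_self] at h2
      refine h2.congr fun y => ?_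
      rw [← sub_div, ENNReal.toReal_sub_of_le (hsub y)
        (ENNReal.sum_ne_top.2 fun j _ => measure_ne_top _ _),
        ENNReal.toReal_sum fun j _ => measure_ne_top _ _]
      rfl
  · have hshift : P ({ω | y < Y j i ω} ∩ {ω | y < Y k i ω}) =
        P ({ω | y < Y j 1 ω} ∩ {ω | y < Y k 1 ω}) := by
      have hS : MeasurableSet {v : Fin r → ℝ | y < v j ∧ y < v k} :=
        (measurableSet_lt measurable_const (measurable_pi_apply j)).inter
          (measurableSet_lt measurable_const (measurable_pi_apply k))
      exact ((hAA.ident i).measure_mem_eq hS).trans ((hAA.ident 1).measure_mem_eq hS).symm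
    rw [hshift]
    refine ENNReal.le_sub_of_add_le_left (measure_ne_top _ _) ?_
    have h1 : {ω | ∃ j, y < Y j 1 ω} ⊆ (⋃ l ∈ Finset.univ.erase j, {ω | y < Y l 1 ω}) ∪
        ({ω | y < Y j 1 ω} \ {ω | y < Y k 1 ω}) := by
      rintro ω ⟨l, hl⟩
      by_cases hlj : l = j
      · subst hlj
        by_cases hk : y < Y k 1 ω
        · exact Or.inl (Set.mem_biUnion (x := k) (by simp [hjk.symm]) hk)
        · exact Or.inr ⟨hl, hk⟩
      · exact Or.inl (Set.mem_biUnion (x := l) (by simp [hlj]) hl)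
    calc _ ≤ (∑ l ∈ Finset.univ.erase j, P {ω | y < Y l 1 ω} +
          P ({ω | y < Y j 1 ω} \ {ω | y < Y k 1 ω})) +
          P ({ω | y < Y j 1 ω} ∩ {ω | y < Y k 1 ω}) := by
          gcongr
          exact (measure_mono h1).trans ((measure_union_le _ _).trans
            (add_le_add_left (measure_biUnion_finset_le _ _) _))
      _ = _ := by
          rw [add_assoc, add_comm (P (_ \ _)), measure_inter_add_sdiff _ (hmj k 1 y),
            Finset.sum_erase_add _ _ (Finset.mem_univ j)]

theorem exists_tsum_exceedLine_le (hAA : AA P f T ζ Y) (hSE : SE P F Y d)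
    (hFν : IntegratedPair F ν) {c : ℝ} (hc : 0 < c) :
    ∃ C : ℝ≥0∞, C ≠ ∞ ∧ ∀ᶠ x in atTop,
      ∑' p, P (exceedLine Y c x p) ≤ C * ν (Set.Ioi x) := by
  choose C hC hle using fun j => exists_forall_le_mul_tail hSE.subexp
    (T := fun y => P {ω | y < Y j 1 ω}) (fun y => prob_le_one) (hSE.tail_equiv j)
  refine ⟨∑ j, C j * ENNReal.ofReal (1 / c + 1), ENNReal.sum_ne_top.2 fun j _ =>
    ENNReal.mul_ne_top (hC j) ENNReal.ofReal_ne_top, ?_⟩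
  filter_upwards [hFν.eventually_tsum_le hc one_pos 0] with x hx
  simp only [sub_zero] at hx
  rw [ENNReal.tsum_prod', tsum_fintype, Finset.sum_mul]
  refine Finset.sum_le_sum fun j _ => ?_
  calc _ ≤ ∑' n : ℕ, C j * F (Set.Ioi (x + n * c)) :=
        ENNReal.tsum_le_tsum fun n => (hAA.measure_gt j _ _).trans_le (hle j _)
    _ ≤ _ := by rw [ENNReal.tsum_mul_left, mul_assoc]; gcongr

/-- Exceedances at different times are independent, and the sum of their products is $O(\overline
F^s(x)^2)$. At equal times the components differ, and `negligible_simultaneous` is summed along the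
line. -/
theorem negligible_pairSum (hAA : AA P f T ζ Y) (hSE : SE P F Y d) (hH : HypH P Y)
    (hFν : IntegratedPair F ν) {c : ℝ} (hc : 0 < c) : Negligible ν (pairSum P Y c) := by
  have := hFν.subexp_integrated.prob
  obtain ⟨g, hg, hgle⟩ := negligible_simultaneous hAA hSE hH
  obtain ⟨C, hC, hCle⟩ := exists_tsum_exceedLine_le hAA hSE hFν hc
  have hsq : Negligible ν fun x => C * C * (ν (Set.Ioi x) * ν (Set.Ioi x)) := by
    refine Negligible.const_mul (fun ε hε => ?_) (by finiteness)
    filter_upwards [(tendsto_measure_Ioi_atTop ν).eventually_le_const (pos_iff_ne_zero.2 hε)]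
      with x hx
    gcongr
  have hg' := (hFν.negligible_tsum hg hc 0).const_mul (C := (r : ℝ≥0∞) * r) (by finiteness)
  simp only [sub_zero] at hg'
  refine (hsq.add hg').mono ?_
  filter_upwards [hCle] with x hx
  have hpair : ∀ p q : Fin r × ℕ, q ≠ p → P (exceedLine Y c x p ∩ exceedLine Y c x q) ≤
      P (exceedLine Y c x p) * P (exceedLine Y c x q) +
        if q.2 = p.2 then g (x + p.2 * c) else 0 := by
    rintro ⟨j, n⟩ ⟨k, m⟩ hne
    by_cases hnm : m = n
    · subst hnm
      rw [if_pos rfl]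
      exact (hgle _ j k (by rintro rfl; exact hne rfl) _).trans le_add_self
    · rw [if_neg hnm, add_zero]
      have hind := hAA.indep.indepFun (show -(n : ℤ) ≠ -(m : ℤ) by omega)
      exact (hind.measure_inter_preimage_eq_mul {v | x + n * c < v j} {v | x + m * c < v k}
        (measurableSet_lt measurable_const (measurable_pi_apply j))
        (measurableSet_lt measurable_const (measurable_pi_apply k))).le
  calc pairSum P Y c x ≤ ∑' p : Fin r × ℕ, ∑' q : Fin r × ℕ,
        (P (exceedLine Y c x p) * P (exceedLine Y c x q) +
          if q.2 = p.2 then g (x + p.2 * c) else 0) := by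
        refine ENNReal.tsum_le_tsum fun p => ?_
        exact (ENNReal.tsum_le_tsum fun q : {q // q ≠ p} => hpair p q q.2).trans
          (ENNReal.tsum_comp_le_tsum_of_injective Subtype.val_injective
            fun q : Fin r × ℕ => P (exceedLine Y c x p) * P (exceedLine Y c x q) +
              if q.2 = p.2 then g (x + p.2 * c) else 0)
    _ = (∑' p, P (exceedLine Y c x p)) * (∑' p, P (exceedLine Y c x p)) +
        r * r * ∑' n : ℕ, g (x + n * c) := by
        simp only [ENNReal.tsum_add, ENNReal.tsum_mul_left, ENNReal.tsum_mul_right]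
        congr 1
        simp only [ENNReal.tsum_prod', tsum_fintype, tsum_ite_eq, Finset.sum_const,
          Finset.card_univ, Fintype.card_fin, nsmul_eq_mul, ENNReal.tsum_mul_left]
        rw [mul_assoc]
    _ ≤ _ := add_le_add_left ((mul_le_mul' hx hx).trans_eq (by ring)) _

end Pairs

variable {Ω M : Type*} [MeasurableSpace Ω] [MeasurableSpace M] {P : Measure Ω}
  [IsProbabilityMeasure P] {f : (l : ℕ) → (Fin l → ℝ) → (Fin l → M) → ℝ}
  {T : ℤ → Ω → ℝ} {ζ : ℤ → Ω → M} {r : ℕ} {Y : Fin r → ℤ → Ω → ℝ}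
  {F ν : Measure ℝ} {d : Fin r → ℝ}

/-! ### The lower bound for the tail of the maximal dater. -/

omit [MeasurableSpace Ω] in
theorem sum_interarrival (T : ℤ → Ω → ℝ) (n : ℕ) (ω : Ω) :
    ∑ i ∈ Finset.range n, interarrival T (-(n : ℤ) + i) ω = T 0 ω - T (-(n : ℤ)) ω := by
  have h := Finset.sum_range_sub (fun i : ℕ => T (-(n : ℤ) + i) ω) n
  simp only [interarrival]
  simpa [add_assoc] using h

/-- The points span at most twice the expected length with probability at least one half. -/
theorem half_le_measure_span (hinput : NetworkInput P f T ζ) (hIA : IA P T ζ) {a : ℝ}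
    (ha : a = ∫ ω, interarrival T 0 ω ∂P) (ha0 : 0 < a) (n : ℕ) :
    1 / 2 ≤ P {ω | T 0 ω - T (-(n : ℤ)) ω ≤ n * (2 * a)} := by
  rcases Nat.eq_zero_or_pos n with rfl | hn
  · simp
  have hn' : (0 : ℝ) < n := by exact_mod_cast hn
  have hint : Integrable (fun ω => T 0 ω - T (-(n : ℤ)) ω) P := by
    simp only [← sum_interarrival]
    exact integrable_finsetSum _ fun i _ => hinput.integrable_interarrival _
  have hval : ∫ ω, (T 0 ω - T (-(n : ℤ)) ω) ∂P = n * a := by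
    simp only [← sum_interarrival]
    rw [integral_finsetSum _ fun i _ => hinput.integrable_interarrival _]
    simp [fun i => (hIA.ident_interarrival i).integral_eq, ← ha]
  have h1 := mul_meas_ge_le_integral_of_nonneg (μ := P)
    (f := fun ω => T 0 ω - T (-(n : ℤ)) ω)
    (Eventually.of_forall fun ω => sub_nonneg.2 (hinput.monotone_points ω (by simp))) hint
    (n * (2 * a))
  rw [hval] at h1
  have hm : MeasurableSet {ω | T 0 ω - T (-(n : ℤ)) ω ≤ n * (2 * a)} :=
    measurableSet_le ((hinput.measurable_points _).sub (hinput.measurable_points _))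
      measurable_const
  have h2 := prob_add_prob_compl (μ := P) hm
  have h3 : P {ω | T 0 ω - T (-(n : ℤ)) ω ≤ n * (2 * a)}ᶜ ≤ 1 / 2 := by
    have h4 : P.real {ω | (n : ℝ) * (2 * a) ≤ T 0 ω - T (-(n : ℤ)) ω} ≤ 1 / 2 := by
      have h5 : (0 : ℝ) < n * a := by positivity
      have : P.real {ω | (n : ℝ) * (2 * a) ≤ T 0 ω - T (-(n : ℤ)) ω} * (n * a) ≤
          1 / 2 * (n * a) := by
        nlinarith
      exact le_of_mul_le_mul_right this h5
    have h5 : {ω | T 0 ω - T (-(n : ℤ)) ω ≤ n * (2 * a)}ᶜ ⊆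
        {ω | (n : ℝ) * (2 * a) ≤ T 0 ω - T (-(n : ℤ)) ω} := fun ω hω => by
      simp only [Set.mem_compl_iff, Set.mem_ofPred_eq, not_le] at hω ⊢
      exact hω.le
    calc _ ≤ P {ω | (n : ℝ) * (2 * a) ≤ T 0 ω - T (-(n : ℤ)) ω} := measure_mono h5
      _ = ENNReal.ofReal (P.real {ω | (n : ℝ) * (2 * a) ≤ T 0 ω - T (-(n : ℤ)) ω}) := by
          rw [ofReal_measureReal]
      _ ≤ ENNReal.ofReal (1 / 2) := ENNReal.ofReal_le_ofReal h4
      _ = 1 / 2 := by rw [ENNReal.ofReal_div_of_pos (by norm_num)]; simp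
  have h4 : (1 : ℝ≥0∞) / 2 + 1 / 2 ≤
      P {ω | T 0 ω - T (-(n : ℤ)) ω ≤ n * (2 * a)} + 1 / 2 := by
    rw [ENNReal.add_halves]
    exact h2.ge.trans (add_le_add_right h3 _)
  exact (ENNReal.add_le_add_iff_right (by simp)).1 h4

/-- The tail of the maximal dater is at least of the order of the integrated tail. -/
theorem exists_le_mul_measure_maximalDater (hf : MonotoneSeparable f)
    (hinput : NetworkInput P f T ζ) (hIA : IA P T ζ) (hAA : AA P f T ζ Y) (hSE : SE P F Y d)
    (hH : HypH P Y) (hFν : IntegratedPair F ν) {a : ℝ}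
    (ha : a = ∫ ω, interarrival T 0 ω ∂P) (ha0 : 0 < a) :
    ∃ C : ℝ≥0∞, C ≠ ∞ ∧ ∀ᶠ x : ℝ in atTop,
      ν (Set.Ioi x) ≤ C * P {ω | (x : EReal) < maximalDater f T ζ ω} := by
  have := hFν.subexp_integrated.prob
  have := hSE.subexp.prob
  obtain ⟨j, -, hj⟩ := Finset.exists_lt_of_sum_lt
    (show ∑ _j : Fin r, (0 : ℝ) < ∑ j, d j by simpa using hSE.sum_pos)
  have hc : 0 < 2 * a := by linarith
  -- On this event $Z_{[-n,0]}\ge Y^{(j)}_{-n}-(T_0-T_{-n})>x$, since the span is at most $2an$ and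
  -- the component exceeds $x+2an$.
  set E : ℝ → Fin r × ℕ → Set Ω := fun x p =>
    exceedLine Y (2 * a) x p ∩ {ω | T 0 ω - T (-(p.2 : ℤ)) ω ≤ p.2 * (2 * a)}
  have hEm : ∀ x p, MeasurableSet (E x p) := fun x p =>
    (measurableSet_exceedLine hAA _ _ _).inter
      (measurableSet_le ((hinput.measurable_points _).sub (hinput.measurable_points _))
        measurable_const)
  have hZ : ∀ x : ℝ, P (⋃ p, E x p) ≤ P {ω | (x : EReal) < maximalDater f T ζ ω} := fun x => by
    refine measure_mono_ae ?_
    have h1 : ∀ᵐ ω ∂P, ∀ n : ℕ, ∀ j, ∑ i ∈ Finset.Icc (-(n : ℤ)) 0, Y j i ω ≤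
        dater f (-(n : ℤ)) 0 (fun _ => 0) (fun k => ζ k ω) :=
      ae_all_iff.2 fun n => hAA.sum_le_dater _ (by omega)
    have h2 : ∀ᵐ ω ∂P, ∀ j i, 0 ≤ Y j i ω :=
      ae_all_iff.2 fun j => ae_all_iff.2 fun i => hAA.nonneg j i
    filter_upwards [h1, h2] with ω h1 h2 hω
    obtain ⟨⟨k, n⟩, h3, h4⟩ := Set.mem_iUnion.1 hω
    refine (lt_maximalDater_iff hf (hinput.monotone_points ω) x).2 ⟨n, ?_⟩
    have h5 := hf.dater_zero_sub_le (hinput.monotone_points ω) (fun i => ζ i ω)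
      (show -(n : ℤ) ≤ 0 by omega)
    have h6 := Finset.single_le_sum (f := fun i => Y k i ω) (fun i _ => h2 k i)
      (show -(n : ℤ) ∈ Finset.Icc (-(n : ℤ)) 0 by simp)
    have h7 := h1 n k
    have h3 : x + n * (2 * a) < Y k (-(n : ℤ)) ω := h3
    have h4 : T 0 ω - T (-(n : ℤ)) ω ≤ n * (2 * a) := h4
    linarith
  -- The span depends only on the interarrival times, which are independent of the $Y$, so the span
  -- condition costs at most a factor 2.
  have hhalf : ∀ x p, 1 / 2 * P (exceedLine Y (2 * a) x p) ≤ P (E x p) := fun x p => by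
    have h1 := hAA.indep_interarrival.measure_inter_preimage_eq_mul
      {t | ∑ i ∈ Finset.range p.2, t (-(p.2 : ℤ) + i) ≤ p.2 * (2 * a)}
      {y | x + p.2 * (2 * a) < y (-(p.2 : ℤ)) p.1}
      (measurableSet_le (by fun_prop) measurable_const)
      (measurableSet_lt measurable_const (by fun_prop))
    have h2 : (fun ω n => interarrival T n ω) ⁻¹'
        {t | ∑ i ∈ Finset.range p.2, t (-(p.2 : ℤ) + i) ≤ p.2 * (2 * a)} =
        {ω | T 0 ω - T (-(p.2 : ℤ)) ω ≤ p.2 * (2 * a)} := by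
      ext ω
      simp only [Set.mem_preimage, Set.mem_ofPred_eq, sum_interarrival]
    rw [h2, Set.inter_comm] at h1
    exact (mul_le_mul' (half_le_measure_span hinput hIA ha ha0 p.2) le_rfl).trans h1.ge
  have hd0 : 0 < d j / 2 := by simpa using hj
  have hlow : ∀ᶠ x in atTop, ENNReal.ofReal (d j / 2) * (ENNReal.ofReal (1 / (2 * a)) *
      ν (Set.Ioi x)) ≤ ∑' p, P (exceedLine Y (2 * a) x p) := by
    obtain ⟨x₀, hx₀⟩ := eventually_atTop.1
      ((hSE.tail_equiv j).eventually_const_lt (show d j / 2 < d j by linarith))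
    filter_upwards [eventually_ge_atTop x₀, hFν.eventually_le_tsum hc] with x hx h1
    calc _ ≤ ENNReal.ofReal (d j / 2) * ∑' n : ℕ, F (Set.Ioi (x + n * (2 * a))) := by gcongr
      _ ≤ ∑' n : ℕ, P (exceedLine Y (2 * a) x (j, n)) := by
          rw [← ENNReal.tsum_mul_left]
          refine ENNReal.tsum_le_tsum fun n => ?_
          have h2 := hx₀ (x + n * (2 * a)) (by
            have : (0 : ℝ) ≤ n * (2 * a) := by positivity
            linarith)
          rw [lt_div_iff₀ (hSE.subexp.tail_pos _)] at h2
          refine le_of_le_of_eq ?_ (hAA.measure_gt j (-(n : ℤ)) (x + n * (2 * a))).symm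
          rw [← ofReal_tail, ← ENNReal.ofReal_mul hd0.le, ← ofReal_measureReal]
          exact ENNReal.ofReal_le_ofReal h2.le
      _ ≤ _ := ENNReal.tsum_comp_le_tsum_of_injective
          (Prod.mk_right_injective j) fun p => P (exceedLine Y (2 * a) x p)
  set κ := 1 / 2 * (ENNReal.ofReal (d j / 2) * ENNReal.ofReal (1 / (2 * a)))
  have hκ0 : κ ≠ 0 := by
    have h1 : 0 < 1 / (2 * a) := by positivity
    have h2 : ENNReal.ofReal (d j / 2) ≠ 0 := by simpa using hd0
    have h3 : ENNReal.ofReal (1 / (2 * a)) ≠ 0 := (ENNReal.ofReal_pos.2 h1).ne'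
    exact mul_ne_zero (by simp) (mul_ne_zero h2 h3)
  have hκ : κ ≠ ∞ := by finiteness
  have hκ2 : κ / 2 ≠ 0 := by simp [hκ0]
  refine ⟨(κ / 2)⁻¹, ENNReal.inv_ne_top.2 hκ2, ?_⟩
  -- The union of the events `E` has probability at least $\kappa\overline\nu(x)$ minus the pair
  -- sum, which takes away at most half of it.
  filter_upwards [hlow, negligible_pairSum hAA hSE hH hFν hc (κ / 2) hκ2] with x h1 h2
  have h3 := tsum_measure_inter_le_add_pairSum (P := P) (hEm x)
    (fun p => Set.inter_subset_left) Set.univ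
  simp only [Set.univ_inter] at h3
  have h4 : κ * ν (Set.Ioi x) ≤
      P {ω | (x : EReal) < maximalDater f T ζ ω} + κ / 2 * ν (Set.Ioi x) :=
    calc κ * ν (Set.Ioi x) = 1 / 2 * (ENNReal.ofReal (d j / 2) * (ENNReal.ofReal (1 / (2 * a)) *
          ν (Set.Ioi x))) := by simp only [κ]; ring
      _ ≤ 1 / 2 * ∑' p, P (exceedLine Y (2 * a) x p) := by gcongr
      _ ≤ ∑' p, P (E x p) := by
          rw [← ENNReal.tsum_mul_left]; exact ENNReal.tsum_le_tsum fun p => hhalf x p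
      _ ≤ _ := h3.trans (add_le_add (hZ x) h2)
  have h5 : κ / 2 * ν (Set.Ioi x) ≤ P {ω | (x : EReal) < maximalDater f T ζ ω} := by
    refine (ENNReal.add_le_add_iff_right (a := κ / 2 * ν (Set.Ioi x)) (by finiteness)).1 ?_
    rwa [← add_mul, ENNReal.add_halves]
  calc ν (Set.Ioi x) = (κ / 2)⁻¹ * (κ / 2 * ν (Set.Ioi x)) := by
        rw [← mul_assoc, ENNReal.inv_mul_cancel hκ2 (by finiteness), one_mul]
    _ ≤ _ := by gcongr

/-! ### Sums over typical events. -/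

section Typical

variable {N : ℝ → ℕ} {K : Fin r → ℕ → ℝ → Set Ω} {η : Fin r → ℕ → ℝ} {a b : ℝ}

omit [MeasurableSpace Ω] in
theorem eventually_typicalEvent_subset (hη : ∀ j, Tendsto (η j) atTop (𝓝 0)) (hstable : b < a) :
    ∀ᶠ n : ℕ in atTop, ∀ j x,
      typicalEvent Y K η a b j n x ⊆ exceedLine Y ((a - b) / 2) x (j, n) := by
  have h1 : ∀ᶠ n in atTop, ∀ j, -((a - b) / 2) < η j n :=
    eventually_all.2 fun j => (hη j).eventually_const_lt (by linarith)
  filter_upwards [h1] with n hn j x ω hω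
  have h2 : x + n * (a - b + η j n) < Y j (-(n : ℤ)) ω := hω.2
  refine lt_of_le_of_lt ?_ h2
  have := hn j
  simp only
  gcongr
  linarith

/-- Here $x$ is fixed and possibly low, while sums of tails are controlled only at high levels;
dropping the first $n_0$ terms raises the level to $x+n_0c$. -/
theorem summable_typicalEvent (hAA : AA P f T ζ Y) (hSE : SE P F Y d) (hFν : IntegratedPair F ν)
    (hη : ∀ j, Tendsto (η j) atTop (𝓝 0)) (hstable : b < a) (j : Fin r) (x : ℝ) :
    Summable fun n => P.real (typicalEvent Y K η a b j n x) := by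
  have := hFν.subexp_integrated.prob
  set c := (a - b) / 2
  have hc : 0 < c := by simp only [c]; linarith
  obtain ⟨C, hC, hCle⟩ := exists_tsum_exceedLine_le hAA hSE hFν hc
  have ht : Tendsto (fun n : ℕ => x + n * c) atTop atTop :=
    tendsto_atTop_add_const_left _ _ (tendsto_natCast_atTop_atTop.atTop_mul_const hc)
  obtain ⟨n₀, hn₀, hsub⟩ := ((ht.eventually hCle).and
    (eventually_forall_ge_atTop.2 (eventually_typicalEvent_subset (Y := Y) (K := K) hη
      hstable))).exists
  refine (summable_nat_add_iff n₀).1 (ENNReal.summable_toReal (ne_top_of_le_ne_top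
    (show C * ν (Set.Ioi (x + n₀ * c)) ≠ ∞ by finiteness) (le_trans ?_ hn₀)))
  calc ∑' n : ℕ, P (typicalEvent Y K η a b j (n + n₀) x)
      ≤ ∑' n : ℕ, P (exceedLine Y c (x + n₀ * c) (j, n)) := by
        refine ENNReal.tsum_le_tsum fun n => (measure_mono (hsub (n + n₀) (by omega) j x)).trans ?_
        refine le_of_eq ((hAA.measure_gt j _ _).trans (Eq.trans ?_ (hAA.measure_gt j _ _).symm))
        have h1 : x + ((n + n₀ : ℕ) : ℝ) * ((a - b) / 2) = x + n₀ * c + n * c := by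
          simp only [c]; push_cast; ring
        exact congrArg (fun y => P {ω | y < Y j 1 ω}) h1
    _ ≤ _ := ENNReal.tsum_comp_le_tsum_of_injective
        (Prod.mk_right_injective j) fun p => P (exceedLine Y c (x + n₀ * c) p)

/-- For $n\ge N_x$ with $x$ large, typical events lie among the exceedances of the line of slope
$(a-b)/2$, so the pair sum of that line bounds the overlaps, uniformly in `S`. -/
theorem exists_negligible_tsum_typicalEvent_le (hAA : AA P f T ζ Y) (hSE : SE P F Y d)
    (hH : HypH P Y) (hFν : IntegratedPair F ν) (hN : TruncationLevel F N)
    (hKmeas : ∀ j n x, MeasurableSet (K j n x)) (hη : ∀ j, Tendsto (η j) atTop (𝓝 0))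
    (hstable : b < a) :
    ∃ h : ℝ → ℝ≥0∞, Negligible ν h ∧ ∀ᶠ x in atTop, ∀ S : Set Ω,
      ∑ j, ∑' n : {n : ℕ // N x ≤ n}, P (S ∩ typicalEvent Y K η a b j n x) ≤
        P (S ∩ ⋃ j, ⋃ n : ℕ, ⋃ _ : N x ≤ n, typicalEvent Y K η a b j n x) + h x := by
  have hc : 0 < (a - b) / 2 := by linarith
  refine ⟨_, negligible_pairSum hAA hSE hH hFν hc, ?_⟩
  filter_upwards [hN.tendsto.eventually (eventually_forall_ge_atTop.2
    (eventually_typicalEvent_subset (Y := Y) (K := K) hη hstable))] with x hx S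
  set E : Fin r × ℕ → Set Ω := fun p => ⋃ _ : N x ≤ p.2, typicalEvent Y K η a b p.1 p.2 x
  have h1 := tsum_measure_inter_le_add_pairSum (P := P) (c := (a - b) / 2) (x := x) (E := E)
    (fun p => .iUnion fun _ => (hKmeas _ _ _).inter
      (measurableSet_lt measurable_const (hAA.measurable _ _)))
    (fun p => Set.iUnion_subset fun h => hx p.2 h p.1 x) S
  have h2 : ⋃ p, E p = ⋃ j, ⋃ n : ℕ, ⋃ _ : N x ≤ n, typicalEvent Y K η a b j n x :=
    Set.iUnion_prod' _
  rw [h2] at h1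
  refine le_trans ?_ h1
  rw [ENNReal.tsum_prod', tsum_fintype]
  refine Finset.sum_le_sum fun j _ => ?_
  calc _ = ∑' n : {n : ℕ // N x ≤ n}, P (S ∩ E (j, n)) :=
        tsum_congr fun n => by simp only [E, n.2, Set.iUnion_true]
    _ ≤ _ := ENNReal.tsum_comp_le_tsum_of_injective Subtype.val_injective
        fun n => P (S ∩ E (j, n))

end Typical

theorem Negligible.isLittleO_toReal_sub [IsFiniteMeasure ν] {u v g : ℝ → ℝ≥0∞}
    (hg : Negligible ν g) (hu : ∀ x, u x ≠ ∞) (h1 : ∀ᶠ x in atTop, u x ≤ v x + g x)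
    (h2 : ∀ᶠ x in atTop, v x ≤ u x + g x) :
    (fun x => (u x).toReal - (v x).toReal) =o[atTop] tail ν := by
  refine IsBigO.trans_isLittleO (IsBigO.of_bound 1 ?_) hg.isLittleO
  filter_upwards [h1, h2, hg 1 one_ne_zero] with x h1 h2 h3
  have hgt : g x ≠ ∞ := ne_top_of_le_ne_top (by finiteness) h3
  have hvt : v x ≠ ∞ := ne_top_of_le_ne_top (ENNReal.add_ne_top.2 ⟨hu x, hgt⟩) h2
  have h4 := ENNReal.toReal_mono (ENNReal.add_ne_top.2 ⟨hvt, hgt⟩) h1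
  have h5 := ENNReal.toReal_mono (ENNReal.add_ne_top.2 ⟨hu x, hgt⟩) h2
  rw [ENNReal.toReal_add hvt hgt] at h4
  rw [ENNReal.toReal_add (hu x) hgt] at h5
  rw [one_mul, Real.norm_eq_abs, Real.norm_of_nonneg ENNReal.toReal_nonneg, abs_le]
  constructor <;> linarith

end MonSep

/-! ### Assembly of the theorem. -/

theorem theorem8 {Ω M : Type*} [MeasurableSpace Ω] [MeasurableSpace M]
    (P : Measure Ω) [IsProbabilityMeasure P]
    (f : (l : ℕ) → (Fin l → ℝ) → (Fin l → M) → ℝ) (hf : MonotoneSeparable f)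
    (T : ℤ → Ω → ℝ) (ζ : ℤ → Ω → M) (hinput : NetworkInput P f T ζ)
    (hIA : IA P T ζ)
    (r : ℕ) (Y : Fin r → ℤ → Ω → ℝ) (hAA : AA P f T ζ Y)
    (F : Measure ℝ) (d : Fin r → ℝ) (hSE : SE P F Y d) (hH : HypH P Y)
    (a b : ℝ) (ha : a = ∫ ω, interarrival T 0 ω ∂P) (hb : b = gammaZero P f ζ)
    (hstable : b < a)
    (N : ℝ → ℕ) (hN : TruncationLevel F N)
    (K : Fin r → ℕ → ℝ → Set Ω) (hKmeas : ∀ j n x, MeasurableSet (K j n x))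
    (hKindep : ∀ j n x, ∀ B : Set ℝ, MeasurableSet B →
      P (K j n x ∩ Y j (-(n : ℤ)) ⁻¹' B) = P (K j n x) * P (Y j (-(n : ℤ)) ⁻¹' B))
    (hKunif : ∀ j, ∀ ε : ℝ, 0 < ε → ∀ᶠ x in atTop, ∀ n : ℕ, N x ≤ n → 1 - ε < P.real (K j n x))
    (η : Fin r → ℕ → ℝ) (hη : ∀ j, Tendsto (η j) atTop (𝓝 0)) :
    let Z : Ω → EReal := maximalDater f T ζ
    let Aₙ : Fin r → ℕ → ℝ → Set Ω := typicalEvent Y K η a b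
    let Aⱼ : Fin r → ℝ → Set Ω := fun j x => ⋃ n : ℕ, ⋃ _ : N x ≤ n, Aₙ j n x
    let A : ℝ → Set Ω := fun x => ⋃ j, Aⱼ j x
    (∀ j x, Summable fun n : {n : ℕ // N x ≤ n} => P.real (Aₙ j n x)) ∧
    ((fun x : ℝ => P.real {ω | (x : EReal) < Z ω}) ~[atTop]
        (fun x : ℝ => P.real ({ω | (x : EReal) < Z ω} ∩ A x)) ∧
      (fun x : ℝ => P.real ({ω | (x : EReal) < Z ω} ∩ A x)) ~[atTop]
        (fun x : ℝ => ∑ j, P.real ({ω | (x : EReal) < Z ω} ∩ Aⱼ j x)) ∧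
      (fun x : ℝ => ∑ j, P.real ({ω | (x : EReal) < Z ω} ∩ Aⱼ j x)) ~[atTop]
        (fun x : ℝ => ∑ j, ∑' n : {n : ℕ // N x ≤ n},
          P.real ({ω | (x : EReal) < Z ω} ∩ Aₙ j n x))) ∧
    ∀ Z' : Ω → EReal, AEMeasurable Z' P → (∀ᵐ ω ∂P, Z' ω ≤ Z ω) →
      ((fun x : ℝ => P.real {ω | (x : EReal) < Z' ω}
          - P.real ({ω | (x : EReal) < Z' ω} ∩ A x)) =o[atTop] integratedTail F ∧
        (fun x : ℝ => P.real {ω | (x : EReal) < Z' ω}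
          - ∑ j, P.real ({ω | (x : EReal) < Z' ω} ∩ Aⱼ j x)) =o[atTop] integratedTail F ∧
        (fun x : ℝ => P.real {ω | (x : EReal) < Z' ω}
          - ∑ j, ∑' n : {n : ℕ // N x ≤ n},
            P.real ({ω | (x : EReal) < Z' ω} ∩ Aₙ j n x)) =o[atTop] integratedTail F) ∧
      ((fun x : ℝ => P.real {ω | (x : EReal) < Z' ω}) =Θ[atTop] integratedTail F →
        (fun x : ℝ => P.real {ω | (x : EReal) < Z' ω}) ~[atTop]
          (fun x : ℝ => P.real ({ω | (x : EReal) < Z' ω} ∩ A x)) ∧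
        (fun x : ℝ => P.real ({ω | (x : EReal) < Z' ω} ∩ A x)) ~[atTop]
          (fun x : ℝ => ∑ j, P.real ({ω | (x : EReal) < Z' ω} ∩ Aⱼ j x)) ∧
        (fun x : ℝ => ∑ j, P.real ({ω | (x : EReal) < Z' ω} ∩ Aⱼ j x)) ~[atTop]
          (fun x : ℝ => ∑ j, ∑' n : {n : ℕ // N x ≤ n},
            P.real ({ω | (x : EReal) < Z' ω} ∩ Aₙ j n x))) := by
  intro Z Aₙ Aⱼ A
  obtain ⟨ν, hνs, hν⟩ := hSE.subexp_integrated
  have := hνs.prob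
  have hFν := integratedPair_of_truncationLevel hSE.subexp hνs hν hN
  have hGν : tail ν =ᶠ[atTop] integratedTail F := (eventually_ge_atTop 0).mono hν
  -- Nonnegativity of $b$ gives $a>0$, needed to bound the spans in the lower bound.
  have hb0 : 0 ≤ b := hb ▸ (tendsto_gammaZero hf hinput hIA).1
  have hAm : ∀ x, MeasurableSet (A x) := fun x => .iUnion fun j => .iUnion fun n => .iUnion fun _ =>
    (hKmeas _ _ _).inter (measurableSet_lt measurable_const (hAA.measurable _ _))
  have hmiss : Negligible ν fun x : ℝ => P ({ω | (x : EReal) < Z ω} \ A x) :=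
    negligible_exceed_diff_typical hf hinput hIA hAA hSE hH hFν hν ha hb hstable hN hKmeas hKindep
      hKunif hη
  obtain ⟨h, hh, hle⟩ := exists_negligible_tsum_typicalEvent_le hAA hSE hH hFν hN hKmeas hη hstable
  have hlower : integratedTail F =O[atTop] fun x : ℝ => P.real {ω | (x : EReal) < Z ω} := by
    obtain ⟨C, hC, hCle⟩ :=
      exists_le_mul_measure_maximalDater hf hinput hIA hAA hSE hH hFν ha (hb0.trans_lt hstable)
    refine hGν.symm.trans_isBigO (IsBigO.of_bound C.toReal ?_)
    filter_upwards [hCle] with x hx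
    rw [Real.norm_of_nonneg (tail_nonneg ν x), Real.norm_of_nonneg measureReal_nonneg]
    have h1 := ENNReal.toReal_mono (by finiteness) hx
    rwa [ENNReal.toReal_mul] at h1
  have hsmall : ∀ Z' : Ω → EReal, (∀ᵐ ω ∂P, Z' ω ≤ Z ω) →
      ((fun x : ℝ => P.real {ω | (x : EReal) < Z' ω}
          - P.real ({ω | (x : EReal) < Z' ω} ∩ A x)) =o[atTop] integratedTail F ∧
        (fun x : ℝ => P.real {ω | (x : EReal) < Z' ω}
          - ∑ j, P.real ({ω | (x : EReal) < Z' ω} ∩ Aⱼ j x)) =o[atTop] integratedTail F ∧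
        (fun x : ℝ => P.real {ω | (x : EReal) < Z' ω}
          - ∑ j, ∑' n : {n : ℕ // N x ≤ n},
            P.real ({ω | (x : EReal) < Z' ω} ∩ Aₙ j n x)) =o[atTop] integratedTail F) := by
    intro Z' hZ'
    set S : ℝ → Set Ω := fun x => {ω | (x : EReal) < Z' ω}
    have hS : ∀ x, P (S x) ≤ P (S x ∩ A x) + P ({ω | (x : EReal) < Z ω} \ A x) := fun x => by
      -- Only $\tilde Z\le Z$ enters: the part of $\{\tilde Z>x\}$ outside $A_x$ is controlled by
      -- the same part for $Z$.
      rw [← measure_inter_add_sdiff (S x) (hAm x)]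
      refine add_le_add_right (measure_mono_ae ?_) _
      filter_upwards [hZ'] with ω h1 h2 using ⟨lt_of_lt_of_le h2.1 h1, h2.2⟩
    have h01 : ∀ x, P (S x ∩ A x) ≤ ∑ j, P (S x ∩ Aⱼ j x) := fun x => by
      rw [Set.inter_iUnion]; exact measure_iUnion_fintype_le _ _
    have h12 : ∀ x, ∑ j, P (S x ∩ Aⱼ j x) ≤
        ∑ j, ∑' n : {n : ℕ // N x ≤ n}, P (S x ∩ Aₙ j n x) := fun x =>
      Finset.sum_le_sum fun j _ => by
        have h1 : Aⱼ j x = ⋃ n : {n : ℕ // N x ≤ n}, Aₙ j n x :=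
          (Set.iUnion_subtype (fun n => N x ≤ n) fun n => Aₙ j n x).symm
        rw [h1, Set.inter_iUnion]
        exact measure_iUnion_le _
    -- The quantities $\mathbf P(S\cap A)$, the sum over $j$ and the double sum increase in this
    -- order, so a lower bound for the first and this upper bound for the last squeeze all three
    -- around $\mathbf P(S)$.
    have h20 : ∀ᶠ x in atTop, ∑ j, ∑' n : {n : ℕ // N x ≤ n}, P (S x ∩ Aₙ j n x) ≤
        P (S x) + (P ({ω | (x : EReal) < Z ω} \ A x) + h x) := by
      filter_upwards [hle] with x hx
      exact (hx (S x)).trans (add_le_add (measure_mono Set.inter_subset_left) le_add_self)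
    have hS' : ∀ x, P (S x) ≤ P (S x ∩ A x) + (P ({ω | (x : EReal) < Z ω} \ A x) + h x) :=
      fun x => (hS x).trans (by gcongr; exact le_self_add)
    have hfin : ∀ x, P (S x) ≠ ∞ := fun x => measure_ne_top _ _
    have hg := hmiss.add hh
    have k0 := hg.isLittleO_toReal_sub (u := fun x => P (S x)) (v := fun x => P (S x ∩ A x)) hfin
      (.of_forall hS') (.of_forall fun x => (measure_mono Set.inter_subset_left).trans le_self_add)
    have k1 := hg.isLittleO_toReal_sub (u := fun x => P (S x))
      (v := fun x => ∑ j, P (S x ∩ Aⱼ j x)) hfin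
      (.of_forall fun x => (hS' x).trans (add_le_add_left (h01 x) _))
      (h20.mono fun x hx => (h12 x).trans hx)
    have k2 := hg.isLittleO_toReal_sub (u := fun x => P (S x))
      (v := fun x => ∑ j, ∑' n : {n : ℕ // N x ≤ n}, P (S x ∩ Aₙ j n x)) hfin
      (.of_forall fun x => (hS' x).trans (add_le_add_left ((h01 x).trans (h12 x)) _)) h20
    refine ⟨k0.trans_eventuallyEq hGν, (k1.trans_eventuallyEq hGν).congr_left fun x => ?_,
      (k2.trans_eventuallyEq hGν).congr' ?_ .rfl⟩
    · rw [ENNReal.toReal_sum fun j _ => measure_ne_top _ _]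
      rfl
    · filter_upwards [h20, hg 1 one_ne_zero] with x h1 h2
      have h3 := ne_top_of_le_ne_top (ENNReal.add_ne_top.2 ⟨hfin x,
        ne_top_of_le_ne_top (by finiteness) h2⟩) h1
      rw [ENNReal.toReal_sum (ENNReal.sum_ne_top.1 h3)]
      simp only [ENNReal.tsum_toReal_eq fun _ => measure_ne_top P _]
      rfl
  -- Once $\overline F^s=O(u)$, an error $o(\overline F^s)$ is $o(u)$. The bound comes from `hlower`
  -- for $Z$ and from the assumption $\Theta(\overline F^s)$ for $\tilde Z$.
  have hequiv : ∀ u v₀ v₁ v₂ : ℝ → ℝ, (u - v₀) =o[atTop] integratedTail F →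
      (u - v₁) =o[atTop] integratedTail F → (u - v₂) =o[atTop] integratedTail F →
      integratedTail F =O[atTop] u → u ~[atTop] v₀ ∧ v₀ ~[atTop] v₁ ∧ v₁ ~[atTop] v₂ := by
    intro u v₀ v₁ v₂ h0 h1 h2 hu
    have key : ∀ v : ℝ → ℝ, (u - v) =o[atTop] integratedTail F → v ~[atTop] u := fun v hv =>
      (hv.trans_isBigO hu).symm
    exact ⟨(key _ h0).symm, (key _ h0).trans (key _ h1).symm, (key _ h1).trans (key _ h2).symm⟩
  refine ⟨fun j x => (summable_typicalEvent hAA hSE hFν hη hstable j x).subtype _, ?_,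
    fun Z' _ hZ' => ⟨hsmall Z' hZ', fun hΘ => ?_⟩⟩
  · obtain ⟨h0, h1, h2⟩ := hsmall Z (.of_forall fun ω => le_rfl)
    exact hequiv _ _ _ _ h0 h1 h2 hlower
  · obtain ⟨h0, h1, h2⟩ := hsmall Z' hZ'
    exact hequiv _ _ _ _ h0 h1 h2 hΘ.isBigO_symm
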